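/- For a finite graph $G$ and $X\subseteq V(G)$ let $N_G(X)$ be the set of vertices outside $X$ that have a neighbour in $X$, and for $X,Y\subseteq V(G)$ let $e_G(X,Y)$ be the number of pairs $(x,y)\in X\times Y$ with $xy\in E(G)$. For $n\in\mathbb{N}$ and a real number $d>0$, an $n$-vertex graph $G$ is an $(n,d)$-expander if (i) $|N_G(X)|\ge d|X|$ for all $X\subseteq V(G)$ with $1\le |X|<\frac{n}{2d}$, and (ii) $e_G(X,Y)>0$ for all disjoint $X,Y\subseteq V(G)$ with $|X|=|Y|\ge \frac{n}{2d}$. Let $\mathcal{T}(n,\Delta)$ be the family of all $n$-vertex trees with maximum degree at most $\Delta$. A graph $G$ is $\mathcal{T}(n,\Delta)$-universal if it contains every member of $\mathcal{T}(n,\Delta)$ as a (not necessarily induced) subgraph. Theorem. There exist absolute constants $C,c>0$ and $n_0\in\mathbb{N}$ such that for all integers $n\ge n_0$ and all $\Delta\in\mathbb{N}$ with $\Delta\le c\sqrt{n}$, every $(n,C\Delta\sqrt{n})$-expander is $\mathcal{T}(n,\Delta)$-universal. -/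

import Mathlib

namespace TreeUniversality

open Classical in
/-- The external neighbourhood `N_G(X)` of a vertex set `X`: the vertices outside `X` that have a
neighbour in `X`. -/
noncomputable def extNeighbors {V : Type*} [Fintype V] (G : SimpleGraph V) (X : Finset V) :
    Finset V :=
  Finset.univ.filter fun y => y ∉ X ∧ ∃ x ∈ X, G.Adj x y

open Classical in
/-- The number `e_G(X, Y)` of pairs `(x, y)` in `X × Y` such that `xy` is an edge of `G`. -/
noncomputable def numEdgesBetween {V : Type*} (G : SimpleGraph V) (X Y : Finset V) : ℕ :=
  (G.interedges X Y).card

/-- `G` is an `(n, d)`-expander, for a natural number `n` and a real number `d > 0`. -/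
structure IsExpander {V : Type*} [Fintype V] (n : ℕ) (d : ℝ) (G : SimpleGraph V) : Prop where
  d_pos : 0 < d
  card_eq : Fintype.card V = n
  expands : ∀ X : Finset V, 1 ≤ X.card → (X.card : ℝ) < (n : ℝ) / (2 * d) →
    d * (X.card : ℝ) ≤ ((extNeighbors G X).card : ℝ)
  joined : ∀ X Y : Finset V, Disjoint X Y → X.card = Y.card → (n : ℝ) / (2 * d) ≤ (X.card : ℝ) →
    0 < numEdgesBetween G X Y

open Classical in
/-- The family `𝒯(n, Δ)` of all `n`-vertex trees with maximum degree at most `Δ`. Graphs are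
considered up to isomorphism, so the vertex set is taken to be `Fin n`. -/
def boundedDegreeTrees (n Δ : ℕ) : Set (SimpleGraph (Fin n)) :=
  {T | T.IsTree ∧ T.maxDegree ≤ Δ}

/-- `G` is universal for the family `𝓕`: it contains a (not necessarily induced) copy of every
member of `𝓕`. -/
def IsUniversal {V W : Type*} (G : SimpleGraph V) (𝓕 : Set (SimpleGraph W)) : Prop :=
  ∀ F ∈ 𝓕, F.IsContained G

end TreeUniversality

/-! Put `m = ⌈n/(2d)⌉` and `μ = Δ * m`. Two consequences of expansion suffice: disjoint sets of at
least `m` vertices are joined by an edge (`Joined`), and all degrees are at least `240 * μ`. With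
the chosen constants `n` has the order of `μ ^ 2`. By `Joined.card_low_lt`, fewer than `m` vertices
have fewer than `t` neighbours in a set of size at least `(t + 1) * m`.

Trees are embedded greedily from a root. An image without a free neighbour falls back on a token, a
vertex of a small reserve that every vertex sees many times. Each token used, apart from explicitly
exempted ones, is charged to a tree neighbour whose image is short of free vertices. There are fewer
than `m` such images and each has at most `Δ` tree neighbours, so about `Δ * m` tokens suffice
(`Charged.card_used_le`) as long as some free vertices remain. In the same way two embedded vertices
can be joined by a path of length three (`Emb.join`). What is left is to make the embedding
spanning, and here there are two cases.

Many leaves (`Joined.exists_emb_of_leaves`): a linear number of leaves is held back and finally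
matched to the unoccupied vertices by Hall's theorem. The condition can fail only because of fewer
than `m` vertices that see few parents of leaves. These are covered beforehand by small pieces cut
off the bottom of the tree (`Rooted.exists_cover`).

Few leaves (`Joined.exists_emb_of_paths`): there are linearly many disjoint bare paths.
`Joined.exists_absorber` builds pairs of vertices, called slots, and a set `A` that fills them
whenever any `45 * μ` vertices of `A` with distinct colours are missing. The tokens are coloured
vertices of `A`, and the colour is the label, so an embedding uses every colour at most once. One
inner vertex of many bare paths is held back, its two neighbours being placed on a slot. The
remaining bare paths sweep up all vertices outside `A`. Counting then shows that exactly `45 * μ`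
tokens are in use, so the rest of `A` fills the slots and the held-back vertices are embedded.

The absorber is made of `q = 120 * μ` components, one for each colour, and `75 * μ` lines. A
component fills its slots with all but one of its vertices, whichever that one is. A line needs one
further vertex and accepts one from any component. So the lines take the omitted vertices of `75 *
μ` components and exactly `45 * μ` vertices remain for the tree (`Network.absorbs`). -/

namespace TreeUniversality

set_option linter.unusedSectionVars false

/-! ### Joinedness, small reserves and colourings -/

section Expansion
open scoped Classical

variable {V : Type*} [Fintype V]

/-- The neighbourhood of a vertex as a finset. -/
noncomputable def nbr (G : SimpleGraph V) (v : V) : Finset V :=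
  Finset.univ.filter fun w => G.Adj v w

@[simp] lemma mem_nbr {G : SimpleGraph V} {v w : V} : w ∈ nbr G v ↔ G.Adj v w := by
  simp [nbr]

/-- Any two disjoint sets of at least `m` vertices are joined by an edge. -/
def Joined (G : SimpleGraph V) (m : ℕ) : Prop :=
  ∀ X Y : Finset V, Disjoint X Y → m ≤ X.card → m ≤ Y.card → ∃ x ∈ X, ∃ y ∈ Y, G.Adj x y

/-- The vertices with fewer than `t` neighbours in `R`. -/
noncomputable def low (G : SimpleGraph V) (R : Finset V) (t : ℕ) : Finset V :=
  Finset.univ.filter fun v => (nbr G v ∩ R).card < t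

lemma mem_low {G : SimpleGraph V} {R : Finset V} {t : ℕ} {v : V} :
    v ∈ low G R t ↔ (nbr G v ∩ R).card < t := by
  simp [low]

lemma low_mono {G : SimpleGraph V} {R R' : Finset V} {t t' : ℕ} (hR : R' ⊆ R) (ht : t ≤ t') :
    low G R t ⊆ low G R' t' := by
  intro v hv
  rw [mem_low] at *
  exact lt_of_le_of_lt (Finset.card_le_card (Finset.inter_subset_inter_left hR)) (by omega)

lemma Joined.pos {G : SimpleGraph V} {m : ℕ} (h : Joined G m) : 0 < m := by
  by_contra hm
  obtain ⟨x, hx, -⟩ := h ∅ ∅ (by simp) (by simp; omega) (by simp; omega)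
  simp at hx

/-- If `m` vertices had fewer than `t` neighbours in `R`, deleting them and these neighbours from
`R` would leave at least `(t + 1) * m - m - m * (t - 1) ≥ m` vertices with no edge to them. This is
the main way in which joinedness is used. -/
lemma Joined.card_low_lt {G : SimpleGraph V} {m : ℕ} (h : Joined G m) {R : Finset V} {t : ℕ}
    (hR : (t + 1) * m ≤ R.card) : (low G R t).card < m := by
  by_contra hm
  push Not at hm
  obtain ⟨X, hX, hXm⟩ := Finset.exists_subset_card_eq hm
  have hpos := h.pos
  have hb : (X.biUnion fun x => nbr G x ∩ R).card ≤ m * (t - 1) := by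
    rw [← hXm]
    refine Finset.card_biUnion_le_card_mul _ _ _ fun x hx => ?_
    have := mem_low.1 (hX hx)
    omega
  have ht : 0 < t := by
    obtain ⟨x, hx⟩ := Finset.card_pos.1 (hXm ▸ hpos)
    have := mem_low.1 (hX hx)
    omega
  have hY : m ≤ (R \ (X ∪ X.biUnion fun x => nbr G x ∩ R)).card := by
    have h1 := Finset.le_card_sdiff (X ∪ X.biUnion fun x => nbr G x ∩ R) R
    have h2 := Finset.card_union_le X (X.biUnion fun x => nbr G x ∩ R)
    obtain ⟨s, rfl⟩ : ∃ s, t = s + 1 := ⟨t - 1, by omega⟩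
    simp only [Nat.add_sub_cancel] at hb
    have : (s + 1 + 1) * m = m * s + m + m := by ring
    omega
  obtain ⟨x, hx, y, hy, hxy⟩ := h X _ (by
    rw [Finset.disjoint_left]
    intro a ha hb
    simp [ha] at hb) hXm.ge hY
  simp only [Finset.mem_sdiff, Finset.mem_union, Finset.mem_biUnion, not_or] at hy
  exact hy.2.2 ⟨x, hx, by simp [hxy, hy.1]⟩

/-- A reserve: a small set in which every vertex has at least `b` neighbours. -/
lemma Joined.exists_reserve {G : SimpleGraph V} {m b : ℕ} (h : Joined G m)
    (hb : ∀ v, b ≤ (nbr G v).card) (hn : (b + 1) * m ≤ Fintype.card V) :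
    ∃ A : Finset V, A.card ≤ (2 * b + 1) * m ∧ ∀ v, b ≤ (nbr G v ∩ A).card := by
  obtain ⟨R, -, hR⟩ := Finset.exists_subset_card_eq (s := (Finset.univ : Finset V))
    (n := (b + 1) * m) (by simpa using hn)
  have hlow := h.card_low_lt (R := R) (t := b) hR.ge
  choose N hN hNb using fun v => Finset.exists_subset_card_eq (hb v)
  -- An arbitrary set `R` of `(b + 1) * m` vertices serves all but fewer than `m` vertices; each
  -- exception contributes `b` neighbours of its own.
  refine ⟨R ∪ (low G R b).biUnion N, ?_, fun v => ?_⟩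
  · refine (Finset.card_union_le _ _).trans ?_
    have : ((low G R b).biUnion N).card ≤ (low G R b).card * b :=
      Finset.card_biUnion_le_card_mul _ _ _ fun x _ => (hNb x).le
    have h2 : (low G R b).card * b ≤ m * b := Nat.mul_le_mul_right _ hlow.le
    rw [hR]
    nlinarith
  · by_cases hv : v ∈ low G R b
    · refine (hNb v).ge.trans (Finset.card_le_card fun x hx => ?_)
      simp only [Finset.mem_inter, Finset.mem_union, Finset.mem_biUnion]
      exact ⟨hN v hx, Or.inr ⟨v, hv, hx⟩⟩
    · rw [mem_low, not_lt] at hv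
      exact hv.trans (Finset.card_le_card
        (Finset.inter_subset_inter_left Finset.subset_union_left))

/-- If every set of a family is large then some colouring with `2 * B` colours shows at least
`B` colours on each of them. -/
lemma exists_colouring_card_image (N : V → Finset V) (B : ℕ) (hB : 0 < B)
    (hN : ∀ v, 4 * B ≤ (N v).card) (hn : Fintype.card V < 4 ^ B) :
    ∃ c : V → Fin (2 * B), ∀ v, B ≤ ((N v).image c).card := by
  by_contra hcon
  push Not at hcon
  set M := Fintype.card V with hM
  have hNM : ∀ v, (N v).card ≤ M := fun v => Finset.card_le_univ _
  -- Union bound by counting: the colourings with all of `N v` coloured from a fixed set `K` of half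
  -- the colours are a fraction at most `2 ^ (-4B)` of all. There are at most `4 ^ B` sets `K` and
  -- fewer than `4 ^ B` vertices.
  let bad : V → Finset (Fin (2 * B)) → Finset (V → Fin (2 * B)) := fun v K =>
    Fintype.piFinset fun x => if x ∈ N v then K else Finset.univ
  have hbad : ∀ v, ∀ K : Finset (Fin (2 * B)), K.card = B →
      (bad v K).card * 2 ^ (4 * B) ≤ (2 * B) ^ M := by
    intro v K hK
    have h1 : (bad v K).card = B ^ (N v).card * (2 * B) ^ (M - (N v).card) := by
      simp only [bad, Fintype.card_piFinset, apply_ite Finset.card, hK, Finset.card_univ,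
        Fintype.card_fin]
      rw [Finset.prod_ite]
      simp only [Finset.prod_const]
      congr 2
      · congr 1; ext x; simp
      · rw [Finset.filter_not, Finset.card_sdiff_of_subset (Finset.filter_subset _ _)]
        congr 2; ext x; simp
    rw [h1]
    calc B ^ (N v).card * (2 * B) ^ (M - (N v).card) * 2 ^ (4 * B)
        ≤ B ^ (N v).card * (2 * B) ^ (M - (N v).card) * 2 ^ (N v).card := by
          gcongr
          · norm_num
          · exact hN v
      _ = (2 * B) ^ (N v).card * (2 * B) ^ (M - (N v).card) := by rw [mul_pow 2 B]; ring
      _ = (2 * B) ^ M := by rw [← pow_add, Nat.add_sub_cancel' (hNM v)]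
  have hcov : (Finset.univ : Finset (V → Fin (2 * B))) ⊆
      (Finset.univ : Finset V).biUnion fun v =>
        (Finset.powersetCard B (Finset.univ : Finset (Fin (2 * B)))).biUnion (bad v) := by
    intro c _
    obtain ⟨v, hv⟩ := hcon c
    obtain ⟨K, hK, hKc⟩ := Finset.exists_superset_card_eq (s := (N v).image c) (n := B)
      hv.le (by simp; omega)
    simp only [Finset.mem_biUnion, Finset.mem_univ, true_and, Finset.mem_powersetCard,
      Finset.subset_univ]
    refine ⟨v, K, hKc, ?_⟩
    simp only [bad, Fintype.mem_piFinset]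
    intro x
    split_ifs with hx
    · exact hK (Finset.mem_image_of_mem _ hx)
    · simp
  have hc := Finset.card_le_card hcov
  have hcard : (Finset.univ : Finset (V → Fin (2 * B))).card = (2 * B) ^ M := by
    simp [hM]
  rw [hcard] at hc
  have h2 : ((Finset.univ : Finset V).biUnion fun v =>
        (Finset.powersetCard B (Finset.univ : Finset (Fin (2 * B)))).biUnion (bad v)).card
        * 2 ^ (4 * B) ≤ M * (4 ^ B * (2 * B) ^ M) := by
    refine (Nat.mul_le_mul_right _ Finset.card_biUnion_le).trans ?_
    rw [Finset.sum_mul]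
    refine (Finset.sum_le_card_nsmul _ _ (4 ^ B * (2 * B) ^ M) fun v _ => ?_).trans
      (by simp [hM])
    refine (Nat.mul_le_mul_right _ Finset.card_biUnion_le).trans ?_
    rw [Finset.sum_mul]
    refine (Finset.sum_le_card_nsmul _ _ ((2 * B) ^ M) fun K hK =>
      hbad v K (Finset.mem_powersetCard.1 hK).2).trans ?_
    rw [smul_eq_mul]
    gcongr
    rw [Finset.card_powersetCard, Finset.card_univ, Fintype.card_fin]
    calc (2 * B).choose B ≤ 2 ^ (2 * B) := Nat.choose_le_two_pow _ _
      _ = 4 ^ B := by rw [pow_mul]; norm_num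
  have h3 : (2 * B) ^ M * 2 ^ (4 * B) ≤ M * (4 ^ B * (2 * B) ^ M) :=
    (Nat.mul_le_mul_right _ hc).trans h2
  have hpos : 0 < (2 * B) ^ M := by positivity
  have h4 : 2 ^ (4 * B) ≤ M * 4 ^ B := by
    refine Nat.le_of_mul_le_mul_left (c := (2 * B) ^ M) ?_ hpos
    calc _ ≤ _ := h3
      _ = _ := by ring
  have h5 : (2 : ℕ) ^ (4 * B) = 4 ^ B * 4 ^ B := by
    rw [← mul_pow, pow_mul]; norm_num
  rw [h5] at h4
  have := Nat.le_of_mul_le_mul_right h4 (by positivity)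
  omega

end Expansion

/-! ### Greedy embedding with tokens as a last resort -/

section Engine
open scoped Classical

variable {V W L : Type*} [Fintype V] [Fintype W]

/-- Static data for partial embeddings: labels (each to be used at most once), the allowed vertices,
and among them the tokens, which are used only when nothing else is available. -/
structure Palette (V L : Type*) where
  label : V → L
  allowed : Finset V
  tokens : Finset V
  tokens_subset : tokens ⊆ allowed
  label_inj : ∀ c ∈ allowed, c ∉ tokens → ∀ c' ∈ allowed, label c = label c' → c = c'

/-- `φ` embeds the part of `T` on `D` into the allowed vertices, using every label at most once. -/
structure Emb (G : SimpleGraph V) (T : SimpleGraph W) (P : Palette V L) (D : Finset W)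
    (φ : W → V) : Prop where
  inj : ∀ u ∈ D, ∀ v ∈ D, P.label (φ u) = P.label (φ v) → u = v
  mem : ∀ w ∈ D, φ w ∈ P.allowed
  adj : ∀ u ∈ D, ∀ v ∈ D, T.Adj u v → G.Adj (φ u) (φ v)

/-- The unoccupied allowed vertices that are not tokens. -/
noncomputable def Palette.free (P : Palette V L) (D : Finset W) (φ : W → V) : Finset V :=
  (P.allowed \ P.tokens) \ D.image φ

/-- The labels of tokens adjacent to a vertex. -/
noncomputable def Palette.hits (P : Palette V L) (G : SimpleGraph V) (v : V) : Finset L :=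
  (nbr G v ∩ P.tokens).image P.label

/-- The tree vertices placed on tokens. -/
noncomputable def Palette.used (P : Palette V L) (D : Finset W) (φ : W → V) : Finset W :=
  D.filter fun w => φ w ∈ P.tokens

variable {G : SimpleGraph V} {T : SimpleGraph W} {P : Palette V L} {D D' : Finset W}
  {φ φ' : W → V} {m t Δ : ℕ}

lemma Palette.mem_free {c : V} : c ∈ P.free D φ ↔
    c ∈ P.allowed ∧ c ∉ P.tokens ∧ ∀ w ∈ D, φ w ≠ c := by
  simp [Palette.free, and_assoc]

lemma Palette.mem_used {w : W} : w ∈ P.used D φ ↔ w ∈ D ∧ φ w ∈ P.tokens := by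
  simp [Palette.used]

lemma Palette.free_anti (hD : D ⊆ D') (h : ∀ w ∈ D, φ' w = φ w) :
    P.free D' φ' ⊆ P.free D φ := by
  intro c hc
  rw [Palette.mem_free] at *
  exact ⟨hc.1, hc.2.1, fun w hw => h w hw ▸ hc.2.2 w (hD hw)⟩

lemma Palette.card_le_card_free : (P.allowed \ P.tokens).card ≤ (P.free D φ).card + D.card := by
  have h1 := Finset.le_card_sdiff (D.image φ) (P.allowed \ P.tokens)
  have h2 : (D.image φ).card ≤ D.card := Finset.card_image_le
  rw [Palette.free]
  omega

lemma Palette.card_used_le (h : ∀ w ∈ D, φ' w = φ w) :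
    (P.used D' φ').card ≤ (P.used D φ).card + (D' \ D).card := by
  rw [← Finset.card_union_of_disjoint]
  · refine Finset.card_le_card fun w hw => ?_
    rw [Palette.mem_used] at hw
    rw [Finset.mem_union, Palette.mem_used, Finset.mem_sdiff]
    by_cases hwD : w ∈ D
    · exact Or.inl ⟨hwD, h w hwD ▸ hw.2⟩
    · exact Or.inr ⟨hw.1, hwD⟩
  · rw [Finset.disjoint_left]
    intro w hw hw'
    exact (Finset.mem_sdiff.1 hw').2 (Palette.mem_used.1 hw).1

lemma Emb.injOn (E : Emb G T P D φ) : ∀ u ∈ D, ∀ v ∈ D, φ u = φ v → u = v :=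
  fun u hu v hv h => E.inj u hu v hv (by rw [h])

lemma Emb.addVertex (E : Emb G T P D φ) {v : W} {c : V} (hv : v ∉ D) (hc : c ∈ P.allowed)
    (hl : ∀ w ∈ D, P.label (φ w) ≠ P.label c) (ha : ∀ b ∈ D, T.Adj b v → G.Adj (φ b) c) :
    Emb G T P (insert v D) (Function.update φ v c) := by
  have hne : ∀ w ∈ D, Function.update φ v c w = φ w := fun w hw =>
    Function.update_of_ne (by rintro rfl; exact hv hw) _ _
  have hself : Function.update φ v c v = c := Function.update_self _ _ _
  refine ⟨fun u hu w hw h => ?_, fun w hw => ?_, fun u hu w hw h => ?_⟩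
  · rcases Finset.mem_insert.1 hu with hu' | hu' <;> rcases Finset.mem_insert.1 hw with hw' | hw'
    · rw [hu', hw']
    · rw [hne w hw', hu', hself] at h
      exact absurd h.symm (hl w hw')
    · rw [hne u hu', hw', hself] at h
      exact absurd h (hl u hu')
    · rw [hne u hu', hne w hw'] at h
      exact E.inj u hu' w hw' h
  · rcases Finset.mem_insert.1 hw with hw' | hw'
    · rwa [hw', hself]
    · rw [hne w hw']; exact E.mem w hw'
  · rcases Finset.mem_insert.1 hu with hu' | hu' <;> rcases Finset.mem_insert.1 hw with hw' | hw'
    · rw [hu', hw'] at h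
      exact absurd h (T.loopless.irrefl _)
    · rw [hne w hw', hu', hself]
      exact (ha w hw' (hu' ▸ h.symm)).symm
    · rw [hne u hu', hw', hself]
      exact ha u hu' (hw' ▸ h)
    · rw [hne u hu', hne w hw']
      exact E.adj u hu' w hw' h

/-- An occupied label of a token is occupied by a token. -/
lemma Emb.exists_used (E : Emb G T P D φ) {c : V} (hc : c ∈ P.tokens) {w : W} (hw : w ∈ D)
    (h : P.label (φ w) = P.label c) : w ∈ P.used D φ := by
  rw [Palette.mem_used]
  refine ⟨hw, ?_⟩
  by_contra hn
  exact hn (P.label_inj _ (E.mem w hw) hn c (P.tokens_subset hc) h ▸ hc)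

lemma Emb.label_ne_of_free (E : Emb G T P D φ) {c : V} (hc : c ∈ P.free D φ) :
    ∀ w ∈ D, P.label (φ w) ≠ P.label c := by
  rw [Palette.mem_free] at hc
  intro w hw h
  exact hc.2.2 w hw (P.label_inj c hc.1 hc.2.1 _ (E.mem w hw) h.symm).symm

/-- Attaching one vertex to an embedded vertex. -/
lemma Emb.attach (E : Emb G T P D φ) {a v : W} (hv : v ∉ D)
    (hnb : ∀ b ∈ D, T.Adj b v → b = a) (hH : (P.used D φ).card < (P.hits G (φ a)).card) :
    ∃ φ' : W → V, (∀ w ∈ D, φ' w = φ w) ∧ Emb G T P (insert v D) φ' ∧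
      (φ' v ∈ P.tokens → nbr G (φ a) ∩ P.free D φ = ∅) := by
  have key : ∀ c ∈ P.allowed, (∀ w ∈ D, P.label (φ w) ≠ P.label c) → G.Adj (φ a) c →
      (c ∈ P.tokens → nbr G (φ a) ∩ P.free D φ = ∅) →
      ∃ φ' : W → V, (∀ w ∈ D, φ' w = φ w) ∧ Emb G T P (insert v D) φ' ∧
      (φ' v ∈ P.tokens → nbr G (φ a) ∩ P.free D φ = ∅) := by
    intro c hc hl hac htok
    refine ⟨Function.update φ v c, fun w hw => Function.update_of_ne (by rintro rfl; exact hv hw) _ _,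
      E.addVertex hv hc hl fun b hb hbv => ?_, ?_⟩
    · rw [hnb b hb hbv]; exact hac
    · rwa [Function.update_self]
  by_cases hne : (nbr G (φ a) ∩ P.free D φ).Nonempty
  · obtain ⟨c, hc⟩ := hne
    rw [Finset.mem_inter, mem_nbr] at hc
    have hc' := Palette.mem_free.1 hc.2
    exact key c hc'.1 (E.label_ne_of_free hc.2) hc.1 fun h => absurd h hc'.2.1
  · rw [Finset.not_nonempty_iff_eq_empty] at hne
    -- Only embedded vertices on tokens can occupy a token label, so `φ a` sees a token whose label
    -- is still available.
    have hlt : ((P.used D φ).image fun w => P.label (φ w)).card < (P.hits G (φ a)).card :=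
      lt_of_le_of_lt Finset.card_image_le hH
    obtain ⟨l, hl, hl'⟩ := Finset.exists_mem_notMem_of_card_lt_card hlt
    simp only [Palette.hits, Finset.mem_image, Finset.mem_inter, mem_nbr] at hl
    obtain ⟨c, ⟨hac, hct⟩, rfl⟩ := hl
    refine key c (P.tokens_subset hct) (fun w hw h => hl' ?_) hac fun _ => hne
    exact Finset.mem_image.2 ⟨w, E.exists_used hct hw h, h⟩

/-- Supplies one side of the edge sought in `Emb.join`. A vertex with `2 * m` free neighbours keeps
`m` of them once the labels in `Λ` are forbidden, because free vertices have distinct labels.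
Otherwise the candidates are tokens with distinct available labels, and `p` is a vertex to which
they can be charged. -/
lemma Emb.exists_candidates (E : Emb G T P D φ) (p : V) (Λ : Finset L) (hΛ : Λ.card ≤ m)
    (hH : (P.used D φ).card + 2 * m ≤ (P.hits G p).card) :
    ∃ X : Finset V, X.card = m ∧ (∀ c ∈ X, G.Adj p c ∧ c ∈ P.allowed ∧ P.label c ∉ Λ ∧
      (∀ w ∈ D, P.label (φ w) ≠ P.label c) ∧ (c ∈ P.tokens → p ∈ low G (P.free D φ) (2 * m))) := by
  by_cases hp : p ∈ low G (P.free D φ) (2 * m)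
  · have h1 : m ≤ ((P.hits G p \ Λ) \ ((P.used D φ).image fun w => P.label (φ w))).card := by
      have a1 := Finset.le_card_sdiff ((P.used D φ).image fun w => P.label (φ w)) (P.hits G p \ Λ)
      have a2 := Finset.le_card_sdiff Λ (P.hits G p)
      have a3 : ((P.used D φ).image fun w => P.label (φ w)).card ≤ (P.used D φ).card :=
        Finset.card_image_le
      omega
    obtain ⟨Y, hY, hYm⟩ := Finset.exists_subset_card_eq h1
    have h2 : ∀ l ∈ Y, ∃ c, (G.Adj p c ∧ c ∈ P.tokens) ∧ P.label c = l := by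
      intro l hl
      have := hY hl
      simp only [Finset.mem_sdiff, Palette.hits, Finset.mem_image, Finset.mem_inter,
        mem_nbr] at this
      exact this.1.1
    have : Nonempty V := ⟨p⟩
    choose! r hr hrl using h2
    refine ⟨Y.image r, ?_, fun c hc => ?_⟩
    · rw [Finset.card_image_of_injOn, hYm]
      intro l hl l' hl' h
      rw [← hrl l hl, ← hrl l' hl', h]
    · obtain ⟨l, hl, rfl⟩ := Finset.mem_image.1 hc
      have h3 := hY hl
      simp only [Finset.mem_sdiff] at h3
      refine ⟨(hr l hl).1, P.tokens_subset (hr l hl).2, ?_, fun w hw h => h3.2 ?_, fun _ => hp⟩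
      · rw [hrl l hl]; exact h3.1.2
      · exact Finset.mem_image.2 ⟨w, E.exists_used (hr l hl).2 hw h, by rw [h, hrl l hl]⟩
  · have hp' := hp
    rw [mem_low, not_lt] at hp'
    have h1 : ((nbr G p ∩ P.free D φ).filter fun c => P.label c ∈ Λ).card ≤ Λ.card := by
      refine Finset.card_le_card_of_injOn P.label (fun c hc => ?_) fun c hc c' hc' h => ?_
      · exact (Finset.mem_filter.1 hc).2
      · have a1 := Palette.mem_free.1 (Finset.mem_inter.1 (Finset.mem_filter.1 hc).1).2
        have a2 := Palette.mem_free.1 (Finset.mem_inter.1 (Finset.mem_filter.1 hc').1).2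
        exact P.label_inj c a1.1 a1.2.1 c' a2.1 h
    have h2 := Finset.card_filter_add_card_filter_not (s := nbr G p ∩ P.free D φ)
      (fun c => P.label c ∈ Λ)
    obtain ⟨X, hX, hXm⟩ := Finset.exists_subset_card_eq
      (s := (nbr G p ∩ P.free D φ).filter fun c => P.label c ∉ Λ) (n := m) (by omega)
    refine ⟨X, hXm, fun c hc => ?_⟩
    have h3 := hX hc
    rw [Finset.mem_filter, Finset.mem_inter, mem_nbr] at h3
    have h4 := Palette.mem_free.1 h3.1.2
    exact ⟨h3.1.1, h4.1, h3.2, E.label_ne_of_free h3.1.2, fun h => absurd h h4.2.1⟩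

/-- Joining two embedded vertices by a path of length three. -/
lemma Emb.join (E : Emb G T P D φ) (hJ : Joined G m) {a x y b : W}
    (hx : x ∉ D) (hy : y ∉ D) (hxy : x ≠ y) (hxa : ∀ c ∈ D, T.Adj c x → c = a)
    (hyb : ∀ c ∈ D, T.Adj c y → c = b)
    (hH : ∀ v, (P.used D φ).card + 2 * m ≤ (P.hits G v).card) :
    ∃ φ' : W → V, (∀ w ∈ D, φ' w = φ w) ∧ Emb G T P (insert y (insert x D)) φ' ∧
      (φ' x ∈ P.tokens → φ a ∈ low G (P.free D φ) (2 * m)) ∧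
      (φ' y ∈ P.tokens → φ b ∈ low G (P.free D φ) (2 * m)) := by
  obtain ⟨X, hXm, hX⟩ := E.exists_candidates (φ a) ∅ (by simp) (hH _)
  -- Forbidding the labels of `X` makes the candidate sets disjoint, as joinedness demands, and
  -- keeps the two new vertices from sharing a label.
  obtain ⟨Y, hYm, hY⟩ := E.exists_candidates (φ b) (X.image P.label)
    (hXm ▸ Finset.card_image_le) (hH _)
  obtain ⟨p, hp, q, hq, hpq⟩ := hJ X Y (by
    rw [Finset.disjoint_left]
    intro c hc hc'
    exact (hY c hc').2.2.1 (Finset.mem_image_of_mem _ hc)) hXm.ge hYm.ge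
  have hl : P.label p ≠ P.label q := fun h =>
    (hY q hq).2.2.1 (h ▸ Finset.mem_image_of_mem _ hp)
  have e1 : ∀ w ∈ D, Function.update φ x p w = φ w := fun w hw =>
    Function.update_of_ne (by rintro rfl; exact hx hw) _ _
  have E1 : Emb G T P (insert x D) (Function.update φ x p) :=
    E.addVertex hx (hX p hp).2.1 (hX p hp).2.2.2.1 fun c hc hcx => by
      rw [hxa c hc hcx]; exact (hX p hp).1
  have hy' : y ∉ insert x D := by simp [hy, Ne.symm hxy]
  have E2 : Emb G T P (insert y (insert x D))
      (Function.update (Function.update φ x p) y q) := by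
    refine E1.addVertex hy' (hY q hq).2.1 (fun w hw => ?_) fun c hc hcy => ?_
    · rcases Finset.mem_insert.1 hw with rfl | hw
      · rwa [Function.update_self]
      · rw [e1 w hw]; exact (hY q hq).2.2.2.1 w hw
    · rcases Finset.mem_insert.1 hc with rfl | hc
      · rwa [Function.update_self]
      · rw [e1 c hc, hyb c hc hcy]; exact (hY q hq).1
  refine ⟨_, fun w hw => ?_, E2, ?_, ?_⟩
  · rw [Function.update_of_ne (by rintro rfl; exact hy hw), e1 w hw]
  · rw [Function.update_of_ne hxy, Function.update_self]
    exact (hX p hp).2.2.2.2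
  · rw [Function.update_self]
    exact (hY q hq).2.2.2.2

/-- Every used token is exempt, or next to an embedded vertex that has run out of free
neighbours. -/
def Charged (G : SimpleGraph V) (T : SimpleGraph W) (P : Palette V L) (Z : Finset V) (t : ℕ)
    (D : Finset W) (φ : W → V) : Prop :=
  ∀ w ∈ D, φ w ∈ P.tokens → φ w ∈ Z ∨ ∃ b ∈ D, T.Adj b w ∧ φ b ∈ low G (P.free D φ) t

/-- As the embedding grows the free set shrinks, so a vertex short of free neighbours stays short
and old charges remain valid. -/
lemma Charged.mono {Z : Finset V} (I : Charged G T P Z t D φ) (hD : D ⊆ D')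
    (h : ∀ w ∈ D, φ' w = φ w)
    (hnew : ∀ w ∈ D', w ∉ D → φ' w ∈ P.tokens → φ' w ∈ Z ∨
      ∃ b ∈ D', T.Adj b w ∧ φ' b ∈ low G (P.free D φ) t) : Charged G T P Z t D' φ' := by
  have hl := low_mono (G := G) (P.free_anti hD h) le_rfl (t := t)
  intro w hw hwt
  by_cases hwD : w ∈ D
  · rw [h w hwD] at hwt ⊢
    rcases I w hwD hwt with hz | ⟨b, hb, hbw, hbl⟩
    · exact Or.inl hz
    · exact Or.inr ⟨b, hD hb, hbw, by rw [h b hb]; exact hl hbl⟩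
  · rcases hnew w hw hwD hwt with hz | ⟨b, hb, hbw, hbl⟩
    · exact Or.inl hz
    · exact Or.inr ⟨b, hb, hbw, hl hbl⟩

/-- While `(t + 1) * m` free vertices remain, fewer than `m` vertices have fewer than `t` free
neighbours. Each of them carries at most one tree vertex, which is charged for at most `Δ` tokens.
Hence the reserve never runs out. -/
lemma Charged.card_used_le {Z : Finset V} (I : Charged G T P Z t D φ) (E : Emb G T P D φ)
    (hJ : Joined G m) (hΔ : ∀ w, (nbr T w).card ≤ Δ)
    (hf : D.card + (t + 1) * m ≤ (P.allowed \ P.tokens).card) :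
    (P.used D φ).card ≤ Z.card + Δ * m := by
  have hlow := hJ.card_low_lt (R := P.free D φ) (t := t)
    (by have := P.card_le_card_free (D := D) (φ := φ); omega)
  set B := D.filter fun b => φ b ∈ low G (P.free D φ) t with hB
  have hBc : B.card ≤ (low G (P.free D φ) t).card := by
    refine Finset.card_le_card_of_injOn φ (fun b hb => (Finset.mem_filter.1 hb).2) ?_
    intro u hu v hv h
    exact E.injOn u (Finset.mem_filter.1 hu).1 v (Finset.mem_filter.1 hv).1 h
  have hZc : (D.filter fun w => φ w ∈ Z).card ≤ Z.card := by
    refine Finset.card_le_card_of_injOn φ (fun b hb => (Finset.mem_filter.1 hb).2) ?_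
    intro u hu v hv h
    exact E.injOn u (Finset.mem_filter.1 hu).1 v (Finset.mem_filter.1 hv).1 h
  have hsub : P.used D φ ⊆ (D.filter fun w => φ w ∈ Z) ∪ B.biUnion (nbr T) := by
    intro w hw
    rw [Palette.mem_used] at hw
    rw [Finset.mem_union, Finset.mem_filter, Finset.mem_biUnion]
    rcases I w hw.1 hw.2 with hz | ⟨b, hb, hbw, hbl⟩
    · exact Or.inl ⟨hw.1, hz⟩
    · exact Or.inr ⟨b, Finset.mem_filter.2 ⟨hb, hbl⟩, by simpa using hbw⟩
  have h1 := Finset.card_le_card hsub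
  have h2 := Finset.card_union_le (D.filter fun w => φ w ∈ Z) (B.biUnion (nbr T))
  have h3 : (B.biUnion (nbr T)).card ≤ B.card * Δ :=
    Finset.card_biUnion_le_card_mul _ _ _ fun b _ => hΔ b
  have h4 : B.card * Δ ≤ Δ * m := by
    rw [mul_comm]; exact Nat.mul_le_mul_left _ (by omega)
  omega

/-- A parent function and a depth function for a tree rooted at `ρ`. -/
structure Rooted (T : SimpleGraph W) (ρ : W) (par : W → W) (dep : W → ℕ) : Prop where
  par_root : par ρ = ρ
  adj_par : ∀ v, v ≠ ρ → T.Adj (par v) v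
  dep_par : ∀ v, v ≠ ρ → dep v = dep (par v) + 1
  dep_root : dep ρ = 0
  adj_cases : ∀ u v, T.Adj u v → (u = par v ∧ v ≠ ρ) ∨ (v = par u ∧ u ≠ ρ)

/-- Depth is the distance from `ρ`, and the parent is the next vertex on a shortest path to `ρ`. Two
neighbours one level closer to `ρ` would give two paths from `ρ`, so every edge joins a vertex to
its parent. -/
lemma _root_.SimpleGraph.IsTree.exists_rooted (hT : T.IsTree) (ρ : W) :
    ∃ par dep, Rooted T ρ par dep := by
  have h1 : ∀ v, v ≠ ρ → ∃ u, T.Adj u v ∧ T.dist ρ v = T.dist ρ u + 1 := by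
    intro v hv
    obtain ⟨p, hp⟩ := hT.connected.exists_walk_length_eq_dist v ρ
    cases p with
    | nil => exact absurd rfl hv
    | @cons _ u _ h q =>
      refine ⟨u, h.symm, ?_⟩
      rw [SimpleGraph.Walk.length_cons] at hp
      have h2 : T.dist u ρ ≤ q.length := SimpleGraph.dist_le q
      have h3 := hT.dist_eq_dist_add_one_of_adj ρ h
      rw [T.dist_comm (u := ρ), T.dist_comm (u := ρ)] at *
      omega
  choose! p hp hpd using h1
  refine ⟨fun v => if v = ρ then ρ else p v, T.dist ρ, by simp, fun v hv => ?_, fun v hv => ?_,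
    by simp, ?_⟩
  · simpa [hv] using hp v hv
  · simpa [hv] using hpd v hv
  · have huniq : ∀ u v, T.Adj u v → T.dist ρ v = T.dist ρ u + 1 → v ≠ ρ ∧ u = p v := by
      intro u v huv hd
      have hv : v ≠ ρ := by
        rintro rfl
        simp at hd
      refine ⟨hv, ?_⟩
      obtain ⟨q, hq⟩ := hT.connected.exists_walk_length_eq_dist ρ u
      obtain ⟨q', hq'⟩ := hT.connected.exists_walk_length_eq_dist ρ (p v)
      have hqp : (q.concat huv).IsPath := by
        apply SimpleGraph.Walk.isPath_of_length_eq_dist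
        rw [SimpleGraph.Walk.length_concat]; omega
      have hqp' : (q'.concat (hp v hv)).IsPath := by
        apply SimpleGraph.Walk.isPath_of_length_eq_dist
        have := hpd v hv
        rw [SimpleGraph.Walk.length_concat]; omega
      have := (hT.existsUnique_path ρ v).unique hqp hqp'
      exact (SimpleGraph.Walk.concat_inj this).1
    intro u v huv
    rcases hT.dist_eq_dist_add_one_of_adj ρ huv with h | h
    · obtain ⟨a, b⟩ := huniq v u huv.symm h
      right; exact ⟨by simp [a, b], a⟩
    · obtain ⟨a, b⟩ := huniq u v huv h
      left; exact ⟨by simp [a, b], a⟩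

variable {ρ : W} {par : W → W} {dep : W → ℕ}

/-- Extending an embedding along the parent function. -/
lemma Emb.extend (R : Rooted T ρ par dep) (hJ : Joined G m) (hΔ : ∀ w, (nbr T w).card ≤ Δ)
    {Z : Finset V} (ht : 1 ≤ t) (hDD : D ⊆ D')
    (h1 : ∀ v ∈ D', v ∉ D → v ≠ ρ ∧ par v ∈ D')
    (h2 : ∀ c ∈ D, c = ρ ∨ par c ∈ D ∨ par c ∉ D')
    (hf : D'.card + (t + 1) * m ≤ (P.allowed \ P.tokens).card)
    (hH : ∀ v, Z.card + Δ * m < (P.hits G v).card)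
    (E : Emb G T P D φ) (I : Charged G T P Z t D φ) :
    ∃ φ' : W → V, (∀ w ∈ D, φ' w = φ w) ∧ Emb G T P D' φ' ∧ Charged G T P Z t D' φ' := by
  induction hk : (D' \ D).card generalizing D φ with
  | zero =>
    have : D' = D := by
      rw [Finset.card_eq_zero, Finset.sdiff_eq_empty_iff_subset] at hk
      exact Finset.Subset.antisymm hk hDD
    subst this
    exact ⟨φ, fun _ _ => rfl, E, I⟩
  | succ k ih =>
    -- The parent of a missing vertex of least depth is already embedded. By `h2` no missing vertex
    -- is the parent of a vertex of `D`, so the parent is the only embedded neighbour.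
    obtain ⟨v, hv, hmin⟩ := (D' \ D).exists_min_image dep (Finset.card_pos.1 (by omega))
    rw [Finset.mem_sdiff] at hv
    obtain ⟨hvρ, hpar⟩ := h1 v hv.1 hv.2
    have hpD : par v ∈ D := by
      by_contra hn
      have := hmin (par v) (Finset.mem_sdiff.2 ⟨hpar, hn⟩)
      have := R.dep_par v hvρ
      omega
    have hu := I.card_used_le E hJ hΔ (by have := Finset.card_le_card hDD; omega)
    obtain ⟨φ₁, e₁, E₁, t₁⟩ := E.attach hv.2 (fun b hb hbv => by
      rcases R.adj_cases b v hbv with h | h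
      · exact h.1
      · exfalso
        rcases h2 b hb with h3 | h3 | h3
        · exact h.2 h3
        · exact hv.2 (h.1 ▸ h3)
        · exact h3 (h.1 ▸ hv.1)) (by have := hH (φ (par v)); omega)
    have hsub : insert v D ⊆ D' := Finset.insert_subset hv.1 hDD
    have I₁ : Charged G T P Z t (insert v D) φ₁ := by
      refine I.mono (Finset.subset_insert _ _) e₁ fun w hw hwD hwt => Or.inr ?_
      obtain rfl : w = v := by simpa [hwD] using hw
      refine ⟨par w, Finset.mem_insert_of_mem hpD, R.adj_par w hvρ, ?_⟩
      -- `Emb.attach` takes a token only if the parent has no free neighbour at all, so any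
      -- threshold `t ≥ 1` is met.
      rw [e₁ _ hpD, mem_low, t₁ hwt, Finset.card_empty]
      exact ht
    obtain ⟨φ₂, e₂, E₂, I₂⟩ := ih hsub
      (fun w hw hwD => h1 w hw fun h => hwD (Finset.mem_insert_of_mem h))
      (fun c hc => by
        rcases Finset.mem_insert.1 hc with rfl | hc
        · exact Or.inr (Or.inl (Finset.mem_insert_of_mem hpD))
        · rcases h2 c hc with h | h | h
          · exact Or.inl h
          · exact Or.inr (Or.inl (Finset.mem_insert_of_mem h))
          · exact Or.inr (Or.inr h)) E₁ I₁ (by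
        rw [Finset.sdiff_insert, Finset.card_erase_of_mem (Finset.mem_sdiff.2 hv)]
        omega)
    exact ⟨φ₂, fun w hw => (e₂ w (Finset.mem_insert_of_mem hw)).trans (e₁ w hw), E₂, I₂⟩

/-- Joining a family of pairs of embedded vertices by disjoint paths of length three. -/
lemma Emb.join_family (hJ : Joined G m) {Z : Finset V} {ι : Type*} (K : Finset ι)
    (a x y b : ι → W) (E : Emb G T P D φ) (I : Charged G T P Z (2 * m) D φ)
    (ha : ∀ i ∈ K, a i ∈ D) (hb : ∀ i ∈ K, b i ∈ D) (hx : ∀ i ∈ K, x i ∉ D)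
    (hy : ∀ i ∈ K, y i ∉ D) (hxy : ∀ i ∈ K, ∀ j ∈ K, x i ≠ y j)
    (hxx : ∀ i ∈ K, ∀ j ∈ K, x i = x j → i = j) (hyy : ∀ i ∈ K, ∀ j ∈ K, y i = y j → i = j)
    (hax : ∀ i ∈ K, T.Adj (a i) (x i)) (hby : ∀ i ∈ K, T.Adj (b i) (y i))
    (hxa : ∀ i ∈ K, ∀ c, T.Adj c (x i) → c = a i ∨ c = y i)
    (hyb : ∀ i ∈ K, ∀ c, T.Adj c (y i) → c = x i ∨ c = b i)
    (hH : ∀ D' φ', D ⊆ D' → D' ⊆ D ∪ K.image x ∪ K.image y → (∀ w ∈ D, φ' w = φ w) →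
      Emb G T P D' φ' → Charged G T P Z (2 * m) D' φ' →
      ∀ v, (P.used D' φ').card + 2 * m ≤ (P.hits G v).card) :
    ∃ φ' : W → V, (∀ w ∈ D, φ' w = φ w) ∧ Emb G T P (D ∪ K.image x ∪ K.image y) φ' ∧
      Charged G T P Z (2 * m) (D ∪ K.image x ∪ K.image y) φ' := by
  induction K using Finset.induction_on with
  | empty => exact ⟨φ, fun _ _ => rfl, by simpa using E, by simpa using I⟩
  | insert i K hi ih =>
    have hs : D ∪ K.image x ∪ K.image y ⊆
        D ∪ (insert i K).image x ∪ (insert i K).image y := by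
      gcongr <;> exact Finset.subset_insert _ _
    obtain ⟨φ₁, e₁, E₁, I₁⟩ := ih (fun j hj => ha j (Finset.mem_insert_of_mem hj))
      (fun j hj => hb j (Finset.mem_insert_of_mem hj))
      (fun j hj => hx j (Finset.mem_insert_of_mem hj))
      (fun j hj => hy j (Finset.mem_insert_of_mem hj))
      (fun j hj k hk => hxy j (Finset.mem_insert_of_mem hj) k (Finset.mem_insert_of_mem hk))
      (fun j hj k hk => hxx j (Finset.mem_insert_of_mem hj) k (Finset.mem_insert_of_mem hk))
      (fun j hj k hk => hyy j (Finset.mem_insert_of_mem hj) k (Finset.mem_insert_of_mem hk))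
      (fun j hj => hax j (Finset.mem_insert_of_mem hj))
      (fun j hj => hby j (Finset.mem_insert_of_mem hj))
      (fun j hj => hxa j (Finset.mem_insert_of_mem hj))
      (fun j hj => hyb j (Finset.mem_insert_of_mem hj))
      (fun D' φ' a b => hH D' φ' a (b.trans hs))
    obtain ⟨D₁, hD₁⟩ : ∃ D₁, D₁ = D ∪ K.image x ∪ K.image y := ⟨_, rfl⟩
    rw [← hD₁] at hs E₁ I₁
    have hDD₁ : D ⊆ D₁ := hD₁ ▸ Finset.subset_union_left.trans Finset.subset_union_left
    have hi' := Finset.mem_insert_self i K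
    have hx₁ : x i ∉ D₁ := by
      simp only [hD₁, Finset.mem_union, Finset.mem_image, not_or, not_exists, not_and]
      exact ⟨⟨hx i hi', fun j hj h => hi (hxx j (Finset.mem_insert_of_mem hj) i hi' h ▸ hj)⟩,
        fun j hj h => hxy i hi' j (Finset.mem_insert_of_mem hj) h.symm⟩
    have hy₁ : y i ∉ D₁ := by
      simp only [hD₁, Finset.mem_union, Finset.mem_image, not_or, not_exists, not_and]
      exact ⟨⟨hy i hi', fun j hj h => hxy j (Finset.mem_insert_of_mem hj) i hi' h⟩,
        fun j hj h => hi (hyy j (Finset.mem_insert_of_mem hj) i hi' h ▸ hj)⟩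
    obtain ⟨φ₂, e₂, E₂, tx, ty⟩ := E₁.join hJ hx₁ hy₁
      (hxy i hi' i hi')
      (fun c hc hcx => (hxa i hi' c hcx).resolve_right fun h => hy₁ (h ▸ hc))
      (fun c hc hcy => (hyb i hi' c hcy).resolve_left fun h => hx₁ (h ▸ hc))
      (hH D₁ φ₁ hDD₁ hs e₁ E₁ I₁)
    have hfin : D ∪ (insert i K).image x ∪ (insert i K).image y =
        insert (y i) (insert (x i) D₁) := by
      ext w
      simp only [hD₁, Finset.image_insert, Finset.mem_union, Finset.mem_insert, or_assoc,
        or_left_comm]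
    have hsub : D₁ ⊆ insert (y i) (insert (x i) D₁) :=
      (Finset.subset_insert _ _).trans (Finset.subset_insert _ _)
    rw [hfin]
    refine ⟨φ₂, fun w hw => (e₂ w (hDD₁ hw)).trans (e₁ w hw), E₂, ?_⟩
    refine I₁.mono hsub e₂ fun w hw hwD hwt => Or.inr ?_
    have hw' : w = y i ∨ w = x i := by simpa [hwD] using hw
    rcases hw' with h | h
    · subst h
      refine ⟨b i, hsub (hDD₁ (hb i hi')), hby i hi', ?_⟩
      rw [e₂ _ (hDD₁ (hb i hi'))]
      exact ty hwt
    · subst h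
      refine ⟨a i, hsub (hDD₁ (ha i hi')), hax i hi', ?_⟩
      rw [e₂ _ (hDD₁ (ha i hi'))]
      exact tx hwt

end Engine

/-! ### Slots, components and lines -/

section Absorber
open scoped Classical

variable {V : Type*} [Fintype V] {G : SimpleGraph V} {m : ℕ}

/-- A vertex fits into a slot, a pair of vertices, if it is adjacent to both of them. -/
def Fits (G : SimpleGraph V) (s : V × V) (x : V) : Prop := G.Adj s.1 x ∧ G.Adj s.2 x

/-- The slots can be filled bijectively by the vertices of `P`. -/
def Absorbs (G : SimpleGraph V) (Sl : Finset (V × V)) (P : Finset V) : Prop :=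
  ∃ f : V × V → V, Set.BijOn f Sl P ∧ ∀ s ∈ Sl, Fits G s (f s)

/-- The vertices that form the slots. -/
noncomputable def supp (Sl : Finset (V × V)) : Finset V := Sl.image Prod.fst ∪ Sl.image Prod.snd

/-- The slots are pairwise disjoint pairs of distinct vertices. -/
structure Sep (Sl : Finset (V × V)) : Prop where
  fst_inj : ∀ s ∈ Sl, ∀ t ∈ Sl, s.1 = t.1 → s = t
  snd_inj : ∀ s ∈ Sl, ∀ t ∈ Sl, s.2 = t.2 → s = t
  ne : ∀ s ∈ Sl, ∀ t ∈ Sl, s.1 ≠ t.2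

lemma mem_supp {Sl : Finset (V × V)} {v : V} : v ∈ supp Sl ↔ ∃ s ∈ Sl, s.1 = v ∨ s.2 = v := by
  simp only [supp, Finset.mem_union, Finset.mem_image]
  constructor
  · rintro (⟨s, hs, h⟩ | ⟨s, hs, h⟩)
    exacts [⟨s, hs, Or.inl h⟩, ⟨s, hs, Or.inr h⟩]
  · rintro ⟨s, hs, h | h⟩
    exacts [Or.inl ⟨s, hs, h⟩, Or.inr ⟨s, hs, h⟩]

lemma fst_mem_supp {Sl : Finset (V × V)} {s : V × V} (hs : s ∈ Sl) : s.1 ∈ supp Sl :=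
  mem_supp.2 ⟨s, hs, Or.inl rfl⟩

lemma snd_mem_supp {Sl : Finset (V × V)} {s : V × V} (hs : s ∈ Sl) : s.2 ∈ supp Sl :=
  mem_supp.2 ⟨s, hs, Or.inr rfl⟩

lemma supp_insert {Sl : Finset (V × V)} {u w : V} :
    supp (insert (u, w) Sl) = insert u (insert w (supp Sl)) := by
  ext v
  simp only [mem_supp, Finset.mem_insert]
  constructor
  · rintro ⟨s, rfl | hs, h | h⟩
    · exact Or.inl h.symm
    · exact Or.inr (Or.inl h.symm)
    · exact Or.inr (Or.inr ⟨s, hs, Or.inl h⟩)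
    · exact Or.inr (Or.inr ⟨s, hs, Or.inr h⟩)
  · rintro (rfl | rfl | ⟨s, hs, h⟩)
    · exact ⟨_, Or.inl rfl, Or.inl rfl⟩
    · exact ⟨_, Or.inl rfl, Or.inr rfl⟩
    · exact ⟨s, Or.inr hs, h⟩

lemma Sep.empty : Sep (∅ : Finset (V × V)) := ⟨by simp, by simp, by simp⟩

lemma Sep.insert {Sl : Finset (V × V)} (h : Sep Sl) {u w : V} (huw : u ≠ w) (hu : u ∉ supp Sl)
    (hw : w ∉ supp Sl) : Sep (insert (u, w) Sl) := by
  refine ⟨fun s hs t ht e => ?_, fun s hs t ht e => ?_, fun s hs t ht e => ?_⟩ <;>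
  rcases Finset.mem_insert.1 hs with hs' | hs' <;>
  rcases Finset.mem_insert.1 ht with ht' | ht'
  · rw [hs', ht']
  · exact absurd (fst_mem_supp ht') (by rw [← e, hs']; exact hu)
  · exact absurd (fst_mem_supp hs') (by rw [e, ht']; exact hu)
  · exact h.fst_inj s hs' t ht' e
  · rw [hs', ht']
  · exact absurd (snd_mem_supp ht') (by rw [← e, hs']; exact hw)
  · exact absurd (snd_mem_supp hs') (by rw [e, ht']; exact hw)
  · exact h.snd_inj s hs' t ht' e
  · rw [hs', ht'] at e; exact huw e
  · exact absurd (snd_mem_supp ht') (by rw [← e, hs']; exact hu)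
  · exact absurd (fst_mem_supp hs') (by rw [e, ht']; exact hw)
  · exact h.ne s hs' t ht' e

lemma Sep.biUnion {ι : Type*} {K : Finset ι} {Sl : ι → Finset (V × V)}
    (h : ∀ i ∈ K, Sep (Sl i))
    (hd : ∀ i ∈ K, ∀ j ∈ K, i ≠ j → Disjoint (supp (Sl i)) (supp (Sl j))) :
    Sep (K.biUnion Sl) := by
  have key : ∀ i ∈ K, ∀ j ∈ K, ∀ v, v ∈ supp (Sl i) → v ∈ supp (Sl j) → i = j := by
    intro i hi j hj v hv hv'
    by_contra hne
    exact Finset.disjoint_left.1 (hd i hi j hj hne) hv hv'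
  refine ⟨fun s hs t ht e => ?_, fun s hs t ht e => ?_, fun s hs t ht e => ?_⟩ <;>
  obtain ⟨i, hi, hs⟩ := Finset.mem_biUnion.1 hs <;>
  obtain ⟨j, hj, ht⟩ := Finset.mem_biUnion.1 ht
  · obtain rfl := key i hi j hj _ (fst_mem_supp hs) (e ▸ fst_mem_supp ht)
    exact (h i hi).fst_inj s hs t ht e
  · obtain rfl := key i hi j hj _ (snd_mem_supp hs) (e ▸ snd_mem_supp ht)
    exact (h i hi).snd_inj s hs t ht e
  · obtain rfl := key i hi j hj _ (fst_mem_supp hs) (e ▸ snd_mem_supp ht)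
    exact (h i hi).ne s hs t ht e

lemma Absorbs.empty : Absorbs G ∅ ∅ := ⟨Prod.fst, by simp, by simp⟩

lemma Absorbs.union {Sl Sl' : Finset (V × V)} {P P' : Finset V} (h : Absorbs G Sl P)
    (h' : Absorbs G Sl' P') (hS : Disjoint Sl Sl') (hP : Disjoint P P') :
    Absorbs G (Sl ∪ Sl') (P ∪ P') := by
  obtain ⟨f, hf, hff⟩ := h
  obtain ⟨f', hf', hff'⟩ := h'
  have e1 : ∀ s ∈ Sl, (if s ∈ Sl then f s else f' s) = f s := fun s hs => if_pos hs
  have e2 : ∀ s ∈ Sl', (if s ∈ Sl then f s else f' s) = f' s := fun s hs =>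
    if_neg fun h => Finset.disjoint_left.1 hS h hs
  refine ⟨fun s => if s ∈ Sl then f s else f' s, ?_, fun s hs => ?_⟩
  · rw [Finset.coe_union, Finset.coe_union]
    have b1 : Set.BijOn (fun s => if s ∈ Sl then f s else f' s) Sl P :=
      hf.congr fun s hs => (e1 s hs).symm
    have b2 : Set.BijOn (fun s => if s ∈ Sl then f s else f' s) Sl' P' :=
      hf'.congr fun s hs => (e2 s hs).symm
    refine b1.union b2 ?_
    rw [Set.injOn_union (by exact_mod_cast hS)]
    refine ⟨b1.injOn, b2.injOn, fun s hs t ht e => ?_⟩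
    exact Finset.disjoint_left.1 hP (b1.mapsTo hs) (by rw [e]; exact b2.mapsTo ht)
  · rcases Finset.mem_union.1 hs with hs | hs
    · simp only [e1 s hs]; exact hff s hs
    · simp only [e2 s hs]; exact hff' s hs

lemma Absorbs.biUnion {ι : Type*} {K : Finset ι} {Sl : ι → Finset (V × V)} {P : ι → Finset V}
    (h : ∀ i ∈ K, Absorbs G (Sl i) (P i))
    (hS : ∀ i ∈ K, ∀ j ∈ K, i ≠ j → Disjoint (Sl i) (Sl j))
    (hP : ∀ i ∈ K, ∀ j ∈ K, i ≠ j → Disjoint (P i) (P j)) :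
    Absorbs G (K.biUnion Sl) (K.biUnion P) := by
  induction K using Finset.induction_on with
  | empty => simpa using Absorbs.empty
  | insert i K hi ih =>
    rw [Finset.biUnion_insert, Finset.biUnion_insert]
    refine (h i (Finset.mem_insert_self _ _)).union
      (ih (fun j hj => h j (Finset.mem_insert_of_mem hj))
        (fun j hj k hk => hS j (Finset.mem_insert_of_mem hj) k (Finset.mem_insert_of_mem hk))
        (fun j hj k hk => hP j (Finset.mem_insert_of_mem hj) k (Finset.mem_insert_of_mem hk)))
      ?_ ?_
    · rw [Finset.disjoint_biUnion_right]
      exact fun j hj => hS i (Finset.mem_insert_self _ _) j (Finset.mem_insert_of_mem hj)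
        (by rintro rfl; exact hi hj)
    · rw [Finset.disjoint_biUnion_right]
      exact fun j hj => hP i (Finset.mem_insert_self _ _) j (Finset.mem_insert_of_mem hj)
        (by rintro rfl; exact hi hj)

lemma Absorbs.insert {Sl : Finset (V × V)} {P : Finset V} (h : Absorbs G Sl P) {s : V × V} {x : V}
    (hs : s ∉ Sl) (hx : x ∉ P) (hf : Fits G s x) : Absorbs G (insert s Sl) (insert x P) := by
  have h1 : Absorbs G {s} {x} := ⟨fun _ => x, by simp, by simpa using hf⟩
  rw [Finset.insert_eq, Finset.insert_eq]
  exact h1.union h (by simpa using hs) (by simpa using hx)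

/-- Any single vertex may be left out when the slots are filled from `P`. -/
def Flex (G : SimpleGraph V) (Sl : Finset (V × V)) (P : Finset V) : Prop :=
  ∀ o ∈ P, Absorbs G Sl (P.erase o)

/-- If `z` is left out, the new slot takes `o` and flexibility of the old part copes without `o`;
otherwise the new slot takes `z`. Repeated use gives a tree on `P` whose edges are the slots: once a
root is left out, each edge takes its end farther from that root. -/
lemma Flex.insert {Sl : Finset (V × V)} {P : Finset V} (h : Flex G Sl P) {s : V × V} {o z : V}
    (ho : o ∈ P) (hz : z ∉ P) (hs : s ∉ Sl) (hsz : Fits G s z) (hso : Fits G s o) :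
    Flex G (insert s Sl) (insert z P) := by
  intro o' ho'
  rcases Finset.mem_insert.1 ho' with rfl | ho'
  · rw [Finset.erase_insert hz, ← Finset.insert_erase ho]
    exact (h o ho).insert hs (Finset.notMem_erase _ _) hso
  · rw [Finset.erase_insert_of_ne (by rintro rfl; exact hz ho')]
    exact (h o' ho').insert hs (fun hh => hz (Finset.mem_of_mem_erase hh)) hsz

lemma card_sdiff_union_le (N S T : Finset V) : (N \ S).card ≤ (N \ (S ∪ T)).card + T.card := by
  have h : (N \ S) \ T = N \ (S ∪ T) := by
    ext; simp only [Finset.mem_sdiff, Finset.mem_union, not_or, and_assoc]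
  have := Finset.le_card_sdiff T (N \ S)
  rw [h] at this
  omega

lemma mem_low_compl {S : Finset V} {t : ℕ} {v : V} :
    v ∈ low G (Finset.univ \ S) t ↔ (nbr G v \ S).card < t := by
  rw [mem_low]
  congr! 2
  ext; simp

/-- A vertex with many available neighbours has two of them with two further common
neighbours. -/
lemma Joined.exists_cherry (hJ : Joined G m) {N Q : Finset V} (hN : 3 * m ≤ N.card)
    (hQ : 9 * m ^ 2 + m < Q.card) :
    ∃ u ∈ N, ∃ w ∈ N, ∃ e ∈ Q, ∃ g ∈ Q, u ≠ w ∧ e ≠ g ∧ Fits G (u, w) e ∧ Fits G (u, w) g := by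
  obtain ⟨X, hX, hXm⟩ := Finset.exists_subset_card_eq hN
  have hlow := hJ.card_low_lt (R := X) (t := 2) (by omega)
  have h1 : ∀ v ∈ Q \ low G X 2, ∃ s : V × V, (s.1 ∈ X ∧ s.2 ∈ X) ∧ s.1 ≠ s.2 ∧ Fits G s v := by
    intro v hv
    rw [Finset.mem_sdiff, mem_low, not_lt] at hv
    obtain ⟨a, ha, b, hb, hab⟩ := Finset.one_lt_card.1 hv.2
    simp only [Finset.mem_inter, mem_nbr] at ha hb
    exact ⟨(a, b), ⟨ha.2, hb.2⟩, hab, ha.1.symm, hb.1.symm⟩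
  choose! r hr using h1
  -- All but fewer than `m` vertices of `Q` have two neighbours in the set `X` of `3 * m` vertices,
  -- so there are more of them than the `9 * m ^ 2` pairs and two share a pair.
  have h2 : (X ×ˢ X).card < (Q \ low G X 2).card := by
    have := Finset.le_card_sdiff (low G X 2) Q
    rw [Finset.card_product, hXm]
    have e : 3 * m * (3 * m) = 9 * m ^ 2 := by ring
    omega
  obtain ⟨e, he, g, hg, heg, hr'⟩ := Finset.exists_ne_map_eq_of_card_lt_of_maps_to h2
    (f := r) (fun v hv => by
      simp only [Finset.coe_product, Set.mem_prod]
      exact (hr v hv).1)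
  refine ⟨(r e).1, hX (hr e he).1.1, (r e).2, hX (hr e he).1.2, e, (Finset.mem_sdiff.1 he).1, g,
    (Finset.mem_sdiff.1 hg).1, (hr e he).2.1, heg, (hr e he).2.2, ?_⟩
  have := (hr g hg).2.2
  rwa [← hr'] at this

/-- Two vertices with many available neighbours can be linked through a new vertex. -/
lemma Joined.exists_link (hJ : Joined G m) {S : Finset V} {x y : V} {t : ℕ}
    (hx : 5 * m ≤ (nbr G x \ S).card) (hy : 5 * m ≤ (nbr G y \ S).card)
    (hS : (t + 4) * m + S.card < Fintype.card V) :
    ∃ y' u w u' w', y' ∉ S ∧ t ≤ (nbr G y' \ S).card ∧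
      u ∉ S ∧ w ∉ S ∧ u' ∉ S ∧ w' ∉ S ∧ u ≠ w ∧ u' ≠ w' ∧ u ≠ u' ∧ u ≠ w' ∧ w ≠ u' ∧ w ≠ w' ∧
      Fits G (u, w) x ∧ Fits G (u, w) y' ∧ Fits G (u', w') y ∧ Fits G (u', w') y' := by
  have h1 := hJ.card_low_lt (R := nbr G x \ S) (t := 4) (by omega)
  have h2 := hJ.card_low_lt (R := nbr G y \ S) (t := 4) (by omega)
  have hc : (Finset.univ \ S : Finset V).card + S.card = Fintype.card V := by
    rw [Finset.card_sdiff_add_card_eq_card (Finset.subset_univ _), Finset.card_univ]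
  have h3 := hJ.card_low_lt (R := Finset.univ \ S) (t := t) (by nlinarith)
  -- Fewer than `3 * m` vertices are excluded. The survivor has four neighbours on each side: two
  -- are used towards `x`, and of the four towards `y` two avoid these.
  obtain ⟨y', hy'⟩ : ((((Finset.univ \ S) \ low G (Finset.univ \ S) t) \
      low G (nbr G x \ S) 4) \ low G (nbr G y \ S) 4).Nonempty := by
    rw [← Finset.card_pos]
    have a1 := Finset.le_card_sdiff (low G (Finset.univ \ S) t) (Finset.univ \ S)
    have a2 := Finset.le_card_sdiff (low G (nbr G x \ S) 4)
      ((Finset.univ \ S) \ low G (Finset.univ \ S) t)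
    have a3 := Finset.le_card_sdiff (low G (nbr G y \ S) 4)
      (((Finset.univ \ S) \ low G (Finset.univ \ S) t) \ low G (nbr G x \ S) 4)
    have : (t + 4) * m = t * m + 4 * m := by ring
    omega
  rw [Finset.mem_sdiff, Finset.mem_sdiff, Finset.mem_sdiff, Finset.mem_sdiff, mem_low_compl,
    mem_low, mem_low, not_lt, not_lt, not_lt] at hy'
  obtain ⟨⟨⟨⟨-, hyS⟩, hyt⟩, hyx⟩, hyy⟩ := hy'
  obtain ⟨u, hu, w, hw, huw⟩ := Finset.one_lt_card.1 (lt_of_lt_of_le (by norm_num) hyx)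
  have h4 : 1 < ((nbr G y' ∩ (nbr G y \ S)) \ {u, w}).card := by
    have := Finset.le_card_sdiff {u, w} (nbr G y' ∩ (nbr G y \ S))
    have := Finset.card_le_two (a := u) (b := w)
    omega
  obtain ⟨u', hu', w', hw', huw'⟩ := Finset.one_lt_card.1 h4
  simp only [Finset.mem_sdiff, Finset.mem_inter, mem_nbr, Finset.mem_insert,
    Finset.mem_singleton, not_or] at hu hw hu' hw'
  exact ⟨y', u, w, u', w', hyS, hyt, hu.2.2, hw.2.2, hu'.1.2.2, hw'.1.2.2, huw, huw',
    Ne.symm hu'.2.1, Ne.symm hw'.2.1, Ne.symm hu'.2.2, Ne.symm hw'.2.2,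
    ⟨hu.2.1.symm, hw.2.1.symm⟩, ⟨hu.1.symm, hw.1.symm⟩, ⟨hu'.1.2.1.symm, hw'.1.2.1.symm⟩,
    ⟨hu'.1.1.symm, hw'.1.1.symm⟩⟩

/-- Slots that can be filled by `Gs` and any single one of the vertices `e i`, `i < k`. -/
structure Line (G : SimpleGraph V) (k : ℕ) (Sl : Finset (V × V)) (Gs : Finset V) (e : ℕ → V)
    (Bd : Finset V) : Prop where
  sep : Sep Sl
  supp_subset : supp Sl ⊆ Bd
  subset : Gs ⊆ Bd
  mem : ∀ i < k, e i ∈ Bd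
  disj : Disjoint (supp Sl) Gs
  notMem_supp : ∀ i < k, e i ∉ supp Sl
  notMem : ∀ i < k, e i ∉ Gs
  inj : ∀ i < k, ∀ j < k, e i = e j → i = j
  card_eq : Sl.card = Gs.card + 1
  absorbs : ∀ i < k, Absorbs G Sl (insert (e i) Gs)

/-- The induction carries a gate `g` that the line accepts like the vertices `e i`. To lengthen the
line, a new slot inside the neighbourhood of `g`, with two further common neighbours `x` and `g'`,
is added, and `g` joins `Gs`. If the line is given an old `e i`, the new slot takes `g`; if it is
given `x` or `g'`, the new slot takes that vertex and the old slots use `g`. So `x` becomes `e k`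
and `g'` is the next gate, which must again have many neighbours outside the structure. -/
lemma Joined.exists_line_aux (hJ : Joined G m) {S : Finset V} (k : ℕ)
    (hS : S.card + 4 * k + 3 + 10 * m ^ 2 + (10 * m + 7) * m < Fintype.card V) :
    ∃ Sl Gs e Bd g, Line G k Sl Gs e Bd ∧ Disjoint Bd S ∧ Bd.card ≤ 4 * k + 3 ∧
      g ∈ Bd ∧ g ∉ supp Sl ∧ g ∉ Gs ∧ (∀ i < k, e i ≠ g) ∧ Absorbs G Sl (insert g Gs) ∧
      10 * m ≤ (nbr G g \ (S ∪ Bd)).card := by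
  have hc : ∀ S : Finset V, (Finset.univ \ S : Finset V).card + S.card = Fintype.card V := by
    intro S
    rw [Finset.card_sdiff_add_card_eq_card (Finset.subset_univ _), Finset.card_univ]
  induction k with
  | zero =>
    have hlow := hJ.card_low_lt (R := Finset.univ \ S) (t := 10 * m + 3)
      (by have := hc S; nlinarith)
    obtain ⟨g, hg⟩ : ((Finset.univ \ S) \ low G (Finset.univ \ S) (10 * m + 3)).Nonempty := by
      rw [← Finset.card_pos]
      have := Finset.le_card_sdiff (low G (Finset.univ \ S) (10 * m + 3)) (Finset.univ \ S)
      have := hc S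
      have : (10 * m + 7) * m = 10 * m ^ 2 + 7 * m := by ring
      omega
    simp only [Finset.mem_sdiff, mem_low_compl, Finset.mem_univ, true_and, not_lt] at hg
    obtain ⟨u, hu, w, hw, huw⟩ := Finset.one_lt_card.1 (lt_of_lt_of_le (by omega) hg.2)
    simp only [Finset.mem_sdiff, mem_nbr] at hu hw
    have hgu : g ≠ u := hu.1.ne
    have hgw : g ≠ w := hw.1.ne
    have hsupp : supp ({(u, w)} : Finset (V × V)) = {u, w} := by
      ext v; simp [supp]
    -- For `k = 0` there are no `e i`, so the function is a default value; the single slot is filled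
    -- by the gate.
    refine ⟨{(u, w)}, ∅, fun _ => g, {g, u, w}, g, ⟨?_, ?_, ?_, ?_, ?_, ?_, ?_, ?_, ?_, ?_⟩,
      ?_, ?_, ?_, ?_, ?_, ?_, ?_, ?_⟩
    · simpa using Sep.empty.insert huw (by simp [supp]) (by simp [supp])
    · rw [hsupp]; exact Finset.subset_insert _ _
    · simp
    · simp
    · simp
    · simp
    · simp
    · simp
    · simp
    · simp
    · rw [Finset.disjoint_left]
      simp only [Finset.mem_insert, Finset.mem_singleton]
      rintro a (rfl | rfl | rfl)
      exacts [hg.1, hu.2, hw.2]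
    · exact Finset.card_le_three
    · simp
    · rw [hsupp]; simp [hgu, hgw]
    · simp
    · simp
    · exact ⟨fun _ => g, by simp, by simp [Fits, hu.1.symm, hw.1.symm]⟩
    · have := card_sdiff_union_le (nbr G g) S {g, u, w}
      have : ({g, u, w} : Finset V).card ≤ 3 := Finset.card_le_three
      omega
  | succ k ih =>
    obtain ⟨Sl, Gs, e, Bd, g, L, hBS, hBc, hgB, hgs, hgG, hge, habs, hgood⟩ := ih (by omega)
    have hSB : (S ∪ Bd).card ≤ S.card + 4 * k + 3 := by
      have := Finset.card_union_le S Bd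
      omega
    -- The next gate may lose four neighbours to the vertices added in this step, hence the extra
    -- `4`.
    have hlow := hJ.card_low_lt (R := Finset.univ \ (S ∪ Bd)) (t := 10 * m + 4)
      (by have := hc (S ∪ Bd); nlinarith)
    obtain ⟨u, hu, w, hw, x, hx, g', hg', huw, hxg, hfx, hfg⟩ := hJ.exists_cherry
      (N := nbr G g \ (S ∪ Bd))
      (Q := (Finset.univ \ (S ∪ Bd)) \ low G (Finset.univ \ (S ∪ Bd)) (10 * m + 4)) (by omega) (by
        have := Finset.le_card_sdiff (low G (Finset.univ \ (S ∪ Bd)) (10 * m + 4))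
          (Finset.univ \ (S ∪ Bd))
        have := hc (S ∪ Bd)
        have : (10 * m + 7) * m = 10 * m ^ 2 + 7 * m := by ring
        omega)
    simp only [Finset.mem_sdiff, mem_low_compl, Finset.mem_univ, true_and, not_lt, mem_nbr,
      Finset.mem_union, not_or] at hu hw hx hg'
    obtain ⟨hug, huS, huB⟩ := hu
    obtain ⟨hwg, hwS, hwB⟩ := hw
    obtain ⟨⟨hxS, hxB⟩, -⟩ := hx
    obtain ⟨⟨hgS', hgB'⟩, hgood'⟩ := hg'
    have hux : u ≠ x := hfx.1.ne
    have hwx : w ≠ x := hfx.2.ne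
    have hug' : u ≠ g' := hfg.1.ne
    have hwg' : w ≠ g' := hfg.2.ne
    have ns : ∀ v, v ∉ Bd → v ∉ supp Sl := fun v hv h => hv (L.supp_subset h)
    have nG : ∀ v, v ∉ Bd → v ∉ Gs := fun v hv h => hv (L.subset h)
    have ne : ∀ v, v ∉ Bd → ∀ i < k, e i ≠ v := by
      rintro v hv i hi rfl
      exact hv (L.mem i hi)
    have nSl : (u, w) ∉ Sl := fun h => ns u huB (fst_mem_supp h)
    have hfit : Fits G (u, w) g := ⟨hug.symm, hwg.symm⟩
    have hgne : ∀ v, v ∉ Bd → v ≠ g := by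
      rintro v hv rfl
      exact hv hgB
    have hek : ∀ i < k, Function.update e k x i = e i := fun i hi =>
      Function.update_of_ne hi.ne _ _
    have hekk : Function.update e k x k = x := Function.update_self _ _ _
    have hsub : Bd ⊆ Bd ∪ {u, w, x, g'} := Finset.subset_union_left
    have split : ∀ i, i < k + 1 → i < k ∨ i = k := fun i hi => by omega
    have hnew : ∀ v, v ∉ Bd → v ≠ u → v ≠ w → v ≠ x → v ∉ supp (insert (u, w) Sl) ∧
        v ∉ insert g Gs ∧ ∀ i < k + 1, Function.update e k x i ≠ v := by
      intro v hv h1 h2 h3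
      refine ⟨by simp [supp_insert, h1, h2, ns v hv], by simp [hgne v hv, nG v hv], ?_⟩
      intro i hi
      rcases split i hi with hi | rfl
      · rw [hek i hi]; exact ne v hv i hi
      · rw [hekk]; exact h3.symm
    refine ⟨insert (u, w) Sl, insert g Gs, Function.update e k x, Bd ∪ {u, w, x, g'}, g',
      ⟨L.sep.insert huw (ns u huB) (ns w hwB), ?_, ?_, ?_, ?_, ?_, ?_, ?_, ?_, ?_⟩,
      ?_, ?_, ?_, ?_, ?_, ?_, ?_, ?_⟩
    · rw [supp_insert]
      refine Finset.insert_subset (by simp) (Finset.insert_subset (by simp) ?_)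
      exact L.supp_subset.trans hsub
    · exact Finset.insert_subset (hsub hgB) (L.subset.trans hsub)
    · intro i hi
      rcases split i hi with hi | rfl
      · rw [hek i hi]; exact hsub (L.mem i hi)
      · rw [hekk]; simp
    · rw [supp_insert, Finset.disjoint_left]
      intro a ha
      simp only [Finset.mem_insert] at ha
      rcases ha with rfl | rfl | ha
      · simp [hgne _ huB, nG _ huB]
      · simp [hgne _ hwB, nG _ hwB]
      · rw [Finset.mem_insert, not_or]
        exact ⟨by rintro rfl; exact hgs ha, Finset.disjoint_left.1 L.disj ha⟩
    · intro i hi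
      rcases split i hi with hi | rfl
      · rw [hek i hi, supp_insert]
        simp [ne u huB i hi, ne w hwB i hi, L.notMem_supp i hi]
      · rw [hekk, supp_insert]
        simp [hux.symm, hwx.symm, ns x hxB]
    · intro i hi
      rcases split i hi with hi | rfl
      · rw [hek i hi]
        simp [hge i hi, L.notMem i hi]
      · rw [hekk]
        simp [hgne x hxB, nG x hxB]
    · intro i hi j hj h
      rcases split i hi with hi | rfl <;> rcases split j hj with hj | rfl
      · rw [hek i hi, hek j hj] at h; exact L.inj i hi j hj h
      · rw [hek i hi, hekk] at h; exact absurd h (ne x hxB i hi)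
      · rw [hek j hj, hekk] at h; exact absurd h.symm (ne x hxB j hj)
      · rfl
    · rw [Finset.card_insert_of_notMem nSl, Finset.card_insert_of_notMem hgG, L.card_eq]
    · intro i hi
      rcases split i hi with hi | rfl
      · rw [hek i hi, Finset.insert_comm]
        exact (L.absorbs i hi).insert nSl (by simp [Ne.symm (hge i hi), hgG]) hfit
      · rw [hekk]
        exact habs.insert nSl (by simp [hgne x hxB, nG x hxB]) hfx
    · rw [Finset.disjoint_union_left]
      refine ⟨hBS, ?_⟩
      rw [Finset.disjoint_left]
      simp only [Finset.mem_insert, Finset.mem_singleton]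
      rintro a (rfl | rfl | rfl | rfl) <;> assumption
    · have := Finset.card_union_le Bd {u, w, x, g'}
      have : ({u, w, x, g'} : Finset V).card ≤ 4 := Finset.card_le_four
      omega
    · simp
    · exact (hnew g' hgB' hug'.symm hwg'.symm hxg.symm).1
    · exact (hnew g' hgB' hug'.symm hwg'.symm hxg.symm).2.1
    · exact (hnew g' hgB' hug'.symm hwg'.symm hxg.symm).2.2
    · exact habs.insert nSl (by simp [hgne g' hgB', nG g' hgB']) hfg
    · rw [← Finset.union_assoc]
      have := card_sdiff_union_le (nbr G g') (S ∪ Bd) {u, w, x, g'}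
      have : ({u, w, x, g'} : Finset V).card ≤ 4 := Finset.card_le_four
      omega

/-- Slots that can be filled by all but any single vertex of `X' ∪ Y`, where `X'` is the part of
`X` that is not short of neighbours outside `S`. -/
structure Comp (G : SimpleGraph V) (X X' Y : Finset V) (Sl : Finset (V × V))
    (Bd : Finset V) : Prop where
  sep : Sep Sl
  supp_subset : supp Sl ⊆ Bd
  subset : Y ⊆ Bd
  disj : Disjoint (supp Sl) Y
  subset' : X' ⊆ X
  card_eq : Sl.card + 1 = (X' ∪ Y).card
  flex : Flex G Sl (X' ∪ Y)

/-- The vertices of `X` are strung along a path of new vertices with current end `y`. A vertex `x`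
is hung from a new end `y'`, using one slot for `x, y'` and one for `y, y'`. An `x` short of outside
neighbours at its turn is dropped; it remains short in the complement of the larger final set, so
all dropped vertices lie in one small `low` set. -/
lemma Joined.exists_comp_aux (hJ : Joined G m) {S X : Finset V} (hXS : X ⊆ S)
    (hS : S.card + 5 * X.card + 1 + (10 * m + 9) * m < Fintype.card V) :
    ∃ X' Y Sl Bd y, Comp G X X' Y Sl Bd ∧ Disjoint Bd S ∧ Bd.card ≤ 5 * X.card + 1 ∧
      y ∈ Y ∧ 10 * m ≤ (nbr G y \ (S ∪ Bd)).card ∧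
      ∀ x ∈ X, x ∉ X' → x ∈ low G (Finset.univ \ (S ∪ Bd)) (10 * m) := by
  have hc : ∀ S : Finset V, (Finset.univ \ S : Finset V).card + S.card = Fintype.card V := by
    intro S
    rw [Finset.card_sdiff_add_card_eq_card (Finset.subset_univ _), Finset.card_univ]
  induction X using Finset.induction_on with
  | empty =>
    have hlow := hJ.card_low_lt (R := Finset.univ \ S) (t := 10 * m + 1)
      (by have := hc S; nlinarith)
    obtain ⟨y, hy⟩ : ((Finset.univ \ S) \ low G (Finset.univ \ S) (10 * m + 1)).Nonempty := by
      rw [← Finset.card_pos]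
      have := Finset.le_card_sdiff (low G (Finset.univ \ S) (10 * m + 1)) (Finset.univ \ S)
      have := hc S
      have : (10 * m + 9) * m = 10 * m ^ 2 + 9 * m := by ring
      omega
    simp only [Finset.mem_sdiff, mem_low_compl, Finset.mem_univ, true_and, not_lt] at hy
    refine ⟨∅, {y}, ∅, {y}, y, ⟨Sep.empty, by simp [supp], by simp, by simp [supp], by simp,
      by simp, ?_⟩, by simpa using hy.1, by simp, by simp, ?_, by simp⟩
    · intro o ho
      obtain rfl : o = y := by simpa using ho
      simpa using Absorbs.empty
    · have := card_sdiff_union_le (nbr G y) S {y}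
      rw [Finset.card_singleton] at this
      omega
  | insert x X hxX ih =>
    rw [Finset.card_insert_of_notMem hxX] at hS ⊢
    obtain ⟨X', Y, Sl, Bd, y, C, hBS, hBc, hyY, hgood, hdrop⟩ :=
      ih ((Finset.subset_insert _ _).trans hXS) (by omega)
    by_cases hxl : x ∈ low G (Finset.univ \ (S ∪ Bd)) (10 * m)
    · refine ⟨X', Y, Sl, Bd, y, { C with subset' := C.subset'.trans (Finset.subset_insert _ _) },
        hBS, by omega, hyY, hgood, fun z hz hz' => ?_⟩
      rcases Finset.mem_insert.1 hz with rfl | hz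
      · exact hxl
      · exact hdrop z hz hz'
    rw [mem_low_compl, not_lt] at hxl
    have hSB : (S ∪ Bd).card ≤ S.card + (5 * X.card + 1) :=
      (Finset.card_union_le S Bd).trans (by omega)
    obtain ⟨y', u, w, u', w', hyS, hyt, huS, hwS, huS', hwS', huw, huw', h1, h2, h3, h4, f1, f2,
      f3, f4⟩ := hJ.exists_link (S := S ∪ Bd) (x := x) (y := y) (t := 10 * m + 5) (by omega)
      (by omega) (by nlinarith)
    simp only [Finset.mem_union, not_or] at hyS huS hwS huS' hwS'
    have hxS : x ∈ S := hXS (Finset.mem_insert_self _ _)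
    have hxB : x ∉ Bd := fun h => Finset.disjoint_left.1 hBS h hxS
    have ns : ∀ v, v ∉ Bd → v ∉ supp Sl := fun v hv h => hv (C.supp_subset h)
    have hyP : y' ∉ X' ∪ Y := by
      rw [Finset.mem_union, not_or]
      exact ⟨fun h => hyS.1 (hXS (Finset.mem_insert_of_mem (C.subset' h))),
        fun h => hyS.2 (C.subset h)⟩
    have hxy' : x ≠ y' := by rintro rfl; exact hyS.1 hxS
    have hxP : x ∉ insert y' (X' ∪ Y) := by
      rw [Finset.mem_insert, Finset.mem_union, not_or, not_or]
      exact ⟨hxy', fun h => hxX (C.subset' h), fun h => hxB (C.subset h)⟩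
    have n1 : (u', w') ∉ Sl := fun h => ns u' huS'.2 (fst_mem_supp h)
    have n2 : (u, w) ∉ insert (u', w') Sl := by
      rw [Finset.mem_insert, not_or]
      exact ⟨fun h => h1 (Prod.ext_iff.1 h).1, fun h => ns u huS.2 (fst_mem_supp h)⟩
    have hP : insert x X' ∪ insert y' Y = insert x (insert y' (X' ∪ Y)) := by
      ext a; simp only [Finset.mem_union, Finset.mem_insert, or_assoc, or_left_comm]
    have hcomm : S ∪ (Bd ∪ {y', u, w, u', w'}) = (S ∪ Bd) ∪ {y', u, w, u', w'} := by
      rw [Finset.union_assoc]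
    have h5 : ({y', u, w, u', w'} : Finset V).card ≤ 5 := Finset.card_le_five
    refine ⟨insert x X', insert y' Y, insert (u, w) (insert (u', w') Sl),
      Bd ∪ {y', u, w, u', w'}, y', ⟨?_, ?_, ?_, ?_, ?_, ?_, ?_⟩, ?_, ?_, ?_, ?_, ?_⟩
    · refine (C.sep.insert huw' (ns _ huS'.2) (ns _ hwS'.2)).insert huw ?_ ?_
      · simp [supp_insert, h1, h2, ns _ huS.2]
      · simp [supp_insert, h3, h4, ns _ hwS.2]
    · rw [supp_insert, supp_insert]
      intro a ha
      simp only [Finset.mem_insert] at ha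
      rcases ha with rfl | rfl | rfl | rfl | ha
      · simp
      · simp
      · simp
      · simp
      · exact Finset.mem_union_left _ (C.supp_subset ha)
    · exact Finset.insert_subset (by simp) (C.subset.trans Finset.subset_union_left)
    · rw [supp_insert, supp_insert, Finset.disjoint_left]
      have q : ∀ v, v ∉ Bd → v ≠ y' → v ∉ insert y' Y := fun v hv hvy => by
        rw [Finset.mem_insert, not_or]
        exact ⟨hvy, fun h => hv (C.subset h)⟩
      intro a ha
      simp only [Finset.mem_insert] at ha
      rcases ha with rfl | rfl | rfl | rfl | ha
      · exact q _ huS.2 f2.1.ne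
      · exact q _ hwS.2 f2.2.ne
      · exact q _ huS'.2 f4.1.ne
      · exact q _ hwS'.2 f4.2.ne
      · rw [Finset.mem_insert, not_or]
        exact ⟨by rintro rfl; exact hyS.2 (C.supp_subset ha), Finset.disjoint_left.1 C.disj ha⟩
    · exact Finset.insert_subset_insert _ C.subset'
    · rw [hP, Finset.card_insert_of_notMem n2, Finset.card_insert_of_notMem n1,
        Finset.card_insert_of_notMem hxP, Finset.card_insert_of_notMem hyP, ← C.card_eq]
    · rw [hP]
      exact (C.flex.insert (Finset.mem_union_right _ hyY) hyP n1 f4 f3).insert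
        (Finset.mem_insert_self _ _) hxP n2 f1 f2
    · rw [Finset.disjoint_union_left]
      refine ⟨hBS, ?_⟩
      rw [Finset.disjoint_left]
      simp only [Finset.mem_insert, Finset.mem_singleton]
      rintro a (rfl | rfl | rfl | rfl | rfl)
      exacts [hyS.1, huS.1, hwS.1, huS'.1, hwS'.1]
    · have := Finset.card_union_le Bd {y', u, w, u', w'}
      omega
    · simp
    · rw [hcomm]
      have := card_sdiff_union_le (nbr G y') (S ∪ Bd) {y', u, w, u', w'}
      omega
    · intro z hz hz'
      rw [Finset.mem_insert, not_or] at hz'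
      have := hdrop z ((Finset.mem_insert.1 hz).resolve_left hz'.1) hz'.2
      refine low_mono (Finset.sdiff_subset_sdiff (Finset.Subset.refl _) ?_) le_rfl this
      rw [hcomm]
      exact Finset.subset_union_left

/-- Choosing objects one after the other with disjoint bodies. -/
lemma exists_disjoint_family {α : Type*} [Nonempty α] (body : α → Finset V)
    (Pr : ℕ → Finset V → α → Prop) (b : ℕ → ℕ) (M k : ℕ) (S₀ : Finset V)
    (mono : ∀ i S S' o, S ⊆ S' → Pr i S o → Pr i S' o)
    (h : ∀ i < k, ∀ S, S₀ ⊆ S → S.card + b i ≤ M →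
      ∃ o, Pr i (S ∪ body o) o ∧ Disjoint (body o) S ∧ (body o).card ≤ b i)
    (hM : S₀.card + ∑ i ∈ Finset.range k, b i ≤ M) :
    ∃ (o : ℕ → α) (S : Finset V), S₀ ⊆ S ∧ S.card ≤ S₀.card + ∑ i ∈ Finset.range k, b i ∧
      (∀ i < k, Pr i S (o i) ∧ body (o i) ⊆ S ∧ Disjoint (body (o i)) S₀) ∧
      ∀ i < k, ∀ j < k, i ≠ j → Disjoint (body (o i)) (body (o j)) := by
  induction k with
  | zero => exact ⟨fun _ => Classical.arbitrary α, S₀, by simp⟩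
  | succ k ih =>
    rw [Finset.sum_range_succ] at hM ⊢
    -- Monotonicity of `Pr` in the set allows the properties of the earlier objects to be stated for
    -- the final set.
    obtain ⟨o, S, hS, hSc, hP, hd⟩ := ih (fun i hi => h i (by omega)) (by omega)
    obtain ⟨x, hx, hxS, hxc⟩ := h k (by omega) S hS (by omega)
    have e1 : ∀ i < k, Function.update o k x i = o i := fun i hi =>
      Function.update_of_ne hi.ne _ _
    have e2 : Function.update o k x k = x := Function.update_self _ _ _
    have split : ∀ i, i < k + 1 → i < k ∨ i = k := fun i hi => by omega
    refine ⟨Function.update o k x, S ∪ body x, hS.trans Finset.subset_union_left, ?_, ?_, ?_⟩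
    · have := Finset.card_union_le S (body x)
      omega
    · intro i hi
      rcases split i hi with hi | rfl
      · rw [e1 i hi]
        exact ⟨mono _ _ _ _ Finset.subset_union_left (hP i hi).1,
          (hP i hi).2.1.trans Finset.subset_union_left, (hP i hi).2.2⟩
      · rw [e2]
        exact ⟨hx, Finset.subset_union_right, hxS.mono_right hS⟩
    · intro i hi j hj hij
      rcases split i hi with hi | rfl <;> rcases split j hj with hj | rfl
      · rw [e1 i hi, e1 j hj]; exact hd i hi j hj hij
      · rw [e1 i hi, e2]; exact (hxS.mono_right (hP i hi).2.1).symm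
      · rw [e1 j hj, e2]; exact hxS.mono_right (hP j hj).2.1
      · exact absurd rfl hij

end Absorber

/-! ### Combining components and lines into an absorber -/

section Absorber
open scoped Classical

variable {V : Type*} [Fintype V] {G : SimpleGraph V} {m : ℕ}

lemma exists_bijOn_of_card_eq {α β : Type*} [Nonempty β] {s : Finset α} {t : Finset β}
    (h : s.card = t.card) : ∃ f : α → β, Set.BijOn f s t := by
  have e := Finset.equivOfCardEq h
  refine ⟨fun a => if ha : a ∈ s then (e ⟨a, ha⟩ : β) else Classical.arbitrary β, ?_, ?_, ?_⟩
  · intro a ha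
    simp only [Finset.mem_coe] at ha
    simpa only [ha, dite_true, Finset.mem_coe] using (e ⟨a, ha⟩).2
  · intro a ha b hb hab
    simp only [Finset.mem_coe] at ha hb
    simp only [ha, hb, dite_true] at hab
    simpa using e.injective (Subtype.ext hab)
  · intro b hb
    refine ⟨e.symm ⟨b, hb⟩, (e.symm ⟨b, hb⟩).2, ?_⟩
    simp

lemma disjoint_of_supp {Sl Sl' : Finset (V × V)} (h : Disjoint (supp Sl) (supp Sl')) :
    Disjoint Sl Sl' := by
  rw [Finset.disjoint_left] at *
  exact fun s hs hs' => h (fst_mem_supp hs) (fst_mem_supp hs')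

lemma supp_biUnion {ι : Type*} {K : Finset ι} {Sl : ι → Finset (V × V)} :
    supp (K.biUnion Sl) = K.biUnion fun i => supp (Sl i) := by
  ext v
  simp only [mem_supp, Finset.mem_biUnion]
  constructor
  · rintro ⟨s, ⟨i, hi, hs⟩, h⟩; exact ⟨i, hi, s, hs, h⟩
  · rintro ⟨i, hi, s, hs, h⟩; exact ⟨s, ⟨i, hi, hs⟩, h⟩

lemma supp_union {Sl Sl' : Finset (V × V)} : supp (Sl ∪ Sl') = supp Sl ∪ supp Sl' := by
  ext v
  simp only [mem_supp, Finset.mem_union]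
  constructor
  · rintro ⟨s, hs | hs, h⟩
    exacts [Or.inl ⟨s, hs, h⟩, Or.inr ⟨s, hs, h⟩]
  · rintro (⟨s, hs, h⟩ | ⟨s, hs, h⟩)
    exacts [⟨s, Or.inl hs, h⟩, ⟨s, Or.inr hs, h⟩]

lemma Sep.union {Sl Sl' : Finset (V × V)} (h : Sep Sl) (h' : Sep Sl')
    (hd : Disjoint (supp Sl) (supp Sl')) : Sep (Sl ∪ Sl') := by
  have := Sep.biUnion (K := Finset.univ) (Sl := fun b : Bool => if b then Sl else Sl')
    (fun b _ => by cases b <;> simpa) (fun b _ b' _ hb => by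
      cases b <;> cases b' <;> simp_all [disjoint_comm])
  convert this using 1
  ext s; simp

/-- The absorbing structure, as a combination of components and lines. The components indexed by
`i < q` have vertex sets `P i`, and the line `j` can take the vertex `e j i` from the component
`i`. -/
structure Network (G : SimpleGraph V) (q : ℕ) (J : Finset ℕ) (SlC : ℕ → Finset (V × V))
    (P : ℕ → Finset V) (SlL : ℕ → Finset (V × V)) (Gs : ℕ → Finset V) (e : ℕ → ℕ → V) :
    Prop where
  sepC : ∀ i < q, Sep (SlC i)
  sepL : ∀ j ∈ J, Sep (SlL j)
  flex : ∀ i < q, Flex G (SlC i) (P i)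
  line : ∀ j ∈ J, ∀ i < q, Absorbs G (SlL j) (insert (e j i) (Gs j))
  e_mem : ∀ j ∈ J, ∀ i < q, e j i ∈ P i
  cardC : ∀ i < q, (SlC i).card + 1 = (P i).card
  cardL : ∀ j ∈ J, (SlL j).card = (Gs j).card + 1
  sCC : ∀ i < q, ∀ i' < q, i ≠ i' → Disjoint (supp (SlC i)) (supp (SlC i'))
  sLL : ∀ j ∈ J, ∀ j' ∈ J, j ≠ j' → Disjoint (supp (SlL j)) (supp (SlL j'))
  sCL : ∀ i < q, ∀ j ∈ J, Disjoint (supp (SlC i)) (supp (SlL j))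
  pCC : ∀ i < q, ∀ i' < q, i ≠ i' → Disjoint (P i) (P i')
  pLL : ∀ j ∈ J, ∀ j' ∈ J, j ≠ j' → Disjoint (Gs j) (Gs j')
  pCL : ∀ i < q, ∀ j ∈ J, Disjoint (P i) (Gs j)
  spCC : ∀ i < q, ∀ i' < q, Disjoint (supp (SlC i)) (P i')
  spLL : ∀ j ∈ J, ∀ j' ∈ J, Disjoint (supp (SlL j)) (Gs j')
  spCL : ∀ i < q, ∀ j ∈ J, Disjoint (supp (SlC i)) (Gs j)
  spLC : ∀ i < q, ∀ j ∈ J, Disjoint (supp (SlL j)) (P i)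

variable {q : ℕ} {J : Finset ℕ} {SlC : ℕ → Finset (V × V)} {P : ℕ → Finset V}
  {SlL : ℕ → Finset (V × V)} {Gs : ℕ → Finset V} {e : ℕ → ℕ → V}

lemma Network.sep (N : Network G q J SlC P SlL Gs e) :
    Sep ((Finset.range q).biUnion SlC ∪ J.biUnion SlL) := by
  refine Sep.union (Sep.biUnion (by simpa using N.sepC) (by simpa using N.sCC))
    (Sep.biUnion N.sepL N.sLL) ?_
  rw [supp_biUnion, supp_biUnion, Finset.disjoint_biUnion_left]
  intro i hi
  rw [Finset.disjoint_biUnion_right]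
  exact N.sCL i (Finset.mem_range.1 hi)

lemma Network.disj (N : Network G q J SlC P SlL Gs e) :
    Disjoint (supp ((Finset.range q).biUnion SlC ∪ J.biUnion SlL))
      ((Finset.range q).biUnion P ∪ J.biUnion Gs) := by
  rw [supp_union, supp_biUnion, supp_biUnion]
  simp only [Finset.disjoint_union_left, Finset.disjoint_union_right,
    Finset.disjoint_biUnion_left, Finset.disjoint_biUnion_right, Finset.mem_range]
  exact ⟨fun i hi => ⟨fun i' hi' => N.spCC i' hi' i hi, fun j hj => N.spLC i hi j hj⟩,
    fun j hj => ⟨fun i hi => N.spCL i hi j hj, fun j' hj' => N.spLL j' hj' j hj⟩⟩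

lemma Network.card (N : Network G q J SlC P SlL Gs e) :
    ((Finset.range q).biUnion P ∪ J.biUnion Gs).card + J.card =
      ((Finset.range q).biUnion SlC ∪ J.biUnion SlL).card + q := by
  rw [Finset.card_union_of_disjoint, Finset.card_union_of_disjoint, Finset.card_biUnion,
    Finset.card_biUnion, Finset.card_biUnion, Finset.card_biUnion]
  · have h1 : ∑ i ∈ Finset.range q, (P i).card = ∑ i ∈ Finset.range q, (SlC i).card + q := by
      rw [Finset.sum_congr rfl fun i hi => (N.cardC i (Finset.mem_range.1 hi)).symm,
        Finset.sum_add_distrib]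
      simp
    have h2 : ∑ j ∈ J, (SlL j).card = ∑ j ∈ J, (Gs j).card + J.card := by
      rw [Finset.sum_congr rfl N.cardL, Finset.sum_add_distrib]
      simp
    omega
  · exact fun j hj j' hj' h => disjoint_of_supp (N.sLL j hj j' hj' h)
  · exact fun i hi j hj h =>
      disjoint_of_supp (N.sCC i (Finset.mem_range.1 hi) j (Finset.mem_range.1 hj) h)
  · exact fun j hj j' hj' h => N.pLL j hj j' hj' h
  · exact fun i hi j hj h => N.pCC i (Finset.mem_range.1 hi) j (Finset.mem_range.1 hj) h
  · simp only [Finset.disjoint_biUnion_left, Finset.disjoint_biUnion_right, Finset.mem_range]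
    exact fun i hi j hj => disjoint_of_supp (N.sCL j hj i hi)
  · simp only [Finset.disjoint_biUnion_left, Finset.disjoint_biUnion_right, Finset.mem_range]
    exact fun i hi j hj => N.pCL j hj i hi

/-- A component that contains a vertex of `Z` leaves that vertex out. The other `q - Z.card =
J.card` components are paired with the lines by a bijection `γ`; the component paired with line `j`
leaves out `e j (γ j)`, which the line absorbs. Thus everything except `Z` is used. -/
lemma Network.absorbs [Nonempty V] (N : Network G q J SlC P SlL Gs e) {Z : Finset V} {c : V → ℕ}
    (hZ : ∀ z ∈ Z, c z < q ∧ z ∈ P (c z)) (hc : ∀ z ∈ Z, ∀ z' ∈ Z, c z = c z' → z = z')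
    (hcard : Z.card + J.card = q) :
    Absorbs G ((Finset.range q).biUnion SlC ∪ J.biUnion SlL)
      (((Finset.range q).biUnion P ∪ J.biUnion Gs) \ Z) := by
  set U := Z.image c with hU
  have hUc : U.card = Z.card := Finset.card_image_of_injOn hc
  have hUq : U ⊆ Finset.range q := by
    intro i hi
    obtain ⟨z, hz, rfl⟩ := Finset.mem_image.1 hi
    exact Finset.mem_range.2 (hZ z hz).1
  have hcards : J.card = (Finset.range q \ U).card := by
    rw [Finset.card_sdiff_of_subset hUq, Finset.card_range]; omega
  obtain ⟨γ, hγ⟩ := exists_bijOn_of_card_eq hcards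
  have hγm : ∀ j ∈ J, γ j < q ∧ γ j ∉ U := fun j hj => by
    have := hγ.mapsTo hj
    simpa using this
  have hγi : ∀ j ∈ J, ∀ j' ∈ J, γ j = γ j' → j = j' := fun j hj j' hj' h => hγ.injOn hj hj' h
  have hγs : ∀ i < q, i ∉ U → ∃ j ∈ J, γ j = i := fun i hi hiU =>
    hγ.surjOn (by simpa using ⟨hi, hiU⟩)
  -- the vertex left out by each component
  have hoo : ∀ i, ∃ o, i < q → (o ∈ P i ∧ ((o ∈ Z ∧ c o = i) ∨ ∃ j ∈ J, γ j = i ∧ o = e j i)) := by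
    intro i
    by_cases hi : i < q
    · by_cases hiU : i ∈ U
      · obtain ⟨z, hz, rfl⟩ := Finset.mem_image.1 hiU
        exact ⟨z, fun _ => ⟨(hZ z hz).2, Or.inl ⟨hz, rfl⟩⟩⟩
      · obtain ⟨j, hj, rfl⟩ := hγs i hi hiU
        exact ⟨e j (γ j), fun _ => ⟨N.e_mem j hj _ hi, Or.inr ⟨j, hj, rfl, rfl⟩⟩⟩
    · exact ⟨Classical.arbitrary V, fun h => absurd h hi⟩
  choose oo hoo using hoo
  have hA : Absorbs G ((Finset.range q).biUnion SlC)
      ((Finset.range q).biUnion fun i => (P i).erase (oo i)) := by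
    refine Absorbs.biUnion (fun i hi => ?_) (fun i hi j hj h => ?_) fun i hi j hj h => ?_
    · rw [Finset.mem_range] at hi
      exact N.flex i hi _ (hoo i hi).1
    · exact disjoint_of_supp (N.sCC i (Finset.mem_range.1 hi) j (Finset.mem_range.1 hj) h)
    · exact (N.pCC i (Finset.mem_range.1 hi) j (Finset.mem_range.1 hj) h).mono
        (Finset.erase_subset _ _) (Finset.erase_subset _ _)
  have hPeq : ∀ i < q, ∀ i' < q, ∀ x ∈ P i, x ∈ P i' → i = i' := by
    intro i hi i' hi' x hx hx'
    by_contra hne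
    exact Finset.disjoint_left.1 (N.pCC i hi i' hi' hne) hx hx'
  have hPG : ∀ i < q, ∀ j ∈ J, ∀ x ∈ P i, x ∉ Gs j := fun i hi j hj x hx =>
    Finset.disjoint_left.1 (N.pCL i hi j hj) hx
  have hB : Absorbs G (J.biUnion SlL) (J.biUnion fun j => insert (e j (γ j)) (Gs j)) := by
    refine Absorbs.biUnion (fun j hj => N.line j hj _ (hγm j hj).1)
      (fun j hj j' hj' h => disjoint_of_supp (N.sLL j hj j' hj' h)) fun j hj j' hj' h => ?_
    have m1 := N.e_mem j hj _ (hγm j hj).1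
    have m2 := N.e_mem j' hj' _ (hγm j' hj').1
    rw [Finset.disjoint_insert_left, Finset.disjoint_insert_right, Finset.mem_insert, not_or]
    exact ⟨⟨fun h' => h (hγi j hj j' hj' (hPeq _ (hγm j hj).1 _ (hγm j' hj').1 _ m1 (h' ▸ m2))),
      hPG _ (hγm j hj).1 _ hj' _ m1⟩, hPG _ (hγm j' hj').1 _ hj _ m2, N.pLL j hj j' hj' h⟩
  have hZU : ∀ z ∈ Z, c z ∈ U := fun z hz => Finset.mem_image_of_mem _ hz
  have heZ : ∀ j ∈ J, e j (γ j) ∉ Z := by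
    intro j hj hz
    have := hPeq _ (hγm j hj).1 _ (hZ _ hz).1 _ (N.e_mem j hj _ (hγm j hj).1) (hZ _ hz).2
    exact (hγm j hj).2 (this ▸ hZU _ hz)
  have hooe : ∀ j ∈ J, oo (γ j) = e j (γ j) := by
    intro j hj
    obtain ⟨h1, ⟨h2, h3⟩ | ⟨j', hj', h2, h3⟩⟩ := hoo (γ j) (hγm j hj).1
    · exact absurd (h3 ▸ hZU _ h2) (hγm j hj).2
    · rw [h3, hγi j' hj' j hj h2]
  have hooz : ∀ z ∈ Z, oo (c z) = z := by
    intro z hz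
    obtain ⟨h1, ⟨h2, h3⟩ | ⟨j', hj', h2, h3⟩⟩ := hoo (c z) (hZ z hz).1
    · exact hc _ h2 _ hz h3
    · exact absurd (h2 ▸ hZU z hz) (hγm j' hj').2
  have hfin := hA.union hB (by
    simp only [Finset.disjoint_biUnion_left, Finset.disjoint_biUnion_right, Finset.mem_range]
    exact fun i hi j hj => disjoint_of_supp (N.sCL j hj i hi)) (by
    simp only [Finset.disjoint_biUnion_left, Finset.disjoint_biUnion_right, Finset.mem_range]
    intro j hj i hi
    rw [Finset.disjoint_insert_right]
    refine ⟨fun h => ?_, (N.pCL i hi j hj).mono_left (Finset.erase_subset _ _)⟩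
    obtain rfl := hPeq _ (hγm j hj).1 i hi _ (N.e_mem j hj _ (hγm j hj).1)
      (Finset.mem_of_mem_erase h)
    exact Finset.ne_of_mem_erase h (hooe j hj).symm)
  convert hfin using 1
  ext x
  simp only [Finset.mem_sdiff, Finset.mem_union, Finset.mem_biUnion, Finset.mem_range,
    Finset.mem_erase, Finset.mem_insert]
  constructor
  · rintro ⟨⟨i, hi, hx⟩ | ⟨j, hj, hx⟩, hxZ⟩
    · by_cases hxo : x = oo i
      · obtain ⟨h1, ⟨h2, h3⟩ | ⟨j', hj', h2, h3⟩⟩ := hoo i hi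
        · exact absurd (hxo ▸ h2) hxZ
        · exact Or.inr ⟨j', hj', Or.inl (by rw [hxo, h3, h2])⟩
      · exact Or.inl ⟨i, hi, hxo, hx⟩
    · exact Or.inr ⟨j, hj, Or.inr hx⟩
  · rintro (⟨i, hi, hxo, hx⟩ | ⟨j, hj, rfl | hx⟩)
    · refine ⟨Or.inl ⟨i, hi, hx⟩, fun hz => hxo ?_⟩
      obtain rfl := hPeq i hi _ (hZ x hz).1 x hx (hZ x hz).2
      exact (hooz x hz).symm
    · exact ⟨Or.inl ⟨_, (hγm j hj).1, N.e_mem j hj _ (hγm j hj).1⟩, heZ j hj⟩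
    · exact ⟨Or.inr ⟨j, hj, hx⟩, fun hz => hPG _ (hZ x hz).1 j hj x (hZ x hz).2 hx⟩

/-- A set `A` with a family of slots for it, and disjoint subsets `F i` of `A`, such that any
`45 * μ` vertices of `A` from distinct sets `F i` may be left out when the slots are filled. -/
theorem Joined.exists_absorber (hJ : Joined G m) {μ : ℕ} (hm : m ≤ μ)
    (hn : 10 ^ 9 * μ ^ 2 ≤ Fintype.card V) (hlog : Fintype.card V < 4 ^ (60 * μ))
    (hdeg : ∀ v, 240 * μ ≤ (nbr G v).card) :
    ∃ (Sl : Finset (V × V)) (A : Finset V) (F : ℕ → Finset V), Sep Sl ∧ Disjoint (supp Sl) A ∧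
      (∀ i, F i ⊆ A) ∧ (∀ i j, i ≠ j → Disjoint (F i) (F j)) ∧
      A.card = Sl.card + 45 * μ ∧ 1000 * (supp Sl ∪ A).card ≤ Fintype.card V ∧
      (∀ v, ∃ I : Finset ℕ, 59 * μ ≤ I.card ∧ ∀ i ∈ I, (nbr G v ∩ F i).Nonempty) ∧
      ∀ Z : Finset V, (∀ z ∈ Z, ∃ i, z ∈ F i) → (∀ i, (Z ∩ F i).card ≤ 1) → Z.card = 45 * μ →
        Absorbs G Sl (A \ Z) := by
  have hm0 := hJ.pos
  have hV : Nonempty V := by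
    by_contra hne
    rw [not_nonempty_iff, ← Fintype.card_eq_zero_iff] at hne
    have : 0 < μ ^ 2 := by have : 0 < μ := by omega
                           positivity
    omega
  have hmμ : m * μ ≤ μ ^ 2 := by rw [sq]; exact Nat.mul_le_mul_right _ hm
  have hmm : m ^ 2 ≤ μ ^ 2 := Nat.pow_le_pow_left hm 2
  have hμμ : μ ≤ μ ^ 2 := by rw [sq]; exact Nat.le_mul_self μ
  obtain ⟨A₀, hA₀c, hA₀⟩ := hJ.exists_reserve (b := 240 * μ) hdeg (by
    have : (240 * μ + 1) * m = 240 * (m * μ) + m := by ring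
    omega)
  have hA₀c' : A₀.card ≤ 481 * μ ^ 2 := by
    have : (2 * (240 * μ) + 1) * m = 480 * (m * μ) + m := by ring
    omega
  -- The reserve is coloured with `120 * μ` colours, one per component, so that every vertex sees
  -- `60 * μ` of them; this needs `4 * (60 * μ) = 240 * μ` neighbours in the reserve.
  obtain ⟨c, hc⟩ := exists_colouring_card_image (fun v => nbr G v ∩ A₀) (60 * μ) (by omega)
    (fun v => by have := hA₀ v; omega) hlog
  obtain ⟨q, hq⟩ : ∃ q, q = 120 * μ := ⟨_, rfl⟩
  have hcq : ∀ v, (c v : ℕ) < q := fun v => by have := (c v).2; omega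
  -- the lines
  have hqq : 76 * μ * (4 * q + 3) ≤ 36708 * μ ^ 2 := by
    rw [hq]
    have : 76 * μ * (4 * (120 * μ) + 3) = 36480 * μ ^ 2 + 228 * μ := by ring
    omega
  have h2m : (10 * m + 7) * m = 10 * m ^ 2 + 7 * m := by ring
  have h2m' : (10 * m + 9) * m = 10 * m ^ 2 + 9 * m := by ring
  -- There are `μ` more lines than the `75 * μ` finally kept, to allow for spoiled ones.
  obtain ⟨l, S₁, hAS, hS₁c, hl, hld⟩ := exists_disjoint_family
    (α := Finset (V × V) × Finset V × (ℕ → V) × Finset V) (fun o => o.2.2.2)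
    (fun _ _ o => Line G q o.1 o.2.1 o.2.2.1 o.2.2.2) (fun _ => 4 * q + 3) (10 ^ 6 * μ ^ 2)
    (76 * μ) A₀ (fun _ _ _ _ _ h => h) (by
      intro i _ S _ hS
      obtain ⟨Sl, Gs, e, Bd, g, L, h1, h2, -⟩ := hJ.exists_line_aux (S := S) q (by omega)
      exact ⟨(Sl, Gs, e, Bd), L, h1, h2⟩) (by simp; omega)
  simp only [Finset.sum_const, Finset.card_range, smul_eq_mul] at hS₁c
  obtain ⟨e, he⟩ : ∃ e : ℕ → ℕ → V, e = fun j => (l j).2.2.1 := ⟨_, rfl⟩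
  have hL : ∀ j < 76 * μ, Line G q (l j).1 (l j).2.1 (e j) (l j).2.2.2 := fun j hj => by
    rw [he]; exact (hl j hj).1
  -- the payloads
  obtain ⟨X, hX⟩ : ∃ X : ℕ → Finset V, X = fun i =>
    A₀.filter (fun v => (c v : ℕ) = i) ∪ (Finset.range (76 * μ)).image fun j => e j i := ⟨_, rfl⟩
  have memX : ∀ i x, x ∈ X i ↔ (x ∈ A₀ ∧ (c x : ℕ) = i) ∨ ∃ j < 76 * μ, e j i = x := by
    intro i x
    simp [hX]
  have hXS : ∀ i < q, X i ⊆ S₁ := by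
    intro i hi x hx
    rcases (memX i x).1 hx with h | ⟨j, hj, rfl⟩
    · exact hAS h.1
    · exact (hl j hj).2.1 ((hL j hj).mem i hi)
  have hXc : ∑ i ∈ Finset.range q, (5 * (X i).card + 1) ≤ 48125 * μ ^ 2 := by
    have h1 : ∀ i ∈ Finset.range q, 5 * (X i).card + 1 ≤
        5 * (A₀.filter (fun v => (c v : ℕ) = i)).card + (380 * μ + 1) := by
      intro i _
      have a1 : (X i).card ≤ (A₀.filter (fun v => (c v : ℕ) = i)).card +
          ((Finset.range (76 * μ)).image fun j => e j i).card := by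
        rw [hX]; exact Finset.card_union_le _ _
      have a2 : ((Finset.range (76 * μ)).image fun j => e j i).card ≤ 76 * μ :=
        Finset.card_image_le.trans (by simp)
      omega
    refine (Finset.sum_le_sum h1).trans ?_
    rw [Finset.sum_add_distrib, ← Finset.mul_sum, ← Finset.card_eq_sum_card_fiberwise
      (f := fun v => (c v : ℕ)) (fun v _ => by simpa using hcq v)]
    simp only [Finset.sum_const, Finset.card_range, smul_eq_mul]
    have : q * (380 * μ + 1) = 45600 * μ ^ 2 + 120 * μ := by rw [hq]; ring
    omega
  obtain ⟨k, S₂, hSS, hS₂c, hk, hkd⟩ := exists_disjoint_family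
    (α := Finset V × Finset V × Finset (V × V) × Finset V) (fun o => o.2.2.2)
    (fun i S o => Comp G (X i) o.1 o.2.1 o.2.2.1 o.2.2.2 ∧
      ∀ x ∈ X i, x ∉ o.1 → x ∈ low G (Finset.univ \ S) (10 * m))
    (fun i => 5 * (X i).card + 1) (10 ^ 6 * μ ^ 2) q S₁ (by
      intro i S S' o hSS h
      refine ⟨h.1, fun x hx hx' => ?_⟩
      exact low_mono (Finset.sdiff_subset_sdiff (Finset.Subset.refl _) hSS) le_rfl
        (h.2 x hx hx')) (by
      intro i hi S hS hSc
      obtain ⟨X', Y, Sl, Bd, y, C, h1, h2, -, -, h3⟩ := hJ.exists_comp_aux (S := S) (X := X i)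
        ((hXS i hi).trans hS) (by omega)
      exact ⟨(X', Y, Sl, Bd), ⟨C, h3⟩, h1, h2⟩) (by omega)
  have hS₂ : S₂.card ≤ 85314 * μ ^ 2 := by omega
  have hK : ∀ i < q, Comp G (X i) (k i).1 (k i).2.1 (k i).2.2.1 (k i).2.2.2 :=
    fun i hi => (hk i hi).1.1
  -- Every vertex dropped from any component lies in `Lw`, which has fewer than `m ≤ μ` elements.
  -- Hence fewer than `μ` lines are spoiled, and every vertex still sees at least `59 * μ` colours.
  obtain ⟨Lw, hLw⟩ : ∃ Lw, Lw = low G (Finset.univ \ S₂) (10 * m) := ⟨_, rfl⟩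
  have hLwc : Lw.card < m := by
    rw [hLw]
    refine hJ.card_low_lt ?_
    have a1 : (Finset.univ \ S₂ : Finset V).card + S₂.card = Fintype.card V := by
      rw [Finset.card_sdiff_add_card_eq_card (Finset.subset_univ _), Finset.card_univ]
    have : (10 * m + 1) * m = 10 * m ^ 2 + m := by ring
    omega
  have hkept : ∀ i < q, ∀ x ∈ X i, x ∉ Lw → x ∈ (k i).1 := by
    intro i hi x hx hxl
    by_contra hn
    exact hxl (hLw ▸ (hk i hi).1.2 x hx hn)
  have heeq : ∀ j < 76 * μ, ∀ j' < 76 * μ, ∀ i < q, ∀ i' < q, e j i = e j' i' →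
      j = j' ∧ i = i' := by
    intro j hj j' hj' i hi i' hi' h
    have hjj : j = j' := by
      by_contra hne
      exact Finset.disjoint_left.1 (hld j hj j' hj' hne) ((hL j hj).mem i hi)
        (h ▸ (hL j' hj').mem i' hi')
    subst hjj
    exact ⟨rfl, (hL j hj).inj i hi i' hi' h⟩
  -- the lines that are kept
  obtain ⟨Jb, hJb⟩ : ∃ Jb, Jb = (Finset.range (76 * μ)).filter fun j => ∃ i < q, e j i ∈ Lw :=
    ⟨_, rfl⟩
  have hJbc : Jb.card ≤ Lw.card := by
    have h1 : ∀ j ∈ Jb, ∃ i < q, e j i ∈ Lw := fun j hj => by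
      rw [hJb] at hj; exact (Finset.mem_filter.1 hj).2
    have h2 : ∀ j ∈ Jb, j < 76 * μ := fun j hj => by
      rw [hJb] at hj; exact Finset.mem_range.1 (Finset.mem_filter.1 hj).1
    choose! r hr hr' using h1
    refine Finset.card_le_card_of_injOn (fun j => e j (r j)) hr' fun j hj j' hj' h => ?_
    exact (heeq j (h2 j hj) j' (h2 j' hj') _ (hr j hj) _ (hr j' hj') h).1
  obtain ⟨J, hJs, hJc⟩ := Finset.exists_subset_card_eq
    (s := Finset.range (76 * μ) \ Jb) (n := 75 * μ) (by
      have := Finset.le_card_sdiff Jb (Finset.range (76 * μ))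
      rw [Finset.card_range] at this
      omega)
  have hJlt : ∀ j ∈ J, j < 76 * μ := fun j hj =>
    Finset.mem_range.1 (Finset.mem_sdiff.1 (hJs hj)).1
  have heP : ∀ j ∈ J, ∀ i < q, e j i ∈ (k i).1 := by
    intro j hj i hi
    refine hkept i hi _ ((memX _ _).2 (Or.inr ⟨j, hJlt j hj, rfl⟩)) fun h => ?_
    have := (Finset.mem_sdiff.1 (hJs hj)).2
    rw [hJb] at this
    exact this (Finset.mem_filter.2 ⟨Finset.mem_range.2 (hJlt j hj), i, hi, h⟩)
  have hXX : ∀ i < q, ∀ i' < q, ∀ x, x ∈ X i → x ∈ X i' → i = i' := by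
    intro i hi i' hi' x hx hx'
    rcases (memX i x).1 hx with h | ⟨j, hj, rfl⟩ <;> rcases (memX i' _).1 hx' with h' | ⟨j', hj', h'⟩
    · rw [← h.2, h'.2]
    · exact absurd h.1 (Finset.disjoint_left.1 (hl j' hj').2.2 (h' ▸ (hL j' hj').mem i' hi'))
    · exact absurd h'.1 (Finset.disjoint_left.1 (hl j hj).2.2 ((hL j hj).mem i hi))
    · exact (heeq j' hj' j hj i' hi' i hi h').2.symm
  have hbS : ∀ i < q, ∀ x ∈ (k i).2.2.2, x ∉ S₁ := fun i hi x hx =>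
    Finset.disjoint_left.1 (hk i hi).2.2 hx
  have hXl : ∀ i < q, ∀ j < 76 * μ, ∀ x ∈ X i, x ∈ (l j).2.2.2 → x = e j i := by
    intro i hi j hj x hx hxl
    rcases (memX i x).1 hx with h | ⟨j', hj', rfl⟩
    · exact absurd h.1 (Finset.disjoint_left.1 (hl j hj).2.2 hxl)
    · by_cases hjj : j = j'
      · rw [hjj]
      · exact absurd hxl (Finset.disjoint_left.1 (hld j' hj' j hj (Ne.symm hjj))
          ((hL j' hj').mem i hi))
  have N : Network G q J (fun i => (k i).2.2.1) (fun i => (k i).1 ∪ (k i).2.1)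
      (fun j => (l j).1) (fun j => (l j).2.1) e := by
    refine ⟨fun i hi => (hK i hi).sep, fun j hj => (hL j (hJlt j hj)).sep,
      fun i hi => (hK i hi).flex, fun j hj => (hL j (hJlt j hj)).absorbs,
      fun j hj i hi => Finset.mem_union_left _ (heP j hj i hi),
      fun i hi => (hK i hi).card_eq, fun j hj => (hL j (hJlt j hj)).card_eq,
      fun i hi i' hi' h => (hkd i hi i' hi' h).mono (hK i hi).supp_subset (hK i' hi').supp_subset,
      fun j hj j' hj' h => (hld j (hJlt j hj) j' (hJlt j' hj') h).mono
        (hL j (hJlt j hj)).supp_subset (hL j' (hJlt j' hj')).supp_subset,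
      ?_, ?_,
      fun j hj j' hj' h => (hld j (hJlt j hj) j' (hJlt j' hj') h).mono
        (hL j (hJlt j hj)).subset (hL j' (hJlt j' hj')).subset, ?_, ?_, ?_, ?_, ?_⟩
    · intro i hi j hj
      rw [Finset.disjoint_left]
      intro x hx hx'
      exact hbS i hi x ((hK i hi).supp_subset hx)
        ((hl j (hJlt j hj)).2.1 ((hL j (hJlt j hj)).supp_subset hx'))
    · intro i hi i' hi' hne
      rw [Finset.disjoint_left]
      intro x hx hx'
      rcases Finset.mem_union.1 hx with hx | hx <;> rcases Finset.mem_union.1 hx' with hx' | hx'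
      · exact hne (hXX i hi i' hi' x ((hK i hi).subset' hx) ((hK i' hi').subset' hx'))
      · exact hbS i' hi' x ((hK i' hi').subset hx') (hXS i hi ((hK i hi).subset' hx))
      · exact hbS i hi x ((hK i hi).subset hx) (hXS i' hi' ((hK i' hi').subset' hx'))
      · exact Finset.disjoint_left.1 (hkd i hi i' hi' hne) ((hK i hi).subset hx)
          ((hK i' hi').subset hx')
    · intro i hi j hj
      have Lj := hL j (hJlt j hj)
      rw [Finset.disjoint_left]
      intro x hx hx'
      rcases Finset.mem_union.1 hx with hx | hx
      · have := hXl i hi j (hJlt j hj) x ((hK i hi).subset' hx) (Lj.subset hx')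
        exact Lj.notMem i hi (this ▸ hx')
      · exact hbS i hi x ((hK i hi).subset hx) ((hl j (hJlt j hj)).2.1 (Lj.subset hx'))
    · intro i hi i' hi'
      rw [Finset.disjoint_left]
      intro x hx hx'
      rcases Finset.mem_union.1 hx' with hx' | hx'
      · exact hbS i hi x ((hK i hi).supp_subset hx) (hXS i' hi' ((hK i' hi').subset' hx'))
      · by_cases hii : i = i'
        · subst hii
          exact Finset.disjoint_left.1 (hK i hi).disj hx hx'
        · exact Finset.disjoint_left.1 (hkd i hi i' hi' hii) ((hK i hi).supp_subset hx)
            ((hK i' hi').subset hx')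
    · intro j hj j' hj'
      by_cases hjj : j = j'
      · subst hjj
        exact (hL j (hJlt j hj)).disj
      · exact (hld j (hJlt j hj) j' (hJlt j' hj') hjj).mono (hL j (hJlt j hj)).supp_subset
          (hL j' (hJlt j' hj')).subset
    · intro i hi j hj
      rw [Finset.disjoint_left]
      intro x hx hx'
      exact hbS i hi x ((hK i hi).supp_subset hx)
        ((hl j (hJlt j hj)).2.1 ((hL j (hJlt j hj)).subset hx'))
    · intro i hi j hj
      have Lj := hL j (hJlt j hj)
      rw [Finset.disjoint_left]
      intro x hx hx'
      rcases Finset.mem_union.1 hx' with hx' | hx'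
      · have := hXl i hi j (hJlt j hj) x ((hK i hi).subset' hx') (Lj.supp_subset hx)
        exact Lj.notMem_supp i hi (this ▸ hx)
      · exact hbS i hi x ((hK i hi).subset hx') ((hl j (hJlt j hj)).2.1 (Lj.supp_subset hx))
  have hFP : ∀ i x, x ∈ A₀ ∩ (k i).1 → (c x : ℕ) = i → x ∈ A₀ ∧ (c x : ℕ) < q ∧
      x ∈ (k (c x)).1 ∪ (k (c x)).2.1 := by
    intro i x hx hcx
    rw [Finset.mem_inter] at hx
    exact ⟨hx.1, hcq x, Finset.mem_union_left _ (hcx.symm ▸ hx.2)⟩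
  refine ⟨_, _, fun i => (A₀ ∩ (k i).1).filter fun v => (c v : ℕ) = i, N.sep, N.disj, ?_, ?_,
    ?_, ?_, ?_, ?_⟩
  · intro i x hx
    rw [Finset.mem_filter] at hx
    have := hFP i x hx.1 hx.2
    exact Finset.mem_union_left _ (Finset.mem_biUnion.2 ⟨_, Finset.mem_range.2 this.2.1, this.2.2⟩)
  · intro i j hij
    rw [Finset.disjoint_left]
    intro x hx hx'
    exact hij ((Finset.mem_filter.1 hx).2.symm.trans (Finset.mem_filter.1 hx').2)
  · have := N.card
    omega
  · have hsub : supp ((Finset.range q).biUnion (fun i => (k i).2.2.1) ∪ J.biUnion fun j => (l j).1) ∪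
        ((Finset.range q).biUnion (fun i => (k i).1 ∪ (k i).2.1) ∪ J.biUnion fun j => (l j).2.1)
        ⊆ S₂ := by
      rw [supp_union, supp_biUnion, supp_biUnion]
      simp only [Finset.union_subset_iff, Finset.biUnion_subset, Finset.mem_range]
      exact ⟨⟨fun i hi => (hK i hi).supp_subset.trans (hk i hi).2.1,
        fun j hj => ((hL j (hJlt j hj)).supp_subset.trans (hl j (hJlt j hj)).2.1).trans hSS⟩,
        fun i hi => ⟨((hK i hi).subset'.trans (hXS i hi)).trans hSS,
          (hK i hi).subset.trans (hk i hi).2.1⟩,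
        fun j hj => ((hL j (hJlt j hj)).subset.trans (hl j (hJlt j hj)).2.1).trans hSS⟩
    have := Finset.card_le_card hsub
    omega
  · intro v
    refine ⟨((nbr G v ∩ A₀) \ Lw).image fun x => (c x : ℕ), ?_, ?_⟩
    · have h1 : (nbr G v ∩ A₀).image (fun x => (c x : ℕ)) ⊆
          ((nbr G v ∩ A₀) \ Lw).image (fun x => (c x : ℕ)) ∪ Lw.image fun x => (c x : ℕ) := by
        rw [← Finset.image_union]
        refine Finset.image_subset_image ?_
        rw [Finset.sdiff_union_self_eq_union]
        exact Finset.subset_union_left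
      have h2 := Finset.card_le_card h1
      have h3 := Finset.card_union_le (((nbr G v ∩ A₀) \ Lw).image fun x => (c x : ℕ))
        (Lw.image fun x => (c x : ℕ))
      have h4 : (Lw.image fun x => (c x : ℕ)).card ≤ Lw.card := Finset.card_image_le
      have h5 := hc v
      have h6 : ((nbr G v ∩ A₀).image (fun x => (c x : ℕ))).card =
          ((nbr G v ∩ A₀).image c).card := by
        rw [← Finset.card_image_of_injective ((nbr G v ∩ A₀).image c) Fin.val_injective,
          Finset.image_image]
        rfl
      omega
    · intro i hi
      obtain ⟨x, hx, rfl⟩ := Finset.mem_image.1 hi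
      simp only [Finset.mem_sdiff, Finset.mem_inter] at hx
      refine ⟨x, Finset.mem_inter.2 ⟨hx.1.1, Finset.mem_filter.2 ⟨Finset.mem_inter.2
        ⟨hx.1.2, ?_⟩, rfl⟩⟩⟩
      exact hkept _ (hcq x) x ((memX _ _).2 (Or.inl ⟨hx.1.2, rfl⟩)) hx.2
  · intro Z hZF hZ1 hZc
    refine N.absorbs (c := fun x => (c x : ℕ)) (fun z hz => ?_) (fun z hz z' hz' h => ?_) (by omega)
    · obtain ⟨i, hi⟩ := hZF z hz
      rw [Finset.mem_filter] at hi
      exact (hFP i z hi.1 hi.2).2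
    · obtain ⟨i, hi⟩ := hZF z hz
      obtain ⟨i', hi'⟩ := hZF z' hz'
      have e1 := (Finset.mem_filter.1 hi).2
      have e2 := (Finset.mem_filter.1 hi').2
      obtain rfl : i = i' := by rw [← e1, ← e2]; exact h
      exact Finset.card_le_one.1 (hZ1 i) z (Finset.mem_inter.2 ⟨hz, hi⟩) z'
        (Finset.mem_inter.2 ⟨hz', hi'⟩)

end Absorber

/-! ### Trees with many leaves -/

section Leaves
open scoped Classical

variable {V W : Type*} [Fintype V] [Fintype W] {G : SimpleGraph V} {T : SimpleGraph W}
  {ρ : W} {par : W → W} {dep : W → ℕ} {m Δ : ℕ}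

lemma Rooted.dep_pos_iff (R : Rooted T ρ par dep) {v : W} : 0 < dep v ↔ v ≠ ρ := by
  constructor
  · rintro h rfl
    rw [R.dep_root] at h
    exact absurd h (lt_irrefl _)
  · intro h
    have := R.dep_par v h
    omega

lemma Rooted.card_children_le (R : Rooted T ρ par dep) (hΔ : ∀ w, (nbr T w).card ≤ Δ) (p : W) :
    (Finset.univ.filter fun v => v ≠ ρ ∧ par v = p).card ≤ Δ := by
  refine (Finset.card_le_card fun v hv => ?_).trans (hΔ p)
  rw [Finset.mem_filter] at hv
  rw [mem_nbr, ← hv.2.2]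
  exact R.adj_par v hv.2.1

/-- A set containing the root and closed under taking parents. -/
def ParClosed (ρ : W) (par : W → W) (U : Finset W) : Prop :=
  ρ ∈ U ∧ ∀ v ∈ U, v ≠ ρ → par v ∈ U

lemma Rooted.card_le_of_dep_le (R : Rooted T ρ par dep) (hΔ : ∀ w, (nbr T w).card ≤ Δ)
    (x : W) (S : Finset W) (hS : ∀ v ∈ S, v = x ∨ (v ≠ ρ ∧ par v = x) ∨
      (v ≠ ρ ∧ par v ≠ ρ ∧ par (par v) = x)) : S.card ≤ 1 + Δ + Δ * Δ := by
  obtain ⟨Ch, hCh⟩ : ∃ Ch : W → Finset W, Ch = fun p =>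
    Finset.univ.filter fun v => v ≠ ρ ∧ par v = p := ⟨_, rfl⟩
  have hC : ∀ p, (Ch p).card ≤ Δ := fun p => by rw [hCh]; exact R.card_children_le hΔ p
  have hsub : S ⊆ {x} ∪ Ch x ∪ (Ch x).biUnion Ch := by
    intro v hv
    simp only [hCh, Finset.mem_union, Finset.mem_singleton, Finset.mem_biUnion, Finset.mem_filter,
      Finset.mem_univ, true_and]
    rcases hS v hv with h | h | h
    · exact Or.inl (Or.inl h)
    · exact Or.inl (Or.inr h)
    · exact Or.inr ⟨par v, ⟨h.2.1, h.2.2⟩, h.1, rfl⟩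
  have h1 := Finset.card_le_card hsub
  have h2 := Finset.card_union_le ({x} ∪ Ch x) ((Ch x).biUnion Ch)
  have h3 := Finset.card_union_le {x} (Ch x)
  have h4 : ((Ch x).biUnion Ch).card ≤ (Ch x).card * Δ :=
    Finset.card_biUnion_le_card_mul _ _ _ fun b _ => hC b
  have h5 := Nat.mul_le_mul_right Δ (hC x)
  have h6 := hC x
  rw [Finset.card_singleton] at h3
  omega

/-- Cutting off a vertex at distance two above a deepest vertex, with its descendants. -/
lemma Rooted.exists_peel (R : Rooted T ρ par dep) (hΔ : ∀ w, (nbr T w).card ≤ Δ) {U : Finset W}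
    (hU : ParClosed ρ par U) (hc : 1 + Δ + Δ * Δ < U.card) :
    ∃ l, ∃ U' ⊆ U, ParClosed ρ par U' ∧ U.card ≤ U'.card + (1 + Δ + Δ * Δ) ∧ l ∈ U ∧
      l ≠ ρ ∧ par l ≠ ρ ∧ par (par l) ≠ ρ ∧ par (par l) ∉ U' ∧ par (par (par l)) ∈ U' := by
  obtain ⟨l, hl, hmax⟩ := U.exists_max_image dep ⟨ρ, hU.1⟩
  have hdl : 3 ≤ dep l := by
    by_contra hlt
    -- If no vertex of `U` were deeper than two, `U` would consist of the root, its children and its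
    -- grandchildren, too few for `hc`.
    refine absurd (R.card_le_of_dep_le hΔ ρ U fun v hv => ?_) (by omega)
    have h1 := hmax v hv
    by_cases hv : v = ρ
    · exact Or.inl hv
    · have h2 := R.dep_par v hv
      by_cases hpv : par v = ρ
      · exact Or.inr (Or.inl ⟨hv, hpv⟩)
      · have h3 := R.dep_par _ hpv
        refine Or.inr (Or.inr ⟨hv, hpv, ?_⟩)
        by_contra h4
        have := R.dep_par _ h4
        omega
  have hlρ : l ≠ ρ := R.dep_pos_iff.1 (by omega)
  have d1 := R.dep_par l hlρ
  have hpρ : par l ≠ ρ := R.dep_pos_iff.1 (by omega)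
  have d2 := R.dep_par _ hpρ
  have hxρ : par (par l) ≠ ρ := R.dep_pos_iff.1 (by omega)
  have d3 := R.dep_par _ hxρ
  obtain ⟨x, hx⟩ : ∃ x, x = par (par l) := ⟨_, rfl⟩
  rw [← hx] at hxρ d2 d3
  obtain ⟨S, hS⟩ : ∃ S : Finset W, S = U.filter fun v => v = x ∨ (v ≠ ρ ∧ par v = x) ∨
      (v ≠ ρ ∧ par v ≠ ρ ∧ par (par v) = x) := ⟨_, rfl⟩
  have memS : ∀ v, v ∈ S ↔ v ∈ U ∧ (v = x ∨ (v ≠ ρ ∧ par v = x) ∨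
      (v ≠ ρ ∧ par v ≠ ρ ∧ par (par v) = x)) := fun v => by rw [hS, Finset.mem_filter]
  have hdS : ∀ v ∈ S, dep x ≤ dep v := by
    intro v hv
    rcases ((memS v).1 hv).2 with h | ⟨h, h'⟩ | ⟨h, h', h''⟩
    · rw [h]
    · have := R.dep_par v h
      rw [h'] at this; omega
    · have a1 := R.dep_par v h
      have a2 := R.dep_par _ h'
      rw [h''] at a2; omega
  have hSc : S.card ≤ 1 + Δ + Δ * Δ := R.card_le_of_dep_le hΔ x S fun v hv => ((memS v).1 hv).2
  have hxU : x ∈ U := hx ▸ hU.2 _ (hU.2 l hl hlρ) hpρ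
  refine ⟨l, U \ S, Finset.sdiff_subset, ⟨Finset.mem_sdiff.2 ⟨hU.1, fun h => ?_⟩,
    fun v hv hvρ => ?_⟩, ?_, hl, hlρ, hpρ,
    hx ▸ hxρ, fun h => ?_, Finset.mem_sdiff.2 ⟨hx ▸ hU.2 x hxU hxρ, fun h => ?_⟩⟩
  · have := hdS _ h
    rw [R.dep_root] at this
    omega
  · rw [Finset.mem_sdiff] at hv ⊢
    refine ⟨hU.2 v hv.1 hvρ, fun h => ?_⟩
    have hpρ : par v ≠ ρ := by
      rintro h'
      have := hdS _ h
      rw [h', R.dep_root] at this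
      omega
    rcases ((memS _).1 h).2 with h | ⟨h, h'⟩ | ⟨h, h', h''⟩
    · exact hv.2 ((memS v).2 ⟨hv.1, Or.inr (Or.inl ⟨hvρ, h⟩)⟩)
    · exact hv.2 ((memS v).2 ⟨hv.1, Or.inr (Or.inr ⟨hvρ, h, h'⟩)⟩)
    -- A child of a grandchild of `x` would be three levels below `x`, deeper than the deepest
    -- vertex `l`, which is two levels below `x`.
    · have a1 := R.dep_par v hvρ
      have a2 := R.dep_par _ h
      have a3 := R.dep_par _ h'
      rw [h''] at a3
      have := hmax v hv.1
      omega
  · have := Finset.le_card_sdiff S U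
    omega
  · rw [← hx] at h
    exact (Finset.mem_sdiff.1 h).2 ((memS x).2 ⟨hxU, Or.inl rfl⟩)
  · rw [← hx] at h
    have := hdS _ h
    omega

variable {P : Palette V V}

/-- Re-attaching the removed parts of a tree while covering prescribed vertices. -/
lemma Rooted.exists_cover (R : Rooted T ρ par dep) (hJ : Joined G m)
    (hΔ : ∀ w, (nbr T w).card ≤ Δ) (hΔ1 : 1 ≤ Δ) (hlab : ∀ v, P.label v = v)
    (hall : P.allowed = Finset.univ) (hhit : ∀ v, 6 * (Δ * m) ≤ (P.hits G v).card) (k : ℕ)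
    (hk : (k + 1) * (1 + Δ + Δ * Δ) < Fintype.card W) :
    ∃ U : Finset W, ParClosed ρ par U ∧ Fintype.card W ≤ U.card + k * (1 + Δ + Δ * Δ) ∧
      ∀ (L : Finset W), L ⊆ U → ρ ∉ L → (∀ v, v ≠ ρ → par v ∉ L) →
      (Finset.univ \ L).card + (2 * m + 1) * m ≤ (P.allowed \ P.tokens).card →
      ∀ (Z₀ Z : Finset V), Z₀.card ≤ m → Z ⊆ Z₀ → Z.card ≤ k → ∀ φ : W → V,
      Emb G T P (U \ L) φ → Charged G T P Z₀ (2 * m) (U \ L) φ →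
      ∃ φ' : W → V, (∀ w ∈ U \ L, φ' w = φ w) ∧ Emb G T P (Finset.univ \ L) φ' ∧
        Charged G T P Z₀ (2 * m) (Finset.univ \ L) φ' ∧
        ∀ z ∈ Z, ∃ w ∈ Finset.univ \ L, φ' w = z := by
  have hm := hJ.pos
  have hμ : m ≤ Δ * m := Nat.le_mul_of_pos_left m hΔ1
  -- `U` is fixed before the embedding and the vertices to be covered, since the latter depend on
  -- how `U` is embedded. Each step peels off a further piece able to cover one vertex. The exempt
  -- set `Z₀` stays the same throughout, while the set `Z` still to be covered shrinks.
  induction k with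
  | zero =>
    refine ⟨Finset.univ, ⟨Finset.mem_univ _, fun _ _ _ => Finset.mem_univ _⟩, by simp,
      fun L _ _ _ _ Z₀ Z _ _ hZ φ E I => ⟨φ, fun _ _ => rfl, E, I, fun z hz => ?_⟩⟩
    rw [Finset.card_eq_zero.1 (Nat.le_zero.1 hZ)] at hz
    exact absurd hz (Finset.notMem_empty _)
  | succ k ih =>
    have e1 : (k + 1 + 1) * (1 + Δ + Δ * Δ) = (k + 1) * (1 + Δ + Δ * Δ) + (1 + Δ + Δ * Δ) := by ring
    have e2 : (k + 1) * (1 + Δ + Δ * Δ) = k * (1 + Δ + Δ * Δ) + (1 + Δ + Δ * Δ) := by ring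
    obtain ⟨U, hU, hUc, hcov⟩ := ih (by omega)
    obtain ⟨l, U', hUU, hU', hU'c, hl, hlρ, hpρ, hxρ, hxU, hyU⟩ := R.exists_peel hΔ hU (by omega)
    refine ⟨U', hU', by omega, fun L hL hρL hLc hf Z₀ Z hZ₀ hZZ hZ φ E I => ?_⟩
    have hpc : ∀ v ∈ U', v ∉ L → v = ρ ∨ par v ∈ U' \ L := by
      intro v hv _
      by_cases h : v = ρ
      · exact Or.inl h
      · exact Or.inr (Finset.mem_sdiff.2 ⟨hU'.2 v hv h, hLc v h⟩)
    have hhit' : ∀ v, Z₀.card + Δ * m < (P.hits G v).card := fun v => by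
      have := hhit v; omega
    rcases Z.eq_empty_or_nonempty with rfl | ⟨z, hz⟩
    · obtain ⟨φ', e', E', I'⟩ := E.extend R hJ hΔ (D' := Finset.univ \ L) (t := 2 * m) (Z := Z₀)
        (by omega) (Finset.sdiff_subset_sdiff (Finset.subset_univ _) (Finset.Subset.refl _))
        (fun v hv hv' => by
          have h : v ∉ U' := fun h => hv' (Finset.mem_sdiff.2 ⟨h, (Finset.mem_sdiff.1 hv).2⟩)
          have h' : v ≠ ρ := by rintro rfl; exact h hU'.1
          exact ⟨h', Finset.mem_sdiff.2 ⟨Finset.mem_univ _, hLc v h'⟩⟩)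
        (fun c hc => by
          rw [Finset.mem_sdiff] at hc
          rcases hpc c hc.1 hc.2 with h | h
          exacts [Or.inl h, Or.inr (Or.inl h)]) hf hhit' I
      exact ⟨φ', e', E', I', by simp⟩
    have hZk : (Z.erase z).card ≤ k := by
      rw [Finset.card_erase_of_mem hz]; omega
    have hLU : L ⊆ U := hL.trans hUU
    have hsubUL : U \ L ⊆ Finset.univ \ L :=
      Finset.sdiff_subset_sdiff (Finset.subset_univ _) (Finset.Subset.refl _)
    have hfU : (U \ L).card + (2 * m + 1) * m ≤ (P.allowed \ P.tokens).card := by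
      have := Finset.card_le_card hsubUL
      omega
    suffices h : ∃ φ₁ : W → V, (∀ w ∈ U' \ L, φ₁ w = φ w) ∧ Emb G T P (U \ L) φ₁ ∧
        Charged G T P Z₀ (2 * m) (U \ L) φ₁ ∧ ∃ w ∈ U \ L, φ₁ w = z by
      obtain ⟨φ₁, e₁, E₁, I₁, w, hw, hwz⟩ := h
      obtain ⟨φ₂, e₂, E₂, I₂, c₂⟩ := hcov L hLU hρL hLc hf Z₀ (Z.erase z) hZ₀
        ((Finset.erase_subset _ _).trans hZZ) hZk φ₁ E₁ I₁
      have hs : U' \ L ⊆ U \ L := Finset.sdiff_subset_sdiff hUU (Finset.Subset.refl _)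
      refine ⟨φ₂, fun w hw => (e₂ w (hs hw)).trans (e₁ w hw), E₂, I₂, fun z' hz' => ?_⟩
      by_cases hzz : z' = z
      · exact ⟨w, hsubUL hw, by rw [e₂ w hw, hwz, hzz]⟩
      · exact c₂ z' (Finset.mem_erase.2 ⟨hzz, hz'⟩)
    obtain ⟨p, hp⟩ : ∃ p, p = par l := ⟨_, rfl⟩
    obtain ⟨x, hx⟩ : ∃ x, x = par p := ⟨_, rfl⟩
    rw [← hp, ← hx] at hxU hyU
    rw [← hp] at hpρ
    rw [← hp, ← hx] at hxρ
    have hpU : p ∉ U' := fun h => hxU (hx ▸ hU'.2 p h hpρ)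
    have hlU : l ∉ U' := fun h => hpU (hp ▸ hU'.2 l h hlρ)
    have dl := R.dep_par l hlρ
    have dp := R.dep_par p hpρ
    have dx := R.dep_par x hxρ
    rw [← hp] at dl
    rw [← hx] at dp
    have hlx : l ≠ x := by rintro h; rw [h] at dl; omega
    have hlp : l ≠ p := by rintro h; rw [h] at dl; omega
    have hpx : p ≠ x := by rintro h; rw [h] at dp; omega
    have hxL : x ∉ L := hx ▸ hLc p hpρ
    have hpL : p ∉ L := hp ▸ hLc l hlρ
    have hyL : par x ∉ L := hLc x hxρ
    by_cases hlz : ∃ w ∈ U' \ L, φ w = z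
    · obtain ⟨w, hw, hwz⟩ := hlz
      have hs : U' \ L ⊆ U \ L := Finset.sdiff_subset_sdiff hUU (Finset.Subset.refl _)
      obtain ⟨φ', e', E', I'⟩ := E.extend R hJ hΔ (D' := U \ L) (t := 2 * m) (Z := Z₀)
        (by omega) hs
        (fun v hv hv' => by
          rw [Finset.mem_sdiff] at hv
          have h : v ∉ U' := fun h => hv' (Finset.mem_sdiff.2 ⟨h, hv.2⟩)
          have h' : v ≠ ρ := by rintro rfl; exact h hU'.1
          exact ⟨h', Finset.mem_sdiff.2 ⟨hU.2 v hv.1 h', hLc v h'⟩⟩)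
        (fun c hc => by
          rw [Finset.mem_sdiff] at hc
          rcases hpc c hc.1 hc.2 with h | h
          exacts [Or.inl h, Or.inr (Or.inl h)]) hfU hhit' I
      exact ⟨φ', e', E', I', w, hs hw, (e' w hw).trans hwz⟩
    push Not at hlz
    have hlL : l ∉ L := fun h => hlU (hL h)
    obtain ⟨D, hD⟩ : ∃ D, D = U' \ L := ⟨_, rfl⟩
    have memD : ∀ v, v ∈ D ↔ v ∈ U' ∧ v ∉ L := fun v => by rw [hD, Finset.mem_sdiff]
    rw [← hD] at E I hlz ⊢
    have hchild : ∀ c ∈ D, c ≠ ρ → par c ∈ U' := fun c hc h => hU'.2 c ((memD c).1 hc).1 h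
    have hlD : l ∉ D := fun h => hlU ((memD l).1 h).1
    have hpD : p ∉ D := fun h => hpU ((memD p).1 h).1
    have hxD : x ∉ D := fun h => hxU ((memD x).1 h).1
    have hyD : par x ∈ D := (memD _).2 ⟨hyU, hyL⟩
    -- The deepest vertex `l` of the piece is put on `z`; none of its neighbours is embedded yet. It
    -- is then connected to `par x` by the path `par x, x, p, l` of length three, and the rest of
    -- the piece is added greedily.
    have E₀ : Emb G T P (insert l D) (Function.update φ l z) := by
      refine E.addVertex hlD (by rw [hall]; exact Finset.mem_univ _) (fun w hw h => ?_)
        fun b hb hbl => ?_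
      · rw [hlab, hlab] at h
        exact hlz w hw h
      · exfalso
        rcases R.adj_cases b l hbl with h | h
        · exact hpD (by rw [hp, ← h.1]; exact hb)
        · exact hlU (h.1 ▸ hchild b hb h.2)
    have e₀ : ∀ w ∈ D, Function.update φ l z w = φ w := fun w hw =>
      Function.update_of_ne (by rintro rfl; exact hlD hw) _ _
    have I₀ : Charged G T P Z₀ (2 * m) (insert l D) (Function.update φ l z) := by
      -- If `z` is a token, its use cannot be charged to a neighbour of `l`; this is what the
      -- exemption of `Z₀` is for.
      refine I.mono (Finset.subset_insert _ _) e₀ fun w hw hwD _ => Or.inl ?_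
      obtain rfl : w = l := by simpa [hwD] using hw
      rw [Function.update_self]
      exact hZZ hz
    have hDU : D ⊆ U \ L := hD ▸ Finset.sdiff_subset_sdiff hUU (Finset.Subset.refl _)
    have hlUL : l ∈ U \ L := Finset.mem_sdiff.2 ⟨hl, hlL⟩
    have hpUL : p ∈ U \ L := Finset.mem_sdiff.2 ⟨hp ▸ hU.2 l hl hlρ, hpL⟩
    have hxUL : x ∈ U \ L :=
      Finset.mem_sdiff.2 ⟨hx ▸ hU.2 p (Finset.mem_sdiff.1 hpUL).1 hpρ, hxL⟩
    have hu := I₀.card_used_le E₀ hJ hΔ (by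
      have := Finset.card_le_card (Finset.insert_subset hlUL hDU)
      omega)
    obtain ⟨φ₁, e₁, E₁, tx, tp⟩ := E₀.join hJ (a := par x) (x := x) (y := p) (b := l)
      (by simp [hlx.symm, hxD]) (by simp [hlp.symm, hpD]) hpx.symm
      (fun c hc hcx => by
        rcases R.adj_cases c x hcx with h | h
        · exact h.1
        · exfalso
          rcases Finset.mem_insert.1 hc with h' | h'
          · exact hpx (by rw [hp, h.1, h'])
          · exact hxU (h.1 ▸ hchild c h' h.2))
      (fun c hc hcp => by
        rcases Finset.mem_insert.1 hc with h' | h'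
        · exact h'
        · exfalso
          rcases R.adj_cases c p hcp with h | h
          · exact hxD (by rw [hx, ← h.1]; exact h')
          · exact hpU (h.1 ▸ hchild c h' h.2))
      (fun v => by have := hhit v; omega)
    obtain ⟨D₁, hD₁⟩ : ∃ D₁, D₁ = insert p (insert x (insert l D)) := ⟨_, rfl⟩
    have memD₁ : ∀ v, v ∈ D₁ ↔ v = p ∨ v = x ∨ v = l ∨ v ∈ D := fun v => by
      rw [hD₁]; simp only [Finset.mem_insert]
    have I₁ : Charged G T P Z₀ (2 * m) D₁ φ₁ := by
      refine I₀.mono (fun w hw => ?_) e₁ fun w hw hwD hwt => Or.inr ?_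
      · rw [memD₁]
        exact Or.inr (Or.inr (Finset.mem_insert.1 hw))
      · rw [Finset.mem_insert, not_or] at hwD
        rcases (memD₁ w).1 hw with rfl | rfl | h | h
        · refine ⟨l, (memD₁ _).2 (Or.inr (Or.inr (Or.inl rfl))), ?_, ?_⟩
          · rw [hp]; exact (R.adj_par l hlρ).symm
          · rw [e₁ l (Finset.mem_insert_self _ _)]
            exact tp hwt
        · refine ⟨par w, (memD₁ _).2 (Or.inr (Or.inr (Or.inr hyD))), R.adj_par w hxρ, ?_⟩
          rw [e₁ _ (Finset.mem_insert_of_mem hyD)]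
          exact tx hwt
        · exact absurd h hwD.1
        · exact absurd h hwD.2
    rw [← hD₁] at E₁
    obtain ⟨φ₂, e₂, E₂, I₂⟩ := E₁.extend R hJ hΔ (D' := U \ L) (t := 2 * m) (Z := Z₀)
        (by omega) (by
          intro w hw
          rcases (memD₁ w).1 hw with rfl | rfl | rfl | h
          exacts [hpUL, hxUL, hlUL, hDU h])
        (fun v hv hv' => by
          rw [Finset.mem_sdiff] at hv
          have h : v ∉ U' := fun h =>
            hv' ((memD₁ v).2 (Or.inr (Or.inr (Or.inr ((memD v).2 ⟨h, hv.2⟩)))))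
          have h' : v ≠ ρ := by rintro rfl; exact h hU'.1
          exact ⟨h', Finset.mem_sdiff.2 ⟨hU.2 v hv.1 h', hLc v h'⟩⟩)
        (fun c hc => by
          rcases (memD₁ c).1 hc with h | h | h | h
          · exact Or.inr (Or.inl ((memD₁ _).2 (Or.inr (Or.inl (by rw [h, hx])))))
          · exact Or.inr (Or.inl ((memD₁ _).2 (Or.inr (Or.inr (Or.inr (h ▸ hyD))))))
          · exact Or.inr (Or.inl ((memD₁ _).2 (Or.inl (by rw [h, hp]))))
          · rcases hpc c ((memD c).1 h).1 ((memD c).1 h).2 with h' | h'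
            · exact Or.inl h'
            · exact Or.inr (Or.inl ((memD₁ _).2 (Or.inr (Or.inr (Or.inr (hD ▸ h'))))))) hfU hhit' I₁
    refine ⟨φ₂, fun w hw => ?_, E₂, I₂, l, hlUL, ?_⟩
    · rw [e₂ w ((memD₁ w).2 (Or.inr (Or.inr (Or.inr hw)))), e₁ w (Finset.mem_insert_of_mem hw),
        e₀ w hw]
    · rw [e₂ l ((memD₁ l).2 (Or.inr (Or.inr (Or.inl rfl)))), e₁ l (Finset.mem_insert_self _ _),
        Function.update_self]

lemma card_le_mul_card_image_of_fibers {L : Finset W} {g : W → V}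
    (hfib : ∀ v, (L.filter fun l => g l = v).card ≤ Δ) : L.card ≤ Δ * (L.image g).card := by
  refine Finset.card_le_mul_card_image L Δ fun v _ => ?_
  exact hfib v

/-- Hall's condition for matching the vertices `l` of `L` to neighbours of `g l`. -/
lemma Joined.exists_matching (hJ : Joined G m) {L : Finset W} {g : W → V} {R : Finset V}
    (hRc : R.card = L.card) (hgR : ∀ l ∈ L, g l ∉ R)
    (hfib : ∀ v, (L.filter fun l => g l = v).card ≤ Δ)
    (hnb : ∀ l ∈ L, Δ * m ≤ (nbr G (g l) ∩ R).card)
    (hR : ∀ r ∈ R, m ≤ (L.filter fun l => G.Adj (g l) r).card) :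
    ∃ f : W → V, (∀ l ∈ L, f l ∈ R ∧ G.Adj (g l) (f l)) ∧
      ∀ l ∈ L, ∀ l' ∈ L, f l = f l' → l = l' := by
  have hall := (Finset.all_card_le_biUnion_card_iff_exists_injective
    fun l : L => nbr G (g l) ∩ R).1 fun S => ?_
  · obtain ⟨f, hf, hfm⟩ := hall
    have hV : ∀ l ∈ L, Nonempty V := fun l _ => ⟨g l⟩
    refine ⟨fun l => if h : l ∈ L then f ⟨l, h⟩ else g l, fun l hl => ?_, fun l hl l' hl' h => ?_⟩
    · simp only [hl, dite_true]
      have := Finset.mem_inter.1 (hfm ⟨l, hl⟩)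
      exact ⟨this.2, mem_nbr.1 this.1⟩
    · simp only [hl, hl', dite_true] at h
      simpa using hf h
  obtain ⟨S', hS'⟩ : ∃ S' : Finset W, S' = S.map (Function.Embedding.subtype _) := ⟨_, rfl⟩
  have hSL : S' ⊆ L := by
    intro l hl
    rw [hS', Finset.mem_map] at hl
    obtain ⟨a, -, rfl⟩ := hl
    exact a.2
  have hSc : S.card = S'.card := by rw [hS', Finset.card_map]
  have hSU : S.biUnion (fun l : L => nbr G (g l) ∩ R) = S'.biUnion fun l => nbr G (g l) ∩ R := by
    rw [hS', Finset.map_eq_image, Finset.image_biUnion]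
    rfl
  rw [hSc, hSU]
  obtain ⟨U, hU⟩ : ∃ U, U = S'.biUnion fun l => nbr G (g l) ∩ R := ⟨_, rfl⟩
  rw [← hU]
  have memU : ∀ r, r ∈ U ↔ r ∈ R ∧ ∃ l ∈ S', G.Adj (g l) r := fun r => by
    simp only [hU, Finset.mem_biUnion, Finset.mem_inter, mem_nbr]
    constructor
    · rintro ⟨l, h1, h2, h3⟩; exact ⟨h3, l, h1, h2⟩
    · rintro ⟨h3, l, h1, h2⟩; exact ⟨l, h1, h2, h3⟩
  have hXc : S'.card ≤ Δ * (S'.image g).card := card_le_mul_card_image_of_fibers fun v =>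
    (Finset.card_le_card (Finset.filter_subset_filter _ hSL)).trans (hfib v)
  -- Hall's condition in three ranges. With fewer than `m` parent images, `S'` has at most `Δ * m`
  -- elements and one neighbourhood suffices. Otherwise fewer than `m` vertices of `R` are missed,
  -- which settles `S'.card + m ≤ R.card`. For larger `S'` fewer than `m` leaves lie outside `S'`,
  -- so by `hR` no vertex of `R` is missed.
  by_cases hX : (S'.image g).card < m
  · rcases S'.eq_empty_or_nonempty with h | ⟨l, hl⟩
    · simp [h]
    · calc S'.card ≤ Δ * m := hXc.trans (Nat.mul_le_mul_left _ hX.le)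
        _ ≤ _ := hnb l (hSL hl)
        _ ≤ U.card := by
          rw [hU]
          exact Finset.card_le_card
            (Finset.subset_biUnion_of_mem (fun l => nbr G (g l) ∩ R) hl)
  · push Not at hX
    have h1 : (R \ U).card < m := by
      by_contra hcon
      push Not at hcon
      obtain ⟨x, hx, y, hy, hxy⟩ := hJ (S'.image g) (R \ U) (by
        rw [Finset.disjoint_left]
        intro v hv hv'
        obtain ⟨l, hl, rfl⟩ := Finset.mem_image.1 hv
        exact hgR l (hSL hl) (Finset.mem_sdiff.1 hv').1) hX hcon
      obtain ⟨l, hl, rfl⟩ := Finset.mem_image.1 hx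
      rw [Finset.mem_sdiff] at hy
      exact hy.2 ((memU y).2 ⟨hy.1, l, hl, hxy⟩)
    by_cases hS : S'.card + m ≤ R.card
    · have := Finset.le_card_sdiff U R
      omega
    · have hRU : R ⊆ U := by
        intro r hr
        rw [memU]
        refine ⟨hr, ?_⟩
        by_contra hno
        push Not at hno
        have h2 : (L.filter fun l => G.Adj (g l) r) ⊆ L \ S' := by
          intro l hl
          rw [Finset.mem_filter] at hl
          exact Finset.mem_sdiff.2 ⟨hl.1, fun h => hno l h hl.2⟩
        have h3 := Finset.card_le_card h2
        rw [Finset.card_sdiff_of_subset hSL] at h3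
        have h4 := hR r hr
        have h5 := Finset.card_le_card hSL
        omega
      have h5 := Finset.card_le_card hSL
      have h6 := Finset.card_le_card hRU
      omega

/-- For `m` such vertices `Z`, discarding all leaves whose image under `g` is adjacent to `Z` costs
at most `m * (m - 1)` leaves. The others have at least `2 * m` images under `g`, of which `m` lie
outside `Z` and have no edge to it. -/
lemma Joined.card_few_lt (hJ : Joined G m) {L : Finset W} {g : W → V}
    (hfib : ∀ v, (L.filter fun l => g l = v).card ≤ Δ) (hL : Δ * (2 * m) + m * m ≤ L.card) :
    (Finset.univ.filter fun r => (L.filter fun l => G.Adj (g l) r).card < m).card < m := by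
  by_contra hcon
  push Not at hcon
  obtain ⟨Z, hZ, hZm⟩ := Finset.exists_subset_card_eq hcon
  have hm := hJ.pos
  have h1 : (Z.biUnion fun r => L.filter fun l => G.Adj (g l) r).card ≤ m * (m - 1) := by
    rw [← hZm]
    nth_rewrite 2 [hZm]
    refine Finset.card_biUnion_le_card_mul _ _ _ fun r hr => ?_
    have := (Finset.mem_filter.1 (hZ hr)).2
    omega
  obtain ⟨S, hS⟩ : ∃ S, S = L \ Z.biUnion fun r => L.filter fun l => G.Adj (g l) r := ⟨_, rfl⟩
  have h2 := Finset.le_card_sdiff (Z.biUnion fun r => L.filter fun l => G.Adj (g l) r) L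
  have hSL : S ⊆ L := hS ▸ Finset.sdiff_subset
  have hXc : S.card ≤ Δ * (S.image g).card := card_le_mul_card_image_of_fibers fun v =>
    (Finset.card_le_card (Finset.filter_subset_filter _ hSL)).trans (hfib v)
  have h3 : m * (m - 1) + m = m * m := by
    obtain ⟨k, rfl⟩ : ∃ k, m = k + 1 := ⟨m - 1, by omega⟩
    simp only [Nat.add_sub_cancel]; ring
  rw [← hS] at h2
  have h4 : 2 * m ≤ (S.image g).card := by
    by_contra hlt
    push Not at hlt
    have := Nat.mul_le_mul_left Δ hlt.le
    omega
  have h5 := Finset.le_card_sdiff Z (S.image g)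
  obtain ⟨x, hx, y, hy, hxy⟩ := hJ (S.image g \ Z) Z Finset.sdiff_disjoint (by omega) hZm.ge
  obtain ⟨l, hl, rfl⟩ := Finset.mem_image.1 (Finset.mem_sdiff.1 hx).1
  rw [hS, Finset.mem_sdiff] at hl
  exact hl.2 (Finset.mem_biUnion.2 ⟨y, hy, Finset.mem_filter.2 ⟨hl.1, hxy⟩⟩)

/-- The embedding of a tree with many leaves. -/
theorem Joined.exists_emb_of_leaves (hJ : Joined G m) (R : Rooted T ρ par dep)
    (hΔ : ∀ w, (nbr T w).card ≤ Δ) (hcard : Fintype.card V = Fintype.card W)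
    (hdeg : ∀ v, 240 * (Δ * m) ≤ (nbr G v).card)
    (hn : 10 ^ 9 * (Δ * m) ^ 2 ≤ Fintype.card V) (L : Finset W) (hLρ : ρ ∉ L)
    (hLc : ∀ v, v ≠ ρ → par v ∉ L) (hL : Fintype.card V ≤ 2000 * L.card) :
    ∃ φ : W → V, Function.Injective φ ∧ ∀ u v, T.Adj u v → G.Adj (φ u) (φ v) := by
  have hm := hJ.pos
  have hV : 0 < Fintype.card V := hcard ▸ Fintype.card_pos_iff.2 ⟨ρ⟩
  have hΔ1 : 1 ≤ Δ := by
    obtain ⟨l, hl⟩ := Finset.card_pos.1 (by omega : 0 < L.card)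
    refine le_trans (Finset.card_pos.2 ⟨par l, ?_⟩) (hΔ l)
    rw [mem_nbr]
    exact (R.adj_par l (by rintro rfl; exact hLρ hl)).symm
  obtain ⟨μ, hμ⟩ : ∃ μ, μ = Δ * m := ⟨_, rfl⟩
  rw [← hμ] at hdeg hn
  have hmμ : m ≤ μ := hμ ▸ Nat.le_mul_of_pos_left m hΔ1
  have q1 : m * m ≤ μ ^ 2 := by rw [sq]; exact Nat.mul_le_mul hmμ hmμ
  have q2 : μ * m ≤ μ ^ 2 := by rw [sq]; exact Nat.mul_le_mul_left _ hmμ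
  have q3 : μ ≤ μ ^ 2 := by rw [sq]; exact Nat.le_mul_self μ
  have q4 : m * (1 + Δ + Δ * Δ) ≤ 3 * μ ^ 2 := by
    have a1 : μ ^ 2 = m * (m * (Δ * Δ)) := by rw [hμ]; ring
    have a2 : Δ * Δ ≤ m * (Δ * Δ) := Nat.le_mul_of_pos_left _ hm
    have a3 : Δ ≤ Δ * Δ := Nat.le_mul_self Δ
    have a4 : m * (1 + Δ + Δ * Δ) ≤ m * (3 * (m * (Δ * Δ))) := Nat.mul_le_mul_left _ (by omega)
    have a5 : m * (3 * (m * (Δ * Δ))) = 3 * (m * (m * (Δ * Δ))) := by ring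
    omega
  have q5 : (1 + Δ + Δ * Δ) ≤ m * (1 + Δ + Δ * Δ) := Nat.le_mul_of_pos_left _ hm
  -- At most `m + μ ≤ 2 * μ` tokens are used in the end. Six times `μ` leaves room for the joins as
  -- well as for the `Δ * m` unoccupied neighbours needed in Hall's condition.
  obtain ⟨A, hAc, hA⟩ := hJ.exists_reserve (b := 6 * μ) (fun v => by have := hdeg v; omega) (by
    have : (6 * μ + 1) * m = 6 * (μ * m) + m := by ring
    omega)
  have hAc' : A.card ≤ 13 * μ ^ 2 := by
    have : (2 * (6 * μ) + 1) * m = 12 * (μ * m) + m := by ring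
    omega
  obtain ⟨P, hP⟩ : ∃ P : Palette V V, P = ⟨id, Finset.univ, A, Finset.subset_univ _,
    fun c _ _ c' _ h => h⟩ := ⟨_, rfl⟩
  have hlab : ∀ v, P.label v = v := fun v => by rw [hP]; rfl
  have hall : P.allowed = Finset.univ := by rw [hP]
  have htok : P.tokens = A := by rw [hP]
  have hhit : ∀ v, 6 * (Δ * m) ≤ (P.hits G v).card := fun v => by
    rw [← hμ, Palette.hits, htok, Finset.card_image_of_injective _ (fun a b h => by
      rwa [hlab, hlab] at h)]
    exact hA v
  obtain ⟨U, hU, hUc, hcov⟩ := R.exists_cover hJ hΔ hΔ1 hlab hall hhit m (by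
    have : (m + 1) * (1 + Δ + Δ * Δ) = m * (1 + Δ + Δ * Δ) + (1 + Δ + Δ * Δ) := by ring
    omega)
  -- Only leaves in `U` are held back: their parents are embedded in the first stage and do not move
  -- when the pieces are re-attached, so `Z` below keeps its meaning.
  obtain ⟨L₀, hL₀⟩ : ∃ L₀, L₀ = L ∩ U := ⟨_, rfl⟩
  have hL₀c : Fintype.card V ≤ 4000 * L₀.card := by
    have a1 := Finset.card_union_add_card_inter L U
    rw [← hL₀] at a1
    have a2 : (L ∪ U).card ≤ Fintype.card W := Finset.card_le_univ _
    omega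
  have hL₀U : L₀ ⊆ U := hL₀ ▸ Finset.inter_subset_right
  have hL₀ρ : ρ ∉ L₀ := fun h => hLρ (Finset.mem_inter.1 (hL₀ ▸ h)).1
  have hL₀c' : ∀ v, v ≠ ρ → par v ∉ L₀ := fun v hv h => hLc v hv (Finset.mem_inter.1 (hL₀ ▸ h)).1
  have hf : (Finset.univ \ L₀).card + (2 * m + 1) * m ≤ (P.allowed \ P.tokens).card := by
    rw [hall, htok]
    have a1 := Finset.card_sdiff_add_card_eq_card (Finset.subset_univ L₀)
    have a2 := Finset.card_sdiff_add_card_eq_card (Finset.subset_univ A)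
    rw [Finset.card_univ] at a1 a2
    have : (2 * m + 1) * m = 2 * (m * m) + m := by ring
    omega
  obtain ⟨v₀, hv₀⟩ : ∃ v₀, v₀ ∉ A := by
    by_contra hcon
    push Not at hcon
    have : A = Finset.univ := Finset.eq_univ_of_forall hcon
    have : A.card = Fintype.card V := by rw [this, Finset.card_univ]
    omega
  have hhit' : ∀ v, (∅ : Finset V).card + Δ * m < (P.hits G v).card := fun v => by
    have := hhit v
    rw [Finset.card_empty]
    omega
  have hUsub : U \ L₀ ⊆ Finset.univ \ L₀ :=
    Finset.sdiff_subset_sdiff (Finset.subset_univ _) (Finset.Subset.refl _)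
  obtain ⟨φ₁, -, E₁, I₁⟩ := Emb.extend (G := G) (P := P) (D := {ρ}) (φ := fun _ => v₀) R hJ hΔ
    (D' := U \ L₀) (t := 2 * m) (Z := ∅) (by omega)
    (by rw [Finset.singleton_subset_iff]; exact Finset.mem_sdiff.2 ⟨hU.1, hL₀ρ⟩)
    (fun v hv hv' => by
      have h' : v ≠ ρ := by simpa using hv'
      exact ⟨h', Finset.mem_sdiff.2 ⟨hU.2 v (Finset.mem_sdiff.1 hv).1 h', hL₀c' v h'⟩⟩)
    (fun c hc => Or.inl (by simpa using hc))
    (by have := Finset.card_le_card hUsub; omega) hhit'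
    ⟨by simp, by simp [hall], by simp⟩ (by
      intro w _ hw
      rw [htok] at hw
      exact absurd hw hv₀)
  -- the vertices adjacent to the images of the parents of few leaves
  have hfib : ∀ φ : W → V, (∀ u ∈ Finset.univ \ L₀, ∀ v ∈ Finset.univ \ L₀, φ u = φ v → u = v) →
      ∀ v, (L₀.filter fun l => φ (par l) = v).card ≤ Δ := by
    intro φ hφ v
    rcases (L₀.filter fun l => φ (par l) = v).eq_empty_or_nonempty with h | ⟨l, hl⟩
    · rw [h]; exact Nat.zero_le _
    · refine (Finset.card_le_card fun l' hl' => ?_).trans (R.card_children_le hΔ (par l))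
      rw [Finset.mem_filter] at hl hl' ⊢
      have n1 : l ≠ ρ := by rintro rfl; exact hL₀ρ hl.1
      have n2 : l' ≠ ρ := by rintro rfl; exact hL₀ρ hl'.1
      refine ⟨Finset.mem_univ _, n2, hφ _ ?_ _ ?_ (hl'.2.trans hl.2.symm)⟩
      · exact Finset.mem_sdiff.2 ⟨Finset.mem_univ _, hL₀c' _ n2⟩
      · exact Finset.mem_sdiff.2 ⟨Finset.mem_univ _, hL₀c' _ n1⟩
  have hparU : ∀ l ∈ L₀, par l ∈ U \ L₀ := fun l hl => by
    have n1 : l ≠ ρ := by rintro rfl; exact hL₀ρ hl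
    exact Finset.mem_sdiff.2 ⟨hU.2 l (hL₀U hl) n1, hL₀c' l n1⟩
  obtain ⟨Z, hZ⟩ : ∃ Z, Z = Finset.univ.filter fun r =>
      (L₀.filter fun l => G.Adj (φ₁ (par l)) r).card < m := ⟨_, rfl⟩
  have hZc : Z.card < m := by
    rw [hZ]
    refine hJ.card_few_lt (g := fun l => φ₁ (par l)) (Δ := Δ) (fun v => ?_) (by
      have : Δ * (2 * m) = 2 * μ := by rw [hμ]; ring
      omega)
    rcases (L₀.filter fun l => φ₁ (par l) = v).eq_empty_or_nonempty with h | ⟨l, hl⟩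
    · rw [h]; exact Nat.zero_le _
    · refine (Finset.card_le_card fun l' hl' => ?_).trans (R.card_children_le hΔ (par l))
      rw [Finset.mem_filter] at hl hl' ⊢
      have n2 : l' ≠ ρ := by rintro rfl; exact hL₀ρ hl'.1
      exact ⟨Finset.mem_univ _, n2, E₁.injOn _ (hparU l' hl'.1) _ (hparU l hl.1)
        (hl'.2.trans hl.2.symm)⟩
  obtain ⟨φ₂, e₂, E₂, I₂, c₂⟩ := hcov L₀ hL₀U hL₀ρ hL₀c' hf Z Z hZc.le (Finset.Subset.refl _)
    hZc.le φ₁ E₁ (fun w hw hwt => Or.inr ((I₁ w hw hwt).resolve_left (Finset.notMem_empty _)))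
  obtain ⟨D, hD⟩ : ∃ D, D = Finset.univ \ L₀ := ⟨_, rfl⟩
  have memD : ∀ v, v ∈ D ↔ v ∉ L₀ := fun v => by simp [hD]
  rw [← hD] at E₂ I₂ c₂ hf
  have hu := I₂.card_used_le E₂ hJ hΔ hf
  obtain ⟨Rm, hRm⟩ : ∃ Rm, Rm = Finset.univ \ D.image φ₂ := ⟨_, rfl⟩
  have memR : ∀ r, r ∈ Rm ↔ ∀ w ∈ D, φ₂ w ≠ r := fun r => by simp [hRm]
  have hparD : ∀ l ∈ L₀, par l ∈ D := fun l hl => hD ▸ hUsub (hparU l hl)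
  obtain ⟨f, hf1, hf2⟩ := hJ.exists_matching (L := L₀) (g := fun l => φ₂ (par l)) (R := Rm)
    (Δ := Δ) (by
      rw [hRm, Finset.card_sdiff_of_subset (Finset.subset_univ _), Finset.card_image_of_injOn
        (fun u hu v hv h => E₂.injOn u hu v hv h), hD,
        Finset.card_sdiff_of_subset (Finset.subset_univ _), Finset.card_univ, Finset.card_univ]
      have : L₀.card ≤ Fintype.card W := Finset.card_le_univ _
      omega)
    (fun l hl h => (memR _).1 h _ (hparD l hl) rfl)
    (fun v => by
      refine (Finset.card_le_card fun l hl => ?_).trans (hfib φ₂ (hD ▸ E₂.injOn) v)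
      exact hl)
    (fun l hl => by
      have a1 : nbr G (φ₂ (par l)) ∩ A ⊆ (nbr G (φ₂ (par l)) ∩ Rm) ∪ (P.used D φ₂).image φ₂ := by
        intro r hr
        rw [Finset.mem_inter] at hr
        rw [Finset.mem_union, Finset.mem_inter, memR, Finset.mem_image]
        by_cases h : ∀ w ∈ D, φ₂ w ≠ r
        · exact Or.inl ⟨hr.1, h⟩
        · push Not at h
          obtain ⟨w, hw, rfl⟩ := h
          exact Or.inr ⟨w, Palette.mem_used.2 ⟨hw, htok ▸ hr.2⟩, rfl⟩
      have a2 := Finset.card_le_card a1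
      have a3 := Finset.card_union_le (nbr G (φ₂ (par l)) ∩ Rm) ((P.used D φ₂).image φ₂)
      have a4 : ((P.used D φ₂).image φ₂).card ≤ (P.used D φ₂).card := Finset.card_image_le
      have a5 := hA (φ₂ (par l))
      omega)
    (fun r hr => by
      by_contra hlt
      push Not at hlt
      have hrZ : r ∈ Z := by
        rw [hZ, Finset.mem_filter]
        refine ⟨Finset.mem_univ _, lt_of_le_of_lt (Finset.card_le_card fun l hl => ?_) hlt⟩
        rw [Finset.mem_filter] at hl ⊢
        rw [e₂ _ (hparU l hl.1)]
        exact hl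
      obtain ⟨w, hw, hwr⟩ := c₂ r hrZ
      exact (memR r).1 hr w hw hwr)
  refine ⟨fun w => if w ∈ L₀ then f w else φ₂ w, fun u v h => ?_, ?_⟩
  · by_cases hu : u ∈ L₀ <;> by_cases hv : v ∈ L₀ <;> simp only [hu, hv, if_true, if_false] at h
    · exact hf2 u hu v hv h
    · exact absurd h.symm ((memR _).1 (hf1 u hu).1 v ((memD v).2 hv))
    · exact absurd h ((memR _).1 (hf1 v hv).1 u ((memD u).2 hu))
    · exact E₂.injOn u ((memD u).2 hu) v ((memD v).2 hv) h
  · have key : ∀ v, v ≠ ρ → G.Adj (if par v ∈ L₀ then f (par v) else φ₂ (par v))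
        (if v ∈ L₀ then f v else φ₂ v) := by
      intro v hv
      rw [if_neg (hL₀c' v hv)]
      by_cases hvL : v ∈ L₀
      · rw [if_pos hvL]
        exact (hf1 v hvL).2
      · rw [if_neg hvL]
        exact E₂.adj _ ((memD _).2 (hL₀c' v hv)) _ ((memD _).2 hvL) (R.adj_par v hv)
    intro u v huv
    rcases R.adj_cases u v huv with ⟨rfl, h⟩ | ⟨rfl, h⟩
    · exact key v h
    · exact (key u h).symm

end Leaves

/-! ### Bare paths in trees with few leaves -/

section Chains
open scoped Classical

variable {W : Type*} [Fintype W] {T : SimpleGraph W}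
  {ρ : W} {par : W → W} {dep : W → ℕ} {Δ : ℕ}

/-- The children of a vertex. -/
noncomputable def children (ρ : W) (par : W → W) (v : W) : Finset W :=
  Finset.univ.filter fun u => u ≠ ρ ∧ par u = v

lemma mem_children {u v : W} : u ∈ children ρ par v ↔ u ≠ ρ ∧ par u = v := by
  simp [children]

lemma card_children_mem (S : Finset W) :
    (Finset.univ.filter fun w => w ≠ ρ ∧ par w ∈ S).card = ∑ v ∈ S, (children ρ par v).card := by
  rw [Finset.card_eq_sum_card_fiberwise (f := par) (t := S) fun w hw => by
    simpa using (Finset.mem_filter.1 hw).2.2]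
  refine Finset.sum_congr rfl fun v hv => congrArg _ ?_
  ext w
  simp only [Finset.mem_filter, Finset.mem_univ, true_and, mem_children]
  constructor
  · rintro ⟨⟨h1, -⟩, h2⟩; exact ⟨h1, h2⟩
  · rintro ⟨h1, h2⟩; exact ⟨⟨h1, h2 ▸ hv⟩, h2⟩

/-- There are few vertices with siblings in a tree with few leaves. -/
lemma card_sibling_le :
    (Finset.univ.filter fun w => w ≠ ρ ∧ 2 ≤ (children ρ par (par w)).card).card + 2 ≤
      2 * (Finset.univ.filter fun v => (children ρ par v).card = 0).card := by
  have h1 := card_children_mem (ρ := ρ) (par := par) Finset.univ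
  have h2 := card_children_mem (ρ := ρ) (par := par)
    (Finset.univ.filter fun v => 2 ≤ (children ρ par v).card)
  have h3 : (Finset.univ.filter fun w => w ≠ ρ ∧ par w ∈ Finset.univ).card + 1 =
      Fintype.card W := by
    rw [← Finset.card_univ, ← Finset.card_erase_add_one (Finset.mem_univ ρ)]
    congr 2
    ext w; simp
  -- This local inequality is summed over all vertices; the numbers of children add up to
  -- `Fintype.card W - 1`.
  have h4 : ∀ v ∈ (Finset.univ : Finset W),
      (if 2 ≤ (children ρ par v).card then (children ρ par v).card else 0) + 2 ≤
      2 * (children ρ par v).card + 2 * if (children ρ par v).card = 0 then 1 else 0 := by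
    intro v _
    split_ifs <;> omega
  have h5 := Finset.sum_le_sum h4
  rw [Finset.sum_add_distrib, Finset.sum_add_distrib, ← Finset.sum_filter, ← h2,
    ← Finset.mul_sum, ← h1, ← Finset.mul_sum, ← Finset.card_filter] at h5
  simp only [Finset.sum_const, Finset.card_univ, smul_eq_mul, Finset.mem_filter, Finset.mem_univ,
    true_and] at h5 h3
  omega

/-- The vertices `w` of `E` are ends of vertex-disjoint paths
`w, par w, …, par^[5] w` whose vertices other than `w` have a single child. -/
structure IsChainFamily (ρ : W) (par : W → W) (E : Finset W) : Prop where
  ne : ∀ w ∈ E, ∀ i ≤ 5, par^[i] w ≠ ρ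
  child : ∀ w ∈ E, ∀ i < 5, ∀ u, u ≠ ρ → par u = par^[i + 1] w → u = par^[i] w
  disj : ∀ w ∈ E, ∀ w' ∈ E, ∀ i ≤ 5, ∀ j ≤ 5, par^[i] w = par^[j] w' → w = w' ∧ i = j

lemma ParClosed.iterate_mem {U : Finset W} (hU : ParClosed ρ par U)
    (R : Rooted T ρ par dep) {w : W} (hw : w ∈ U) (i : ℕ) : par^[i] w ∈ U := by
  induction i with
  | zero => exact hw
  | succ i ih =>
    rw [Function.iterate_succ_apply']
    by_cases h : par^[i] w = ρ
    · rw [h, R.par_root]; exact hU.1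
    · exact hU.2 _ ih h

lemma Rooted.exists_parClosed (R : Rooted T ρ par dep) (k : ℕ) (hk : k + 1 ≤ Fintype.card W) :
    ∃ U, ParClosed ρ par U ∧ U.card = k + 1 := by
  induction k with
  | zero =>
    exact ⟨{ρ}, ⟨Finset.mem_singleton_self _, fun v hv h => absurd (Finset.mem_singleton.1 hv) h⟩,
      by simp⟩
  | succ k ih =>
    obtain ⟨U, hU, hUc⟩ := ih (by omega)
    have hne : (Finset.univ \ U).Nonempty := by
      rw [← Finset.card_pos, Finset.card_sdiff_of_subset (Finset.subset_univ _),
        Finset.card_univ]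
      omega
    obtain ⟨v, hv, hmin⟩ := Finset.exists_min_image _ dep hne
    have hvU : v ∉ U := (Finset.mem_sdiff.1 hv).2
    have hvρ : v ≠ ρ := by rintro rfl; exact hvU hU.1
    have hpar : par v ∈ U := by
      by_contra h
      have := hmin _ (Finset.mem_sdiff.2 ⟨Finset.mem_univ _, h⟩)
      have := R.dep_par v hvρ
      omega
    refine ⟨insert v U, ⟨Finset.mem_insert_of_mem hU.1, fun u hu huρ => ?_⟩, ?_⟩
    · rcases Finset.mem_insert.1 hu with rfl | hu
      · exact Finset.mem_insert_of_mem hpar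
      · exact Finset.mem_insert_of_mem (hU.2 u hu huρ)
    · rw [Finset.card_insert_of_notMem hvU, hUc]

/-- The vertices within distance five below the root or below a vertex without exactly one child. -/
lemma Rooted.exists_near (R : Rooted T ρ par dep) (hΔ : ∀ w, (nbr T w).card ≤ Δ) (k : ℕ) :
    ∃ S : Finset W, (∀ w, w ∉ S → ∀ i < k, par^[i + 1] w ≠ ρ ∧
      (children ρ par (par^[i + 1] w)).card = 1) ∧ S.card ≤
    k * (Δ + 1 + 2 * (Finset.univ.filter fun v => (children ρ par v).card = 0).card) := by
  obtain ⟨B, hB⟩ : ∃ B : W → Prop, B = fun v => v = ρ ∨ (children ρ par v).card ≠ 1 := ⟨_, rfl⟩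
  have hBρ : B ρ := by rw [hB]; exact Or.inl rfl
  suffices h : ∀ k, (Finset.univ.filter fun w => ∃ i < k, B (par^[i + 1] w)).card ≤
      k * (Δ + 1 + 2 * (Finset.univ.filter fun v => (children ρ par v).card = 0).card) by
    refine ⟨_, fun w hw i hi => ?_, h k⟩
    have h1 : ¬ B (par^[i + 1] w) := fun h =>
      hw (Finset.mem_filter.2 ⟨Finset.mem_univ _, i, hi, h⟩)
    rw [hB] at h1
    push Not at h1
    exact h1
  clear k
  have hone : (Finset.univ.filter fun w => B (par w)).card ≤
      Δ + 1 + 2 * (Finset.univ.filter fun v => (children ρ par v).card = 0).card := by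
    have hsub : (Finset.univ.filter fun w => B (par w)) ⊆ {ρ} ∪ children ρ par ρ ∪
        (Finset.univ.filter fun w => w ≠ ρ ∧ 2 ≤ (children ρ par (par w)).card) := by
      intro w hw
      rw [Finset.mem_filter, hB] at hw
      simp only [Finset.mem_union, Finset.mem_singleton, mem_children, Finset.mem_filter,
        Finset.mem_univ, true_and]
      by_cases hwρ : w = ρ
      · exact Or.inl (Or.inl hwρ)
      · rcases hw.2 with h | h
        · exact Or.inl (Or.inr ⟨hwρ, h⟩)
        · refine Or.inr ⟨hwρ, ?_⟩
          have : 0 < (children ρ par (par w)).card :=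
            Finset.card_pos.2 ⟨w, mem_children.2 ⟨hwρ, rfl⟩⟩
          omega
    have h1 := Finset.card_le_card hsub
    have h2 := Finset.card_union_le ({ρ} ∪ children ρ par ρ)
      (Finset.univ.filter fun w => w ≠ ρ ∧ 2 ≤ (children ρ par (par w)).card)
    have h3 := Finset.card_union_le {ρ} (children ρ par ρ)
    rw [Finset.card_singleton] at h3
    have h4 : (children ρ par ρ).card ≤ Δ := R.card_children_le hΔ ρ
    have h5 := card_sibling_le (ρ := ρ) (par := par)
    omega
  intro k
  induction k with
  | zero => simp
  | succ k ih =>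
    have hsub : (Finset.univ.filter fun w => ∃ i < k + 1, B (par^[i + 1] w)) ⊆
        (Finset.univ.filter fun w => B (par w)) ∪
        (Finset.univ.filter fun w => ¬ B (par w) ∧ ∃ i < k, B (par^[i + 1] (par w))) := by
      intro w hw
      simp only [Finset.mem_filter, Finset.mem_univ, true_and, Finset.mem_union] at hw ⊢
      by_cases h : B (par w)
      · exact Or.inl h
      · obtain ⟨i, hi, hBi⟩ := hw
        cases i with
        | zero => exact absurd hBi h
        | succ i => exact Or.inr ⟨h, i, by omega, by simpa [Function.iterate_succ_apply] using hBi⟩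
    have h1 := Finset.card_le_card hsub
    have h2 := Finset.card_union_le (Finset.univ.filter fun w => B (par w))
      (Finset.univ.filter fun w => ¬ B (par w) ∧ ∃ i < k, B (par^[i + 1] (par w)))
    -- Where the parent is not bad it has a single child, so `par` is injective there and the count
    -- reduces to the previous `k`.
    have h3 : (Finset.univ.filter fun w => ¬ B (par w) ∧ ∃ i < k, B (par^[i + 1] (par w))).card ≤
        (Finset.univ.filter fun w => ∃ i < k, B (par^[i + 1] w)).card := by
      refine Finset.card_le_card_of_injOn par (fun w hw => ?_) fun w hw w' hw' h => ?_
      · have := (Finset.mem_filter.1 hw).2.2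
        exact Finset.mem_filter.2 ⟨Finset.mem_univ _, this⟩
      · have a1 := (Finset.mem_filter.1 hw).2.1
        have a2 := (Finset.mem_filter.1 hw').2.1
        have hne : ∀ w, ¬ B (par w) → w ≠ ρ := by
          rintro w hw rfl
          rw [R.par_root] at hw
          exact hw hBρ
        have a3 : (children ρ par (par w)).card = 1 := by
          by_contra hc
          exact a1 (by rw [hB]; exact Or.inr hc)
        exact Finset.card_le_one.1 a3.le w (mem_children.2 ⟨hne w a1, rfl⟩) w'
          (mem_children.2 ⟨hne w' a2, h.symm⟩)
    have h4 : (k + 1) * (Δ + 1 +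
        2 * (Finset.univ.filter fun v => (children ρ par v).card = 0).card) =
        k * (Δ + 1 + 2 * (Finset.univ.filter fun v => (children ρ par v).card = 0).card) +
        (Δ + 1 + 2 * (Finset.univ.filter fun v => (children ρ par v).card = 0).card) := by ring
    omega

/-- A tree with few leaves has many disjoint paths with internal vertices of degree two, in a
parent-closed set that leaves out half of the tree. -/
lemma Rooted.exists_chains (R : Rooted T ρ par dep) (hΔ : ∀ w, (nbr T w).card ≤ Δ)
    (hL : 2000 * (Finset.univ.filter fun v => v ≠ ρ ∧ ∀ u, u ≠ ρ → par u ≠ v).card <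
      Fintype.card W) (hn : 1000 * (Δ + 1) ≤ Fintype.card W) :
    ∃ U E, ParClosed ρ par U ∧ 2 * U.card ≤ Fintype.card W ∧ E ⊆ U ∧
      Fintype.card W ≤ 20 * E.card ∧ IsChainFamily ρ par E := by
  obtain ⟨U, hU, hUc⟩ := R.exists_parClosed (Fintype.card W / 2 - 1) (by omega)
  have h0 : (Finset.univ.filter fun v => (children ρ par v).card = 0).card ≤
      (Finset.univ.filter fun v => v ≠ ρ ∧ ∀ u, u ≠ ρ → par u ≠ v).card + 1 := by
    refine (Finset.card_le_card (t := insert ρ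
      (Finset.univ.filter fun v => v ≠ ρ ∧ ∀ u, u ≠ ρ → par u ≠ v)) fun v hv => ?_).trans
      (Finset.card_insert_le _ _)
    rw [Finset.mem_filter, Finset.card_eq_zero, Finset.eq_empty_iff_forall_notMem] at hv
    rw [Finset.mem_insert, Finset.mem_filter]
    by_cases h : v = ρ
    · exact Or.inl h
    · exact Or.inr ⟨Finset.mem_univ _, h, fun u hu hv' => hv.2 u (mem_children.2 ⟨hu, hv'⟩)⟩
  obtain ⟨Bd, hBd, hbad⟩ := R.exists_near hΔ 5
  have hgood := Finset.le_card_sdiff Bd U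
  -- Keeping one residue of the depth modulo `6` forces a common vertex of two paths to be at the
  -- same height on both; single children then identify the lower ends.
  obtain ⟨r, -, hr⟩ := Finset.exists_le_card_fiber_of_mul_le_card_of_maps_to
    (s := U \ Bd) (t := Finset.range 6) (f := fun w => dep w % 6) (n := (U \ Bd).card / 6)
    (fun w _ => Finset.mem_range.2 (Nat.mod_lt _ (by norm_num))) ⟨0, by simp⟩ (by
      rw [Finset.card_range]; exact Nat.mul_div_le _ _)
  refine ⟨U, (U \ Bd).filter fun w => dep w % 6 = r, hU, by omega, (Finset.filter_subset _ _).trans Finset.sdiff_subset, ?_, ?_⟩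
  · exact (by omega : Fintype.card W ≤ 20 * ((U \ Bd).card / 6)).trans
      (Nat.mul_le_mul_left _ hr)
  · have hB : ∀ w ∈ (U \ Bd).filter (fun w => dep w % 6 = r), ∀ i < 5, par^[i + 1] w ≠ ρ ∧
        (children ρ par (par^[i + 1] w)).card = 1 := by
      intro w hw i hi
      rw [Finset.mem_filter, Finset.mem_sdiff] at hw
      exact hBd w hw.1.2 i hi
    have hne : ∀ w ∈ (U \ Bd).filter (fun w => dep w % 6 = r), ∀ i ≤ 5, par^[i] w ≠ ρ := by
      intro w hw i hi
      cases i with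
      | zero =>
        rintro (rfl : w = _)
        exact (hB w hw 0 (by norm_num)).1 R.par_root
      | succ i => exact (hB w hw i (by omega)).1
    have hdep : ∀ w ∈ (U \ Bd).filter (fun w => dep w % 6 = r), ∀ i ≤ 5,
        dep (par^[i] w) + i = dep w := by
      intro w hw i hi
      induction i with
      | zero => rfl
      | succ i ih =>
        have h1 := ih (by omega)
        have h2 := R.dep_par _ (hne w hw i (by omega))
        rw [Function.iterate_succ_apply']
        omega
    have hch : ∀ w ∈ (U \ Bd).filter (fun w => dep w % 6 = r), ∀ i < 5, ∀ u, u ≠ ρ →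
        par u = par^[i + 1] w → u = par^[i] w := by
      intro w hw i hi u hu hpu
      refine Finset.card_le_one.1 (hB w hw i hi).2.le u (mem_children.2 ⟨hu, hpu⟩) _
        (mem_children.2 ⟨hne w hw i (by omega), ?_⟩)
      rw [← Function.iterate_succ_apply' par]
    refine ⟨hne, hch, fun w hw w' hw' i hi j hj h => ?_⟩
    have e1 := hdep w hw i hi
    have e2 := hdep w' hw' j hj
    rw [h] at e1
    have e3 := (Finset.mem_filter.1 hw).2
    have e4 := (Finset.mem_filter.1 hw').2
    have hij : i = j := by omega
    subst hij
    refine ⟨?_, rfl⟩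
    clear e1 e2 e3 e4 hj
    induction i with
    | zero => exact h
    | succ i ih =>
      refine ih (by omega) (hch w' hw' i (by omega) _ (hne w hw i (by omega)) ?_)
      rw [← Function.iterate_succ_apply' par]; exact h

end Chains

/-! ### Embedding the tree up to inner vertices of bare paths -/

section Paths
open scoped Classical

variable {V W L : Type*} [Fintype V] [Fintype W] {G : SimpleGraph V} {T : SimpleGraph W}
  {P : Palette V L} {ρ : W} {par : W → W} {dep : W → ℕ} {m Δ : ℕ}

/-- Placing an independent set of tree vertices at prescribed positions. -/
lemma Emb.prefill {D : Finset W} {φ : W → V} (E : Emb G T P D φ) {ι : Type*} (K : Finset ι)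
    (a : ι → W) (c : ι → V)
    (ha : ∀ i ∈ K, a i ∉ D) (hinj : ∀ i ∈ K, ∀ j ∈ K, a i = a j → i = j)
    (hc : ∀ i ∈ K, c i ∈ P.allowed)
    (hcl : ∀ i ∈ K, ∀ j ∈ K, P.label (c i) = P.label (c j) → i = j)
    (hl : ∀ i ∈ K, ∀ w ∈ D, P.label (φ w) ≠ P.label (c i))
    (hadj : ∀ i ∈ K, ∀ b ∈ D, T.Adj b (a i) → G.Adj (φ b) (c i))
    (hind : ∀ i ∈ K, ∀ j ∈ K, ¬ T.Adj (a i) (a j)) :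
    ∃ φ' : W → V, (∀ w ∈ D, φ' w = φ w) ∧ (∀ i ∈ K, φ' (a i) = c i) ∧
      Emb G T P (D ∪ K.image a) φ' := by
  induction K using Finset.induction_on with
  | empty => exact ⟨φ, fun _ _ => rfl, by simp, by simpa using E⟩
  | insert i K hi ih =>
    have hK : ∀ j ∈ K, j ∈ insert i K := fun j hj => Finset.mem_insert_of_mem hj
    have hi' := Finset.mem_insert_self i K
    obtain ⟨φ₁, e₁, c₁, E₁⟩ := ih (fun j hj => ha j (hK j hj))
      (fun j hj k hk => hinj j (hK j hj) k (hK k hk)) (fun j hj => hc j (hK j hj))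
      (fun j hj k hk => hcl j (hK j hj) k (hK k hk)) (fun j hj => hl j (hK j hj))
      (fun j hj => hadj j (hK j hj)) (fun j hj k hk => hind j (hK j hj) k (hK k hk))
    have hai : a i ∉ D ∪ K.image a := by
      rw [Finset.mem_union, Finset.mem_image, not_or]
      refine ⟨ha i hi', ?_⟩
      rintro ⟨j, hj, h⟩
      obtain rfl := hinj j (hK j hj) i hi' h
      exact hi hj
    have E₂ := E₁.addVertex (v := a i) (c := c i) hai (hc i hi') (fun w hw h => by
      rcases Finset.mem_union.1 hw with hw | hw
      · rw [e₁ w hw] at h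
        exact hl i hi' w hw h
      · obtain ⟨j, hj, rfl⟩ := Finset.mem_image.1 hw
        rw [c₁ j hj] at h
        obtain rfl := hcl j (hK j hj) i hi' h
        exact hi hj) (fun b hb hba => by
      rcases Finset.mem_union.1 hb with hb | hb
      · rw [e₁ b hb]
        exact hadj i hi' b hb hba
      · obtain ⟨j, hj, rfl⟩ := Finset.mem_image.1 hb
        exact absurd hba (hind j (hK j hj) i hi'))
    have e₂ : ∀ w ∈ D ∪ K.image a, Function.update φ₁ (a i) (c i) w = φ₁ w := fun w hw =>
      Function.update_of_ne (by rintro rfl; exact hai hw) _ _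
    refine ⟨_, fun w hw => (e₂ w (Finset.mem_union_left _ hw)).trans (e₁ w hw), fun j hj => ?_, ?_⟩
    · rcases Finset.mem_insert.1 hj with rfl | hj
      · exact Function.update_self _ _ _
      · rw [e₂ _ (Finset.mem_union_right _ (Finset.mem_image_of_mem _ hj)), c₁ j hj]
    · rw [Finset.image_insert, Finset.union_insert]
      exact E₂

/-- The exact balance matters: when no free vertex remains it determines how many tokens are in use.
-/
lemma Emb.card_free {D : Finset W} {φ : W → V} (E : Emb G T P D φ) :
    (P.free D φ).card + D.card = (P.allowed \ P.tokens).card + (P.used D φ).card := by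
  have h1 : P.free D φ = (P.allowed \ P.tokens) \ (D \ P.used D φ).image φ := by
    ext c
    simp only [Palette.mem_free, Finset.mem_sdiff, Finset.mem_image, Palette.mem_used, not_exists,
      not_and, and_assoc]
    refine and_congr_right fun _ => and_congr_right fun hct => forall_congr' fun w => ?_
    constructor
    · exact fun h hw _ => h hw
    · rintro h hw rfl
      exact h hw (fun _ => hct) rfl
  have h2 : (D \ P.used D φ).image φ ⊆ P.allowed \ P.tokens := by
    intro c hc
    obtain ⟨w, hw, rfl⟩ := Finset.mem_image.1 hc
    rw [Finset.mem_sdiff, Palette.mem_used] at hw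
    exact Finset.mem_sdiff.2 ⟨E.mem w hw.1, fun h => hw.2 ⟨hw.1, h⟩⟩
  have h3 : ((D \ P.used D φ).image φ).card = (D \ P.used D φ).card :=
    Finset.card_image_of_injOn fun u hu v hv h =>
      E.injOn u (Finset.mem_sdiff.1 hu).1 v (Finset.mem_sdiff.1 hv).1 h
  have h4 : P.used D φ ⊆ D := Finset.filter_subset _ _
  have h5 := Finset.card_sdiff_add_card_eq_card h4
  have h6 := Finset.card_sdiff_add_card_eq_card h2
  rw [h1]
  omega

/-- The vertices at the heights in `J` on the paths ending in `K`. -/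
noncomputable def pieces (par : W → W) (K : Finset W) (J : Finset ℕ) : Finset W :=
  (K ×ˢ J).image fun p => par^[p.2] p.1

variable {E K : Finset W} {J : Finset ℕ} {w w' : W} {i j : ℕ}

lemma mem_pieces {v : W} : v ∈ pieces par K J ↔ ∃ w ∈ K, ∃ i ∈ J, par^[i] w = v := by
  simp only [pieces, Finset.mem_image, Finset.mem_product, Prod.exists]
  constructor
  · rintro ⟨a, b, ⟨h1, h2⟩, h3⟩; exact ⟨a, h1, b, h2, h3⟩
  · rintro ⟨a, h1, b, h2, h3⟩; exact ⟨a, b, ⟨h1, h2⟩, h3⟩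

lemma IsChainFamily.iterate_mem_pieces (hE : IsChainFamily ρ par E) (hK : K ⊆ E)
    (hJ : ∀ j ∈ J, j ≤ 5) (hw : w ∈ E) (hi : i ≤ 5) :
    par^[i] w ∈ pieces par K J ↔ w ∈ K ∧ i ∈ J := by
  rw [mem_pieces]
  constructor
  · rintro ⟨w', hw', j, hj, h⟩
    obtain ⟨rfl, rfl⟩ := hE.disj w' (hK hw') w hw j (hJ j hj) i hi h
    exact ⟨hw', hj⟩
  · exact fun h => ⟨w, h.1, i, h.2, rfl⟩

lemma IsChainFamily.card_pieces (hE : IsChainFamily ρ par E) (hK : K ⊆ E)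
    (hJ : ∀ j ∈ J, j ≤ 5) : (pieces par K J).card = K.card * J.card := by
  rw [pieces, Finset.card_image_of_injOn, Finset.card_product]
  rintro ⟨a, i⟩ h ⟨b, j⟩ h' hab
  simp only [Finset.coe_product, Set.mem_prod, Finset.mem_coe] at h h'
  obtain ⟨rfl, rfl⟩ := hE.disj a (hK h.1) b (hK h'.1) i (hJ i h.2) j (hJ j h'.2) hab
  rfl

/-- The vertex above a path may lie on another path only as its lower end: at a height `k + 1 ≤ 5`
its only child would be at height `k < 5` there, yet is at height `5` on the first path. -/
lemma IsChainFamily.top_notMem (hE : IsChainFamily ρ par E) (hK : K ⊆ E)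
    (hJ : ∀ j ∈ J, 1 ≤ j ∧ j ≤ 5) (hw : w ∈ E) : par^[6] w ∉ pieces par K J := by
  rw [mem_pieces]
  rintro ⟨w', hw', j, hj, h⟩
  obtain ⟨h1, h2⟩ := hJ j hj
  obtain ⟨k, rfl⟩ : ∃ k, j = k + 1 := ⟨j - 1, by omega⟩
  have := hE.child w' (hK hw') k (by omega) (par^[5] w) (hE.ne w hw 5 le_rfl) (by
    rw [h, ← Function.iterate_succ_apply' par])
  have := (hE.disj w hw w' (hK hw') 5 le_rfl k (by omega) this).2
  omega

lemma IsChainFamily.adj_par (hE : IsChainFamily ρ par E) (R : Rooted T ρ par dep) (hw : w ∈ E)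
    (hi : i ≤ 5) : T.Adj (par^[i + 1] w) (par^[i] w) := by
  rw [Function.iterate_succ_apply']
  exact R.adj_par _ (hE.ne w hw i hi)

lemma IsChainFamily.adj_cases (hE : IsChainFamily ρ par E) (R : Rooted T ρ par dep) (hw : w ∈ E)
    (hi : i < 5) {c : W} (hc : T.Adj c (par^[i + 1] w)) :
    c = par^[i + 2] w ∨ c = par^[i] w := by
  rcases R.adj_cases _ _ hc with h | h
  · left
    rw [h.1, ← Function.iterate_succ_apply' par]
  · right
    exact hE.child w hw i hi c h.2 h.1.symm

variable {U KS KF : Finset W}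

/-- Embedding all of the tree except for the inner vertices of the paths ending in `KF` and one
vertex from each of the paths ending in `KS`, whose neighbours are placed as prescribed. -/
lemma IsChainFamily.exists_spread (hE : IsChainFamily ρ par E) (R : Rooted T ρ par dep)
    (hJ : Joined G m) (hΔ : ∀ w, (nbr T w).card ≤ Δ) (hΔ1 : 1 ≤ Δ) (hU : ParClosed ρ par U)
    (hEU : E ⊆ U) (hKS : KS ⊆ E) (hKF : KF ⊆ E) (hSF : Disjoint KS KF) (s₁ s₂ : W → V)
    (h₁ : ∀ w ∈ KS, s₁ w ∈ P.allowed \ P.tokens) (h₂ : ∀ w ∈ KS, s₂ w ∈ P.allowed \ P.tokens)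
    (i₁ : ∀ w ∈ KS, ∀ w' ∈ KS, s₁ w = s₁ w' → w = w')
    (i₂ : ∀ w ∈ KS, ∀ w' ∈ KS, s₂ w = s₂ w' → w = w')
    (i₃ : ∀ w ∈ KS, ∀ w' ∈ KS, s₁ w ≠ s₂ w') (hH : ∀ v, 4 * (Δ * m) ≤ (P.hits G v).card)
    (hUf : U.card + 2 * KS.card + (2 * m + 1) * m ≤ (P.allowed \ P.tokens).card)
    (hWf : Fintype.card W + 2 * m ≤ (P.allowed \ P.tokens).card + KS.card + 5 * KF.card)
    (hXf : 2 * KS.card + KF.card + 1 ≤ (P.allowed \ P.tokens).card) :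
    ∃ φ : W → V, Emb G T P (Finset.univ \ (pieces par KS {2} ∪ pieces par KF {1, 2, 3, 4, 5})) φ ∧
      (∀ w ∈ KS, φ (par^[3] w) = s₁ w ∧ φ (par^[1] w) = s₂ w) ∧
      (P.used (Finset.univ \ (pieces par KS {2} ∪ pieces par KF {1, 2, 3, 4, 5})) φ).card ≤
        2 * (Δ * m) := by
  have hm := hJ.pos
  have hμ : m ≤ Δ * m := Nat.le_mul_of_pos_left m hΔ1
  have hnSF : ∀ w ∈ KS, w ∉ KF := fun w hw hw' => Finset.disjoint_left.1 hSF hw hw'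
  -- `M` is postponed. On a path of `KS`, heights `3` and `1` are prescribed, heights `5` and `4`
  -- later join height `6` to height `3`, and height `2` is held back for the absorber.
  obtain ⟨M, hM⟩ : ∃ M, M = pieces par KS {2, 4, 5} ∪ pieces par KF {1, 2, 3, 4, 5} := ⟨_, rfl⟩
  have b3 : ∀ j ∈ ({2, 4, 5} : Finset ℕ), 1 ≤ j ∧ j ≤ 5 := by decide
  have b5 : ∀ j ∈ ({1, 2, 3, 4, 5} : Finset ℕ), 1 ≤ j ∧ j ≤ 5 := by decide
  have iterM : ∀ w ∈ E, ∀ i ≤ 5, par^[i] w ∈ M ↔ (w ∈ KS ∧ i ∈ ({2, 4, 5} : Finset ℕ)) ∨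
      (w ∈ KF ∧ i ∈ ({1, 2, 3, 4, 5} : Finset ℕ)) := fun w hw i hi => by
    rw [hM, Finset.mem_union, hE.iterate_mem_pieces hKS (fun j hj => (b3 j hj).2) hw hi,
      hE.iterate_mem_pieces hKF (fun j hj => (b5 j hj).2) hw hi]
  have memM : ∀ v ∈ M, ∃ w ∈ E, ∃ i, 1 ≤ i ∧ i ≤ 5 ∧ par^[i] w = v := by
    intro v hv
    rw [hM, Finset.mem_union, mem_pieces, mem_pieces] at hv
    rcases hv with ⟨w, hw, i, hi, h⟩ | ⟨w, hw, i, hi, h⟩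
    · exact ⟨w, hKS hw, i, (b3 i hi).1, (b3 i hi).2, h⟩
    · exact ⟨w, hKF hw, i, (b5 i hi).1, (b5 i hi).2, h⟩
  have hρM : ρ ∉ M := fun h => by
    obtain ⟨w, hw, i, -, hi, h⟩ := memM ρ h
    exact hE.ne w hw i hi h
  have htopM : ∀ w ∈ E, par^[6] w ∉ M := fun w hw h => by
    rw [hM, Finset.mem_union] at h
    rcases h with h | h
    · exact hE.top_notMem hKS b3 hw h
    · exact hE.top_notMem hKF b5 hw h
  -- the vertices that are placed first
  obtain ⟨D₀, hD₀⟩ : ∃ D₀ : Finset W, D₀ = (∅ ∪ (insert ρ KF).image id ∪ KS.image par^[3]) ∪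
    KS.image par^[1] := ⟨_, rfl⟩
  have memD₀ : ∀ v, v ∈ D₀ ↔ v = ρ ∨ v ∈ KF ∨ (∃ w ∈ KS, par^[3] w = v) ∨
      ∃ w ∈ KS, par^[1] w = v := fun v => by
    simp only [hD₀, Finset.mem_union, Finset.mem_image, Finset.notMem_empty, false_or,
      Finset.mem_insert, id, exists_eq_right, or_assoc]
  have hD₀M : ∀ v ∈ D₀, v ∉ M := by
    intro v hv
    rcases (memD₀ v).1 hv with rfl | h | ⟨w, hw, rfl⟩ | ⟨w, hw, rfl⟩
    · exact hρM
    · intro h'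
      have := (iterM v (hKF h) 0 (by norm_num)).1 h'
      simp at this
    · intro h'
      have := (iterM w (hKS hw) 3 (by norm_num)).1 h'
      simp [hnSF w hw] at this
    · intro h'
      have := (iterM w (hKS hw) 1 (by norm_num)).1 h'
      simp [hnSF w hw] at this
  have hM1 : ∀ v, v ≠ ρ → par v ∈ M → v ∈ M ∨ v ∈ D₀ := by
    intro v hv hpv
    obtain ⟨w, hw, i, hi1, hi5, h⟩ := memM _ hpv
    obtain ⟨k, rfl⟩ : ∃ k, i = k + 1 := ⟨i - 1, by omega⟩
    have hvk := hE.child w hw k (by omega) v hv h.symm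
    rw [← h, iterM w hw _ hi5] at hpv
    rw [hvk, iterM w hw k (by omega), memD₀]
    rcases hpv with ⟨hS, hk⟩ | ⟨hF, hk⟩
    · have : k = 1 ∨ k = 3 ∨ k = 4 := by simp at hk; omega
      rcases this with rfl | rfl | rfl
      · exact Or.inr (Or.inr (Or.inr (Or.inr ⟨w, hS, rfl⟩)))
      · exact Or.inr (Or.inr (Or.inr (Or.inl ⟨w, hS, rfl⟩)))
      · exact Or.inl (Or.inl ⟨hS, by simp⟩)
    · by_cases hk0 : k = 0
      · subst hk0
        exact Or.inr (Or.inr (Or.inl hF))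
      · exact Or.inl (Or.inr ⟨hF, by simp at hk ⊢; omega⟩)
  have hM2 : ∀ v ∈ D₀, v = ρ ∨ par v ∈ M := by
    intro v hv
    rcases (memD₀ v).1 hv with rfl | h | ⟨w, hw, rfl⟩ | ⟨w, hw, rfl⟩
    · exact Or.inl rfl
    · exact Or.inr ((iterM v (hKF h) 1 (by norm_num)).2 (Or.inr ⟨h, by simp⟩))
    · right
      rw [← Function.iterate_succ_apply' par]
      exact (iterM w (hKS hw) 4 (by norm_num)).2 (Or.inl ⟨hw, by simp⟩)
    · right
      rw [← Function.iterate_succ_apply' par]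
      exact (iterM w (hKS hw) 2 (by norm_num)).2 (Or.inl ⟨hw, by simp⟩)
  -- Parents of the vertices placed first are postponed, apart from the root, so these vertices are
  -- independent and may be placed anywhere.
  have hind : ∀ u ∈ D₀, ∀ v ∈ D₀, ¬ T.Adj u v := by
    intro u hu v hv huv
    rcases R.adj_cases u v huv with h | h
    · exact hD₀M u hu (h.1 ▸ (hM2 v hv).resolve_left h.2)
    · exact hD₀M v hv (h.1 ▸ (hM2 u hu).resolve_left h.2)
  have hρE : ρ ∉ E := fun h => hE.ne ρ h 0 (by norm_num) rfl
  -- the first stage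
  obtain ⟨X, hX, hXc⟩ := Finset.exists_subset_card_eq
    (s := ((P.allowed \ P.tokens) \ (KS.image s₁ ∪ KS.image s₂))) (n := (insert ρ KF).card) (by
      have a1 := Finset.le_card_sdiff (KS.image s₁ ∪ KS.image s₂) (P.allowed \ P.tokens)
      have a2 := Finset.card_union_le (KS.image s₁) (KS.image s₂)
      have a3 : (KS.image s₁).card ≤ KS.card := Finset.card_image_le
      have a4 : (KS.image s₂).card ≤ KS.card := Finset.card_image_le
      have a5 := Finset.card_insert_le ρ KF
      omega)
  have hVne : Nonempty V := by
    obtain ⟨v, -⟩ := Finset.card_pos.1 (by omega : 0 < (P.allowed \ P.tokens).card)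
    exact ⟨v⟩
  obtain ⟨β, hβ⟩ := exists_bijOn_of_card_eq hXc.symm
  have hβX : ∀ w ∈ insert ρ KF, β w ∈ P.allowed \ P.tokens ∧ (∀ u ∈ KS, s₁ u ≠ β w) ∧
      ∀ u ∈ KS, s₂ u ≠ β w := by
    intro w hw
    have := hX (hβ.mapsTo hw)
    simp only [Finset.mem_sdiff, Finset.mem_union, Finset.mem_image, not_or, not_exists,
      not_and] at this
    exact ⟨Finset.mem_sdiff.2 this.1, this.2.1, this.2.2⟩
  have hlab : ∀ c ∈ P.allowed \ P.tokens, ∀ c' ∈ P.allowed \ P.tokens,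
      P.label c = P.label c' → c = c' := by
    intro c hc c' hc' h
    rw [Finset.mem_sdiff] at hc hc'
    exact P.label_inj c hc.1 hc.2 c' hc'.1 h
  have hDsub1 : ∅ ∪ (insert ρ KF).image id ⊆ D₀ := hD₀ ▸
    Finset.subset_union_left.trans Finset.subset_union_left
  have hDsub2 : ∅ ∪ (insert ρ KF).image id ∪ KS.image par^[3] ⊆ D₀ := hD₀ ▸
    Finset.subset_union_left
  obtain ⟨φ₁, -, c₁, E₁⟩ := Emb.prefill (G := G) (T := T) (P := P) (D := ∅) (φ := β)
    ⟨by simp, by simp, by simp⟩ (insert ρ KF) id β (by simp) (fun _ _ _ _ h => h)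
    (fun w hw => (Finset.mem_sdiff.1 (hβX w hw).1).1)
    (fun u hu v hv h => hβ.injOn hu hv (hlab _ (hβX u hu).1 _ (hβX v hv).1 h)) (by simp) (by simp)
    (fun u hu v hv => hind u (hDsub1 (by simpa using hu)) v (hDsub1 (by simpa using hv)))
  have v₁ : ∀ w ∈ ∅ ∪ (insert ρ KF).image id, φ₁ w = β w ∧ w ∈ insert ρ KF := by
    intro w hw
    have : w ∈ insert ρ KF := by simpa using hw
    exact ⟨c₁ w this, this⟩
  obtain ⟨φ₂, e₂, c₂, E₂⟩ := E₁.prefill KS par^[3] s₁ (fun w hw h => by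
      rcases Finset.mem_insert.1 (v₁ _ h).2 with h | h
      · exact hE.ne w (hKS hw) 3 (by norm_num) h
      · have := hE.disj w (hKS hw) _ (hKF h) 3 (by norm_num) 0 (by norm_num) rfl
        omega)
    (fun w hw w' hw' h => (hE.disj w (hKS hw) w' (hKS hw') 3 (by norm_num) 3 (by norm_num) h).1)
    (fun w hw => (Finset.mem_sdiff.1 (h₁ w hw)).1)
    (fun w hw w' hw' h => i₁ w hw w' hw' (hlab _ (h₁ w hw) _ (h₁ w' hw') h))
    (fun w hw u hu h => by
      rw [(v₁ u hu).1] at h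
      exact (hβX u (v₁ u hu).2).2.1 w hw (hlab _ (hβX u (v₁ u hu).2).1 _ (h₁ w hw) h).symm)
    (fun w hw u hu h => absurd h (hind u (hDsub1 hu) _
      ((memD₀ _).2 (Or.inr (Or.inr (Or.inl ⟨w, hw, rfl⟩))))))
    (fun w hw w' hw' => hind _ ((memD₀ _).2 (Or.inr (Or.inr (Or.inl ⟨w, hw, rfl⟩)))) _
      ((memD₀ _).2 (Or.inr (Or.inr (Or.inl ⟨w', hw', rfl⟩)))))
  have v₂ : ∀ w ∈ ∅ ∪ (insert ρ KF).image id ∪ KS.image par^[3],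
      (φ₂ w = β w ∧ w ∈ insert ρ KF) ∨ ∃ u ∈ KS, w = par^[3] u ∧ φ₂ w = s₁ u := by
    intro w hw
    rcases Finset.mem_union.1 hw with h | h
    · exact Or.inl ⟨(e₂ w h).trans (v₁ w h).1, (v₁ w h).2⟩
    · obtain ⟨u, hu, rfl⟩ := Finset.mem_image.1 h
      exact Or.inr ⟨u, hu, rfl, c₂ u hu⟩
  obtain ⟨φ₃, e₃, c₃, E₃⟩ := E₂.prefill KS par^[1] s₂ (fun w hw h => by
      rcases v₂ _ h with h | ⟨u, hu, h, -⟩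
      · rcases Finset.mem_insert.1 h.2 with h | h
        · exact hE.ne w (hKS hw) 1 (by norm_num) h
        · have := hE.disj w (hKS hw) _ (hKF h) 1 (by norm_num) 0 (by norm_num) rfl
          omega
      · have := hE.disj w (hKS hw) u (hKS hu) 1 (by norm_num) 3 (by norm_num) h
        omega)
    (fun w hw w' hw' h => (hE.disj w (hKS hw) w' (hKS hw') 1 (by norm_num) 1 (by norm_num) h).1)
    (fun w hw => (Finset.mem_sdiff.1 (h₂ w hw)).1)
    (fun w hw w' hw' h => i₂ w hw w' hw' (hlab _ (h₂ w hw) _ (h₂ w' hw') h))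
    (fun w hw u hu h => by
      rcases v₂ u hu with h' | ⟨a, ha, -, h'⟩
      · rw [h'.1] at h
        exact (hβX u h'.2).2.2 w hw (hlab _ (hβX u h'.2).1 _ (h₂ w hw) h).symm
      · rw [h'] at h
        exact i₃ a ha w hw (hlab _ (h₁ a ha) _ (h₂ w hw) h))
    (fun w hw u hu h => absurd h (hind u (hDsub2 hu) _
      ((memD₀ _).2 (Or.inr (Or.inr (Or.inr ⟨w, hw, rfl⟩))))))
    (fun w hw w' hw' => hind _ ((memD₀ _).2 (Or.inr (Or.inr (Or.inr ⟨w, hw, rfl⟩)))) _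
      ((memD₀ _).2 (Or.inr (Or.inr (Or.inr ⟨w', hw', rfl⟩)))))
  rw [← hD₀] at E₃
  have s3 : ∀ w ∈ KS, φ₃ (par^[3] w) = s₁ w ∧ φ₃ (par^[1] w) = s₂ w := by
    intro w hw
    refine ⟨?_, c₃ w hw⟩
    rw [e₃ _ (Finset.mem_union_right _ (Finset.mem_image_of_mem _ hw)), c₂ w hw]
  have n3 : ∀ w ∈ D₀, φ₃ w ∉ P.tokens := by
    intro w hw
    rw [hD₀] at hw
    rcases Finset.mem_union.1 hw with h | h
    · rw [e₃ w h]
      rcases v₂ w h with h' | ⟨a, ha, -, h'⟩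
      · rw [h'.1]; exact (Finset.mem_sdiff.1 (hβX w h'.2).1).2
      · rw [h']; exact (Finset.mem_sdiff.1 (h₁ a ha)).2
    · obtain ⟨u, hu, rfl⟩ := Finset.mem_image.1 h
      rw [c₃ u hu]
      exact (Finset.mem_sdiff.1 (h₂ u hu)).2
  -- the second stage
  obtain ⟨D₁, hD₁⟩ : ∃ D₁, D₁ = U \ M := ⟨_, rfl⟩
  have memD₁ : ∀ v, v ∈ D₁ ↔ v ∈ U ∧ v ∉ M := fun v => by rw [hD₁, Finset.mem_sdiff]
  have hitU : ∀ w ∈ E, ∀ i, par^[i] w ∈ U := fun w hw i => hU.iterate_mem R (hEU hw) i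
  have hD₀₁ : D₀ ⊆ D₁ := by
    intro v hv
    refine (memD₁ v).2 ⟨?_, hD₀M v hv⟩
    rcases (memD₀ v).1 hv with rfl | h | ⟨w, hw, rfl⟩ | ⟨w, hw, rfl⟩
    exacts [hU.1, hEU (hKF h), hitU w (hKS hw) 3, hitU w (hKS hw) 1]
  have hD₁U : D₁.card ≤ U.card := Finset.card_le_card (hD₁ ▸ Finset.sdiff_subset)
  -- Only the part inside `U` is embedded before the joins, since these work with threshold `2 * m`
  -- and thus need `(2 * m + 1) * m` free vertices.
  obtain ⟨φ₄, e₄, E₄, I₄⟩ := E₃.extend R hJ hΔ (D' := D₁) (t := 2 * m) (Z := ∅) (by omega) hD₀₁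
    (fun v hv hv' => by
      have hvρ : v ≠ ρ := by rintro rfl; exact hv' ((memD₀ _).2 (Or.inl rfl))
      rw [memD₁] at hv ⊢
      exact ⟨hvρ, hU.2 v hv.1 hvρ, fun h => (hM1 v hvρ h).elim hv.2 hv'⟩)
    (fun c hc => by
      rcases hM2 c hc with h | h
      · exact Or.inl h
      · exact Or.inr (Or.inr fun h' => ((memD₁ _).1 h').2 h))
    (by omega) (fun v => by have := hH v; rw [Finset.card_empty]; omega)
    (fun w hw hwt => absurd hwt (n3 w hw))
  obtain ⟨D₂, hD₂⟩ : ∃ D₂, D₂ = D₁ ∪ KS.image par^[5] ∪ KS.image par^[4] := ⟨_, rfl⟩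
  have hD₂c : D₂.card ≤ D₁.card + 2 * KS.card := by
    have a1 := Finset.card_union_le (D₁ ∪ KS.image par^[5]) (KS.image par^[4])
    have a2 := Finset.card_union_le D₁ (KS.image par^[5])
    have a3 : (KS.image par^[5]).card ≤ KS.card := Finset.card_image_le
    have a4 : (KS.image par^[4]).card ≤ KS.card := Finset.card_image_le
    rw [hD₂]
    omega
  obtain ⟨φ₅, e₅, E₅, I₅⟩ := Emb.join_family hJ KS par^[6] par^[5] par^[4] par^[3] E₄ I₄
    (fun w hw => (memD₁ _).2 ⟨hitU w (hKS hw) 6, htopM w (hKS hw)⟩)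
    (fun w hw => hD₀₁ ((memD₀ _).2 (Or.inr (Or.inr (Or.inl ⟨w, hw, rfl⟩)))))
    (fun w hw h => ((memD₁ _).1 h).2 ((iterM w (hKS hw) 5 le_rfl).2 (Or.inl ⟨hw, by simp⟩)))
    (fun w hw h => ((memD₁ _).1 h).2
      ((iterM w (hKS hw) 4 (by norm_num)).2 (Or.inl ⟨hw, by simp⟩)))
    (fun w hw w' hw' h => by
      have := (hE.disj w (hKS hw) w' (hKS hw') 5 le_rfl 4 (by norm_num) h).2
      omega)
    (fun w hw w' hw' h => (hE.disj w (hKS hw) w' (hKS hw') 5 le_rfl 5 le_rfl h).1)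
    (fun w hw w' hw' h => (hE.disj w (hKS hw) w' (hKS hw') 4 (by norm_num) 4 (by norm_num) h).1)
    (fun w hw => hE.adj_par R (hKS hw) (i := 5) le_rfl)
    (fun w hw => (hE.adj_par R (hKS hw) (i := 3) (by norm_num)).symm)
    (fun w hw c hc => hE.adj_cases R (hKS hw) (i := 4) (by norm_num) hc)
    (fun w hw c hc => hE.adj_cases R (hKS hw) (i := 3) (by norm_num) hc)
    (fun D' φ' _ hD' _ E' I' v => by
      have a1 := Finset.card_le_card hD'
      rw [← hD₂] at a1
      have a2 := I'.card_used_le E' hJ hΔ (by omega)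
      have := hH v
      rw [Finset.card_empty] at a2
      omega)
  rw [← hD₂] at E₅ I₅
  have hu₅ := I₅.card_used_le E₅ hJ hΔ (by omega)
  rw [Finset.card_empty] at hu₅
  -- the third stage
  have memD₂ : ∀ v, v ∈ D₂ ↔ v ∈ D₁ ∨ (∃ w ∈ KS, par^[5] w = v) ∨ ∃ w ∈ KS, par^[4] w = v :=
    fun v => by simp only [hD₂, Finset.mem_union, Finset.mem_image, or_assoc]
  have hD₁₂ : D₁ ⊆ D₂ := fun v hv => (memD₂ v).2 (Or.inl hv)
  obtain ⟨Q, hQ⟩ : ∃ Q, Q = pieces par KS {2} ∪ pieces par KF {1, 2, 3, 4, 5} := ⟨_, rfl⟩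
  rw [← hQ]
  have iterQ : ∀ w ∈ E, ∀ i ≤ 5, par^[i] w ∈ Q ↔ (w ∈ KS ∧ i ∈ ({2} : Finset ℕ)) ∨
      (w ∈ KF ∧ i ∈ ({1, 2, 3, 4, 5} : Finset ℕ)) := fun w hw i hi => by
    rw [hQ, Finset.mem_union, hE.iterate_mem_pieces hKS (by simp) hw hi,
      hE.iterate_mem_pieces hKF (fun j hj => (b5 j hj).2) hw hi]
  have hMQ : ∀ v ∈ M, v ∈ Q ∨ v ∈ D₂ := by
    intro v hv
    obtain ⟨w, hw, i, -, hi, rfl⟩ := memM v hv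
    rw [iterQ w hw i hi, memD₂]
    rcases (iterM w hw i hi).1 hv with ⟨hS, h⟩ | ⟨hF, h⟩
    · simp only [Finset.mem_insert, Finset.mem_singleton] at h
      rcases h with rfl | rfl | rfl
      · exact Or.inl (Or.inl ⟨hS, by simp⟩)
      · exact Or.inr (Or.inr (Or.inr ⟨w, hS, rfl⟩))
      · exact Or.inr (Or.inr (Or.inl ⟨w, hS, rfl⟩))
    · exact Or.inl (Or.inr ⟨hF, h⟩)
  have hQM : Q ⊆ M := by
    rw [hQ, hM]
    refine Finset.union_subset_union (fun v hv => ?_) (Finset.Subset.refl _)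
    rw [mem_pieces] at hv ⊢
    obtain ⟨w, hw, i, hi, h⟩ := hv
    exact ⟨w, hw, i, by rw [Finset.mem_singleton] at hi; simp [hi], h⟩
  have hQc : Q.card = KS.card + 5 * KF.card := by
    rw [hQ, Finset.card_union_of_disjoint, hE.card_pieces hKS (by simp),
      hE.card_pieces hKF (fun j hj => (b5 j hj).2)]
    · simp [mul_comm]
    · rw [Finset.disjoint_left]
      intro v hv
      obtain ⟨w, hw, i, hi, rfl⟩ := mem_pieces.1 hv
      rw [Finset.mem_singleton] at hi
      subst hi
      rw [hE.iterate_mem_pieces hKF (fun j hj => (b5 j hj).2) (hKS hw) (by norm_num)]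
      exact fun h => hnSF w hw h.1
  have hQn := Finset.card_sdiff_add_card_eq_card (Finset.subset_univ Q)
  rw [Finset.card_univ] at hQn
  obtain ⟨Z, hZ⟩ : ∃ Z, Z = (P.used D₂ φ₅).image φ₅ := ⟨_, rfl⟩
  have hZc : Z.card ≤ (P.used D₂ φ₅).card := hZ ▸ Finset.card_image_le
  have hD₂₃ : D₂ ⊆ Finset.univ \ Q := by
    intro v hv
    refine Finset.mem_sdiff.2 ⟨Finset.mem_univ _, fun h => ?_⟩
    rcases (memD₂ v).1 hv with h' | ⟨w, hw, rfl⟩ | ⟨w, hw, rfl⟩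
    · exact ((memD₁ v).1 h').2 (hQM h)
    · have := (iterQ w (hKS hw) 5 le_rfl).1 h
      simp [hnSF w hw] at this
    · have := (iterQ w (hKS hw) 4 (by norm_num)).1 h
      simp [hnSF w hw] at this
  -- Plain attachment works with threshold `1`, for which `2 * m` free vertices suffice, so almost
  -- all vertices can be used up. The tokens used so far, at most `Δ * m`, become exempt, and a
  -- second `Δ * m` may be added.
  obtain ⟨φ₆, e₆, E₆, I₆⟩ := E₅.extend R hJ hΔ (D' := Finset.univ \ Q) (t := 1) (Z := Z) le_rfl hD₂₃
    (fun v hv hv' => by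
      rw [Finset.mem_sdiff] at hv
      have hvρ : v ≠ ρ := by
        rintro rfl; exact hv' (hD₁₂ (hD₀₁ ((memD₀ _).2 (Or.inl rfl))))
      have hvM : v ∉ M := fun h => (hMQ v h).elim hv.2 hv'
      refine ⟨hvρ, Finset.mem_sdiff.2 ⟨Finset.mem_univ _, fun h => ?_⟩⟩
      exact (hM1 v hvρ (hQM h)).elim hvM fun h => hv' (hD₁₂ (hD₀₁ h)))
    (fun c hc => by
      rcases (memD₂ c).1 hc with h | ⟨w, hw, rfl⟩ | ⟨w, hw, rfl⟩
      · by_cases hcρ : c = ρ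
        · exact Or.inl hcρ
        right
        by_cases hpM : par c ∈ M
        · rcases hMQ _ hpM with h' | h'
          · exact Or.inr fun h'' => (Finset.mem_sdiff.1 h'').2 h'
          · exact Or.inl h'
        · exact Or.inl (hD₁₂ ((memD₁ _).2 ⟨hU.2 c ((memD₁ c).1 h).1 hcρ, hpM⟩))
      · right; left
        rw [← Function.iterate_succ_apply' par]
        exact hD₁₂ ((memD₁ _).2 ⟨hitU w (hKS hw) 6, htopM w (hKS hw)⟩)
      · right; left
        rw [← Function.iterate_succ_apply' par]
        exact (memD₂ _).2 (Or.inr (Or.inl ⟨w, hw, rfl⟩)))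
    (by omega) (fun v => by have := hH v; omega)
    (fun w hw hwt => Or.inl (hZ ▸ Finset.mem_image_of_mem _ (Palette.mem_used.2 ⟨hw, hwt⟩)))
  have hu₆ := I₆.card_used_le E₆ hJ hΔ (by omega)
  refine ⟨φ₆, E₆, fun w hw => ?_, by omega⟩
  have a1 := (memD₀ (par^[3] w)).2 (Or.inr (Or.inr (Or.inl ⟨w, hw, rfl⟩)))
  have a2 := (memD₀ (par^[1] w)).2 (Or.inr (Or.inr (Or.inr ⟨w, hw, rfl⟩)))
  rw [e₆ _ (hD₁₂ (hD₀₁ a1)), e₆ _ (hD₁₂ (hD₀₁ a2)), e₅ _ (hD₀₁ a1), e₅ _ (hD₀₁ a2),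
    e₄ _ a1, e₄ _ a2]
  exact s3 w hw

end Paths

/-! ### Occupying every vertex outside the absorbing set -/

section Completion
open scoped Classical

variable {V W L : Type*} [Fintype V] [Fintype W] {G : SimpleGraph V} {T : SimpleGraph W}
  {P : Palette V L} {ρ : W} {par : W → W} {dep : W → ℕ} {m Δ : ℕ} {E KS KF : Finset W}

/-- The unoccupied vertices that are not tokens, with further tokens of unused labels. -/
lemma Emb.exists_superset_free {D : Finset W} {φ : W → V} (E : Emb G T P D φ) {f : ℕ} (v : V)
    (h1 : (P.free D φ).card ≤ f) (h2 : (P.used D φ).card + f ≤ (P.hits G v).card) :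
    ∃ R : Finset V, P.free D φ ⊆ R ∧ R.card = f ∧ R ⊆ P.allowed ∧
      (∀ c ∈ R, ∀ c' ∈ R, P.label c = P.label c' → c = c') ∧
      ∀ c ∈ R, ∀ w ∈ D, P.label (φ w) ≠ P.label c := by
  obtain ⟨Y, hY, hYc⟩ := Finset.exists_subset_card_eq
    (s := P.hits G v \ (P.used D φ).image fun w => P.label (φ w))
    (n := f - (P.free D φ).card) (by
      have a1 := Finset.le_card_sdiff ((P.used D φ).image fun w => P.label (φ w)) (P.hits G v)
      have a2 : ((P.used D φ).image fun w => P.label (φ w)).card ≤ (P.used D φ).card :=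
        Finset.card_image_le
      omega)
  have hr : ∀ l ∈ Y, ∃ c ∈ P.tokens, P.label c = l := by
    intro l hl
    have := (Finset.mem_sdiff.1 (hY hl)).1
    simp only [Palette.hits, Finset.mem_image, Finset.mem_inter] at this
    obtain ⟨c, hc, h⟩ := this
    exact ⟨c, hc.2, h⟩
  have : Nonempty V := ⟨v⟩
  choose! r hr hrl using hr
  have hnew : ∀ l ∈ Y, ∀ w ∈ D, P.label (φ w) ≠ P.label (r l) := by
    intro l hl w hw h
    refine (Finset.mem_sdiff.1 (hY hl)).2 (Finset.mem_image.2 ⟨w, E.exists_used (hr l hl) hw h, ?_⟩)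
    rw [h, hrl l hl]
  have hcross : ∀ c ∈ P.free D φ, ∀ l ∈ Y, P.label c ≠ P.label (r l) := by
    intro c hc l hl h
    rw [Palette.mem_free] at hc
    have := P.label_inj c hc.1 hc.2.1 _ (P.tokens_subset (hr l hl)) h
    exact hc.2.1 (this ▸ hr l hl)
  refine ⟨P.free D φ ∪ Y.image r, Finset.subset_union_left, ?_, ?_, ?_, ?_⟩
  · rw [Finset.card_union_of_disjoint, Finset.card_image_of_injOn, hYc]
    · omega
    · intro l hl l' hl' h
      rw [← hrl l hl, ← hrl l' hl', h]
    · rw [Finset.disjoint_left]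
      intro c hc hc'
      obtain ⟨l, hl, rfl⟩ := Finset.mem_image.1 hc'
      exact hcross _ hc l hl rfl
  · intro c hc
    rcases Finset.mem_union.1 hc with hc | hc
    · exact (Palette.mem_free.1 hc).1
    · obtain ⟨l, hl, rfl⟩ := Finset.mem_image.1 hc
      exact P.tokens_subset (hr l hl)
  · intro c hc c' hc' h
    rcases Finset.mem_union.1 hc with hc | hc <;> rcases Finset.mem_union.1 hc' with hc' | hc'
    · rw [Palette.mem_free] at hc hc'
      exact P.label_inj c hc.1 hc.2.1 c' hc'.1 h
    · obtain ⟨l, hl, rfl⟩ := Finset.mem_image.1 hc'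
      exact absurd h (hcross c hc l hl)
    · obtain ⟨l, hl, rfl⟩ := Finset.mem_image.1 hc
      exact absurd h.symm (hcross c' hc' l hl)
    · obtain ⟨l, hl, rfl⟩ := Finset.mem_image.1 hc
      obtain ⟨l', hl', rfl⟩ := Finset.mem_image.1 hc'
      rw [hrl l hl, hrl l' hl'] at h
      rw [h]
  · intro c hc w hw
    rcases Finset.mem_union.1 hc with hc | hc
    · exact E.label_ne_of_free hc w hw
    · obtain ⟨l, hl, rfl⟩ := Finset.mem_image.1 hc
      exact hnew l hl w hw

/-- Embedding the inner vertices of the paths ending in `KF` so that only tokens are left. -/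
lemma IsChainFamily.exists_completion (hE : IsChainFamily ρ par E) (R : Rooted T ρ par dep)
    (hJ : Joined G m) (hΔ1 : 1 ≤ Δ)
    (hKS : KS ⊆ E) (hKF : KF ⊆ E) (hSF : Disjoint KS KF) (hFc : KF.card = 10 * (Δ * m))
    (hH : ∀ v, 59 * (Δ * m) ≤ (P.hits G v).card)
    (hc : Fintype.card W = (P.allowed \ P.tokens).card + KS.card + 45 * (Δ * m))
    {φ : W → V}
    (E₀ : Emb G T P (Finset.univ \ (pieces par KS {2} ∪ pieces par KF {1, 2, 3, 4, 5})) φ)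
    (hu : (P.used (Finset.univ \ (pieces par KS {2} ∪ pieces par KF {1, 2, 3, 4, 5})) φ).card ≤
        2 * (Δ * m)) :
    ∃ φ' : W → V, (∀ w ∈ KS, ∀ i ∈ ({1, 3} : Finset ℕ), φ' (par^[i] w) = φ (par^[i] w)) ∧
      Emb G T P (Finset.univ \ pieces par KS {2}) φ' ∧
      ∀ c ∈ P.allowed \ P.tokens, ∃ w ∈ Finset.univ \ pieces par KS {2}, φ' w = c := by
  have hm := hJ.pos
  have hμ : m ≤ Δ * m := Nat.le_mul_of_pos_left m hΔ1
  have hnSF : ∀ w ∈ KS, w ∉ KF := fun w hw hw' => Finset.disjoint_left.1 hSF hw hw'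
  have hnFS : ∀ w ∈ KF, w ∉ KS := fun w hw hw' => Finset.disjoint_left.1 hSF hw' hw
  have b5 : ∀ j ∈ ({1, 2, 3, 4, 5} : Finset ℕ), 1 ≤ j ∧ j ≤ 5 := by decide
  have b2 : ∀ j ∈ ({2} : Finset ℕ), 1 ≤ j ∧ j ≤ 5 := by decide
  obtain ⟨Q, hQ⟩ : ∃ Q, Q = pieces par KS {2} ∪ pieces par KF {1, 2, 3, 4, 5} := ⟨_, rfl⟩
  rw [← hQ] at E₀ hu
  have iterQ : ∀ w ∈ E, ∀ i ≤ 5, par^[i] w ∈ Q ↔ (w ∈ KS ∧ i ∈ ({2} : Finset ℕ)) ∨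
      (w ∈ KF ∧ i ∈ ({1, 2, 3, 4, 5} : Finset ℕ)) := fun w hw i hi => by
    rw [hQ, Finset.mem_union, hE.iterate_mem_pieces hKS (by simp) hw hi,
      hE.iterate_mem_pieces hKF (fun j hj => (b5 j hj).2) hw hi]
  have htopQ : ∀ w ∈ E, par^[6] w ∉ Q := fun w hw h => by
    rw [hQ, Finset.mem_union] at h
    rcases h with h | h
    · exact hE.top_notMem hKS b2 hw h
    · exact hE.top_notMem hKF b5 hw h
  have hQc : Q.card = KS.card + 5 * KF.card := by
    rw [hQ, Finset.card_union_of_disjoint, hE.card_pieces hKS (by simp),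
      hE.card_pieces hKF (fun j hj => (b5 j hj).2)]
    · simp [mul_comm]
    · rw [Finset.disjoint_left]
      intro v hv
      obtain ⟨w, hw, i, hi, rfl⟩ := mem_pieces.1 hv
      rw [Finset.mem_singleton] at hi
      subst hi
      rw [hE.iterate_mem_pieces hKF (fun j hj => (b5 j hj).2) (hKS hw) (by norm_num)]
      exact fun h => hnSF w hw h.1
  have hQn := Finset.card_sdiff_add_card_eq_card (Finset.subset_univ Q)
  rw [Finset.card_univ] at hQn
  obtain ⟨D, hD⟩ : ∃ D, D = Finset.univ \ Q := ⟨_, rfl⟩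
  rw [← hD] at E₀ hu hQn
  have memD : ∀ v, v ∈ D ↔ v ∉ Q := fun v => by simp [hD]
  have hFQ : ∀ w ∈ KF, ∀ i, 1 ≤ i → i ≤ 5 → par^[i] w ∈ Q := fun w hw i h1 h5 =>
    (iterQ w (hKF hw) i h5).2 (Or.inr ⟨hw, by simp; omega⟩)
  have hF0 : ∀ w ∈ KF, par^[0] w ∈ D := fun w hw => by
    rw [memD, iterQ w (hKF hw) 0 (by norm_num)]
    simp
  -- occupying all vertices that are left
  have hfree := E₀.card_free
  obtain ⟨v₀⟩ : Nonempty V := ⟨φ ρ⟩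
  -- By `hc`, the number of free vertices is `5 * (Δ * m)` plus the tokens used, at most `7 * (Δ *
  -- m)`. They are padded by tokens to `KF.card` vertices and become the positions of the middles of
  -- the paths of `KF`.
  obtain ⟨X, hX, hXc, hXa, hXl, hXn⟩ := E₀.exists_superset_free (f := KF.card) v₀ (by omega)
    (by have := hH v₀; omega)
  have hVne : Nonempty V := ⟨v₀⟩
  obtain ⟨β, hβ⟩ := exists_bijOn_of_card_eq hXc.symm
  obtain ⟨φ₁, e₁, c₁, E₁⟩ := E₀.prefill KF par^[3] β
    (fun w hw h => (memD _).1 h (hFQ w hw 3 (by norm_num) (by norm_num)))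
    (fun w hw w' hw' h => (hE.disj w (hKF hw) w' (hKF hw') 3 (by norm_num) 3 (by norm_num) h).1)
    (fun w hw => hXa (hβ.mapsTo hw))
    (fun w hw w' hw' h => hβ.injOn hw hw' (hXl _ (hβ.mapsTo hw) _ (hβ.mapsTo hw') h))
    (fun w hw u hu => hXn _ (hβ.mapsTo hw) u hu)
    (fun w hw u hu h => by
      exfalso
      rcases hE.adj_cases R (hKF hw) (i := 2) (by norm_num) h with rfl | rfl
      · exact (memD _).1 hu (hFQ w hw 4 (by norm_num) (by norm_num))
      · exact (memD _).1 hu (hFQ w hw 2 (by norm_num) (by norm_num)))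
    (fun w hw w' hw' h => by
      rcases hE.adj_cases R (hKF hw') (i := 2) (by norm_num) h with h | h
      · have := (hE.disj w (hKF hw) w' (hKF hw') 3 (by norm_num) 4 (by norm_num) h).2
        omega
      · have := (hE.disj w (hKF hw) w' (hKF hw') 3 (by norm_num) 2 (by norm_num) h).2
        omega)
  have himg : ∀ (S : Finset W) (i : ℕ), ((S ∪ KF.image par^[i]) \ S).card ≤ KF.card := by
    intro S i
    refine (Finset.card_le_card (t := KF.image par^[i]) fun v hv => ?_).trans Finset.card_image_le
    rw [Finset.mem_sdiff, Finset.mem_union] at hv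
    exact hv.1.resolve_left hv.2
  have himg2 : ∀ (S S' : Finset W) (i j : ℕ), S' ⊆ S ∪ KF.image par^[i] ∪ KF.image par^[j] →
      (S' \ S).card ≤ 2 * KF.card := by
    intro S S' i j h
    have a1 : S' \ S ⊆ KF.image par^[i] ∪ KF.image par^[j] := by
      intro v hv
      rw [Finset.mem_sdiff] at hv
      have := h hv.1
      rw [Finset.mem_union, Finset.mem_union] at this
      rw [Finset.mem_union]
      rcases this with (h | h) | h
      exacts [absurd h hv.2, Or.inl h, Or.inr h]
    have a2 := Finset.card_le_card a1
    have a3 := Finset.card_union_le (KF.image par^[i]) (KF.image par^[j])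
    have a4 : (KF.image par^[i]).card ≤ KF.card := Finset.card_image_le
    have a5 : (KF.image par^[j]).card ≤ KF.card := Finset.card_image_le
    omega
  have hu₁ := P.card_used_le (D' := D ∪ KF.image par^[3]) e₁
  have hi₁ := himg D 3
  obtain ⟨D₁, hD₁⟩ : ∃ D₁, D₁ = D ∪ KF.image par^[3] := ⟨_, rfl⟩
  rw [← hD₁] at hu₁ hi₁ E₁
  have memD₁ : ∀ v, v ∈ D₁ ↔ v ∈ D ∨ ∃ w ∈ KF, par^[3] w = v := fun v => by
    simp only [hD₁, Finset.mem_union, Finset.mem_image]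
  have hnD₁ : ∀ w ∈ KF, ∀ i, 1 ≤ i → i ≤ 5 → i ≠ 3 → par^[i] w ∉ D₁ := by
    intro w hw i h1 h5 h3 h
    rcases (memD₁ _).1 h with h | ⟨w', hw', h⟩
    · exact (memD _).1 h (hFQ w hw i h1 h5)
    · exact h3 (hE.disj w' (hKF hw') w (hKF hw) 3 (by norm_num) i h5 h).2.symm
  -- joining the paths
  obtain ⟨φ₂, e₂, E₂, -⟩ := Emb.join_family hJ (Z := Finset.univ) KF par^[6] par^[5] par^[4] par^[3]
    E₁ (fun _ _ _ => Or.inl (Finset.mem_univ _))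
    (fun w hw => (memD₁ _).2 (Or.inl ((memD _).2 (htopQ w (hKF hw)))))
    (fun w hw => (memD₁ _).2 (Or.inr ⟨w, hw, rfl⟩))
    (fun w hw => hnD₁ w hw 5 (by norm_num) le_rfl (by norm_num))
    (fun w hw => hnD₁ w hw 4 (by norm_num) (by norm_num) (by norm_num))
    (fun w hw w' hw' h => by
      have := (hE.disj w (hKF hw) w' (hKF hw') 5 le_rfl 4 (by norm_num) h).2
      omega)
    (fun w hw w' hw' h => (hE.disj w (hKF hw) w' (hKF hw') 5 le_rfl 5 le_rfl h).1)
    (fun w hw w' hw' h => (hE.disj w (hKF hw) w' (hKF hw') 4 (by norm_num) 4 (by norm_num) h).1)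
    (fun w hw => hE.adj_par R (hKF hw) (i := 5) le_rfl)
    (fun w hw => (hE.adj_par R (hKF hw) (i := 3) (by norm_num)).symm)
    (fun w hw c hc => hE.adj_cases R (hKF hw) (i := 4) (by norm_num) hc)
    (fun w hw c hc => hE.adj_cases R (hKF hw) (i := 3) (by norm_num) hc)
    (fun D' φ' _ hD' e' _ _ v => by
      have a1 := himg2 _ _ 5 4 hD'
      have a2 := P.card_used_le (D' := D') e'
      have := hH v
      omega)
  have hu₂ := P.card_used_le (D' := D₁ ∪ KF.image par^[5] ∪ KF.image par^[4]) e₂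
  have hi₂ := himg2 D₁ _ 5 4 (Finset.Subset.refl _)
  obtain ⟨D₂, hD₂⟩ : ∃ D₂, D₂ = D₁ ∪ KF.image par^[5] ∪ KF.image par^[4] := ⟨_, rfl⟩
  rw [← hD₂] at hu₂ hi₂ E₂
  have memD₂ : ∀ v, v ∈ D₂ ↔ v ∈ D₁ ∨ (∃ w ∈ KF, par^[5] w = v) ∨ ∃ w ∈ KF, par^[4] w = v :=
    fun v => by simp only [hD₂, Finset.mem_union, Finset.mem_image, or_assoc]
  have hD₁₂ : D₁ ⊆ D₂ := fun v hv => (memD₂ v).2 (Or.inl hv)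
  have hDD₁ : D ⊆ D₁ := fun v hv => (memD₁ v).2 (Or.inl hv)
  have hnD₂ : ∀ w ∈ KF, ∀ i, 1 ≤ i → i ≤ 2 → par^[i] w ∉ D₂ := by
    intro w hw i h1 h2 h
    rcases (memD₂ _).1 h with h | ⟨w', hw', h⟩ | ⟨w', hw', h⟩
    · exact hnD₁ w hw i h1 (by omega) (by omega) h
    · have := (hE.disj w' (hKF hw') w (hKF hw) 5 (by norm_num) i (by omega) h).2
      omega
    · have := (hE.disj w' (hKF hw') w (hKF hw) 4 (by norm_num) i (by omega) h).2
      omega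
  obtain ⟨φ₃, e₃, E₃, -⟩ := Emb.join_family hJ (Z := Finset.univ) KF par^[3] par^[2] par^[1] par^[0]
    E₂ (fun _ _ _ => Or.inl (Finset.mem_univ _))
    (fun w hw => hD₁₂ ((memD₁ _).2 (Or.inr ⟨w, hw, rfl⟩)))
    (fun w hw => hD₁₂ (hDD₁ (hF0 w hw)))
    (fun w hw => hnD₂ w hw 2 (by norm_num) le_rfl)
    (fun w hw => hnD₂ w hw 1 le_rfl (by norm_num))
    (fun w hw w' hw' h => by
      have := (hE.disj w (hKF hw) w' (hKF hw') 2 (by norm_num) 1 (by norm_num) h).2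
      omega)
    (fun w hw w' hw' h => (hE.disj w (hKF hw) w' (hKF hw') 2 (by norm_num) 2 (by norm_num) h).1)
    (fun w hw w' hw' h => (hE.disj w (hKF hw) w' (hKF hw') 1 (by norm_num) 1 (by norm_num) h).1)
    (fun w hw => hE.adj_par R (hKF hw) (i := 2) (by norm_num))
    (fun w hw => (hE.adj_par R (hKF hw) (i := 0) (by norm_num)).symm)
    (fun w hw c hc => hE.adj_cases R (hKF hw) (i := 1) (by norm_num) hc)
    (fun w hw c hc => hE.adj_cases R (hKF hw) (i := 0) (by norm_num) hc)
    (fun D' φ' _ hD' e' _ _ v => by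
      have a1 := himg2 _ _ 2 1 hD'
      have a2 := P.card_used_le (D' := D') e'
      have := hH v
      omega)
  have hfin : D₂ ∪ KF.image par^[2] ∪ KF.image par^[1] = Finset.univ \ pieces par KS {2} := by
    ext v
    rw [Finset.mem_union, Finset.mem_union, Finset.mem_image, Finset.mem_image, memD₂, memD₁, memD,
      Finset.mem_sdiff]
    simp only [Finset.mem_univ, true_and]
    have hFS : ∀ w ∈ KF, ∀ i ≤ 5, par^[i] w ∉ pieces par KS {2} := fun w hw i hi => by
      rw [hE.iterate_mem_pieces hKS (by simp) (hKF hw) hi]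
      exact fun h => hnFS w hw h.1
    constructor
    · rintro ((((h | ⟨w, hw, rfl⟩) | ⟨w, hw, rfl⟩ | ⟨w, hw, rfl⟩) | ⟨w, hw, rfl⟩) | ⟨w, hw, rfl⟩)
      · exact fun h' => h (hQ ▸ Finset.mem_union_left _ h')
      all_goals exact hFS w hw _ (by norm_num)
    · intro h
      by_cases hv : v ∈ Q
      · rw [hQ, Finset.mem_union] at hv
        obtain ⟨w, hw, i, hi, h⟩ := mem_pieces.1 (hv.resolve_left h)
        simp only [Finset.mem_insert, Finset.mem_singleton] at hi
        rcases hi with rfl | rfl | rfl | rfl | rfl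
        · exact Or.inr ⟨w, hw, h⟩
        · exact Or.inl (Or.inr ⟨w, hw, h⟩)
        · exact Or.inl (Or.inl (Or.inl (Or.inr ⟨w, hw, h⟩)))
        · exact Or.inl (Or.inl (Or.inr (Or.inr ⟨w, hw, h⟩)))
        · exact Or.inl (Or.inl (Or.inr (Or.inl ⟨w, hw, h⟩)))
      · exact Or.inl (Or.inl (Or.inl (Or.inl hv)))
  rw [hfin] at E₃
  have hDfin : D₁ ⊆ Finset.univ \ pieces par KS {2} := hfin ▸
    (hD₁₂.trans Finset.subset_union_left).trans Finset.subset_union_left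
  have ee : ∀ w ∈ D₁, φ₃ w = φ₁ w := fun w hw => (e₃ w (hD₁₂ hw)).trans (e₂ w hw)
  refine ⟨φ₃, fun w hw i hi => ?_, E₃, fun c hc => ?_⟩
  · have : par^[i] w ∈ D := by
      simp only [Finset.mem_insert, Finset.mem_singleton] at hi
      rw [memD, iterQ w (hKS hw) i (by omega)]
      rcases hi with rfl | rfl <;> simp [hnSF w hw]
    rw [ee _ (hDD₁ this), e₁ _ this]
  · rw [Finset.mem_sdiff] at hc
    by_cases h : ∀ w ∈ D, φ w ≠ c
    · obtain ⟨w, hw, rfl⟩ := hβ.surjOn (hX (Palette.mem_free.2 ⟨hc.1, hc.2, h⟩))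
      have hw' : par^[3] w ∈ D₁ := (memD₁ _).2 (Or.inr ⟨w, hw, rfl⟩)
      exact ⟨_, hDfin hw', by rw [ee _ hw', c₁ w hw]⟩
    · push Not at h
      obtain ⟨w, hw, rfl⟩ := h
      exact ⟨w, hDfin (hDD₁ hw), by rw [ee _ (hDD₁ hw), e₁ w hw]⟩

end Completion

/-! ### Spanning embeddings in both cases -/

section Embedding
open scoped Classical

variable {V W : Type*} [Fintype V] [Fintype W] {G : SimpleGraph V} {T : SimpleGraph W}
  {ρ : W} {par : W → W} {dep : W → ℕ} {m Δ : ℕ}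

lemma Palette.mem_hits {L : Type*} {P : Palette V L} {v : V} {l : L} :
    l ∈ P.hits G v ↔ ∃ c, G.Adj v c ∧ c ∈ P.tokens ∧ P.label c = l := by
  simp only [Palette.hits, Finset.mem_image, Finset.mem_inter, mem_nbr, and_assoc]

/-- The palette in which the vertices of `F i` are tokens with the common label `i`, and all other
vertices of `A` are excluded. -/
lemma exists_palette {A : Finset V} {F : ℕ → Finset V} (hFA : ∀ i, F i ⊆ A)
    (hF : ∀ i j, i ≠ j → Disjoint (F i) (F j)) :
    ∃ P : Palette V (V ⊕ ℕ), P.allowed \ P.tokens = Finset.univ \ A ∧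
      (∀ c, c ∈ P.tokens ↔ ∃ i, c ∈ F i) ∧ (∀ c ∈ P.allowed, c ∈ A → c ∈ P.tokens) ∧
      ∀ i, ∀ c ∈ F i, P.label c = Sum.inr i := by
  have huniq : ∀ i j c, c ∈ F i → c ∈ F j → i = j := fun i j c hi hj => by
    by_contra hne
    exact Finset.disjoint_left.1 (hF i j hne) hi hj
  have h1 : ∀ c, ∃ l : V ⊕ ℕ, (∀ i, c ∈ F i → l = Sum.inr i) ∧ ((∀ i, c ∉ F i) → l = Sum.inl c) := by
    intro c
    by_cases h : ∃ i, c ∈ F i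
    · obtain ⟨i, hi⟩ := h
      exact ⟨Sum.inr i, fun j hj => by rw [huniq i j c hi hj], fun h => absurd hi (h i)⟩
    · push Not at h
      exact ⟨Sum.inl c, fun j hj => absurd hj (h j), fun _ => rfl⟩
  choose l hl hl' using h1
  have memt : ∀ c, c ∈ A.filter (fun c => ∃ i, c ∈ F i) ↔ ∃ i, c ∈ F i := fun c => by
    rw [Finset.mem_filter]
    exact ⟨fun h => h.2, fun ⟨i, hi⟩ => ⟨hFA i hi, i, hi⟩⟩
  refine ⟨⟨l, Finset.univ.filter fun c => c ∈ A → ∃ i, c ∈ F i, A.filter fun c => ∃ i, c ∈ F i,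
    fun c hc => ?_, fun c _ hc c' _ h => ?_⟩, ?_, memt, fun c hc hcA => ?_, fun i c hc => hl c i hc⟩
  · exact Finset.mem_filter.2 ⟨Finset.mem_univ _, fun _ => (memt c).1 hc⟩
  · rw [memt] at hc
    push Not at hc
    rw [hl' c hc] at h
    by_cases h' : ∃ i, c' ∈ F i
    · obtain ⟨i, hi⟩ := h'
      rw [hl c' i hi] at h
      exact absurd h (by simp)
    · push Not at h'
      rw [hl' c' h'] at h
      exact Sum.inl.inj h
  · ext c
    rw [Finset.mem_sdiff, memt, Finset.mem_filter, Finset.mem_sdiff]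
    constructor
    · rintro ⟨⟨_, h⟩, h'⟩; exact ⟨Finset.mem_univ _, fun hA => h' (h hA)⟩
    · rintro ⟨_, h⟩
      exact ⟨⟨Finset.mem_univ _, fun hA => absurd hA h⟩, fun ⟨i, hi⟩ => h (hFA i hi)⟩
  · exact (memt c).2 ((Finset.mem_filter.1 hc).2 hcA)

/-- The embedding of a tree with few leaves. -/
theorem Joined.exists_emb_of_paths (hJ : Joined G m) (R : Rooted T ρ par dep)
    (hΔ : ∀ w, (nbr T w).card ≤ Δ) (hΔ1 : 1 ≤ Δ) (hcard : Fintype.card V = Fintype.card W)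
    (hdeg : ∀ v, 240 * (Δ * m) ≤ (nbr G v).card)
    (hn : 10 ^ 9 * (Δ * m) ^ 2 ≤ Fintype.card V)
    (hlog : Fintype.card V < 4 ^ (60 * (Δ * m)))
    (hL : 2000 * (Finset.univ.filter fun v => v ≠ ρ ∧ ∀ u, u ≠ ρ → par u ≠ v).card <
      Fintype.card V) :
    ∃ φ : W → V, Function.Injective φ ∧ ∀ u v, T.Adj u v → G.Adj (φ u) (φ v) := by
  have hm := hJ.pos
  have hμ : m ≤ Δ * m := Nat.le_mul_of_pos_left m hΔ1
  have hΔμ : Δ ≤ Δ * m := Nat.le_mul_of_pos_right Δ hm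
  have q1 : m * m ≤ (Δ * m) ^ 2 := by rw [sq]; exact Nat.mul_le_mul hμ hμ
  have q2 : Δ * m ≤ (Δ * m) ^ 2 := by rw [sq]; exact Nat.le_mul_self _
  have q3 : (2 * m + 1) * m = 2 * (m * m) + m := by ring
  obtain ⟨Sl, A, F, hSep, hSA, hFA, hFd, hAc, hAn, hFv, habs⟩ :=
    hJ.exists_absorber hμ hn hlog hdeg
  have hAn' : 1000 * A.card ≤ Fintype.card V :=
    (Nat.mul_le_mul_left _ (Finset.card_le_card Finset.subset_union_right)).trans hAn
  obtain ⟨P, hPc, hPt, hPa, hPl⟩ := exists_palette hFA hFd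
  have hA := Finset.card_sdiff_add_card_eq_card (Finset.subset_univ A)
  rw [Finset.card_univ, ← hPc] at hA
  have hH : ∀ v, 59 * (Δ * m) ≤ (P.hits G v).card := by
    intro v
    obtain ⟨I, hI, hIv⟩ := hFv v
    refine hI.trans (Finset.card_le_card_of_injOn Sum.inr (fun i hi => ?_)
      Sum.inr_injective.injOn)
    obtain ⟨c, hc⟩ := hIv i hi
    rw [Finset.mem_inter] at hc
    exact Palette.mem_hits.2 ⟨c, mem_nbr.1 hc.1, (hPt c).2 ⟨i, hc.2⟩, hPl i c hc.2⟩
  obtain ⟨U, E, hU, hUc, hEU, hEc, hE⟩ := R.exists_chains hΔ (hcard ▸ hL) (by omega)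
  -- One path for each slot, and `10 * (Δ * m)` further ones to sweep up the free vertices.
  obtain ⟨KS, hKS, hKSc⟩ := Finset.exists_subset_card_eq (s := E) (n := Sl.card) (by omega)
  obtain ⟨KF, hKF', hKFc⟩ := Finset.exists_subset_card_eq (s := E \ KS) (n := 10 * (Δ * m)) (by
    have := Finset.le_card_sdiff KS E
    omega)
  have hKF : KF ⊆ E := hKF'.trans Finset.sdiff_subset
  have hSF : Disjoint KS KF := by
    rw [Finset.disjoint_left]
    exact fun w hw hw' => (Finset.mem_sdiff.1 (hKF' hw')).2 hw
  obtain ⟨v₀⟩ : Nonempty V := Fintype.card_pos_iff.1 (hcard ▸ Fintype.card_pos_iff.2 ⟨ρ⟩)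
  have hVV : Nonempty (V × V) := ⟨(v₀, v₀)⟩
  obtain ⟨κ, hκ⟩ := exists_bijOn_of_card_eq hKSc
  have hsupp : ∀ v ∈ supp Sl, v ∈ P.allowed \ P.tokens := fun v hv => by
    rw [hPc, Finset.mem_sdiff]
    exact ⟨Finset.mem_univ _, Finset.disjoint_left.1 hSA hv⟩
  obtain ⟨φ₁, E₁, s₁, u₁⟩ := hE.exists_spread (P := P) R hJ hΔ hΔ1 hU hEU hKS hKF hSF
    (fun w => (κ w).1) (fun w => (κ w).2) (fun w hw => hsupp _ (fst_mem_supp (hκ.mapsTo hw)))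
    (fun w hw => hsupp _ (snd_mem_supp (hκ.mapsTo hw)))
    (fun w hw w' hw' h => hκ.injOn hw hw' (hSep.fst_inj _ (hκ.mapsTo hw) _ (hκ.mapsTo hw') h))
    (fun w hw w' hw' h => hκ.injOn hw hw' (hSep.snd_inj _ (hκ.mapsTo hw) _ (hκ.mapsTo hw') h))
    (fun w hw w' hw' => hSep.ne _ (hκ.mapsTo hw) _ (hκ.mapsTo hw'))
    (fun v => (Nat.mul_le_mul_right _ (by norm_num)).trans (hH v))
    (by omega) (by omega) (by omega)
  obtain ⟨φ₂, e₂, E₂, c₂⟩ := hE.exists_completion R hJ hΔ1 hKS hKF hSF hKFc hH (by omega) E₁ u₁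
  have hpc : (pieces par KS {2}).card = Sl.card := by
    rw [hE.card_pieces hKS (by simp), hKSc]; simp
  have hDn := Finset.card_sdiff_add_card_eq_card (Finset.subset_univ (pieces par KS {2}))
  rw [Finset.card_univ] at hDn
  obtain ⟨D, hD⟩ : ∃ D, D = Finset.univ \ pieces par KS {2} := ⟨_, rfl⟩
  rw [← hD] at hDn E₂ c₂
  have hfree : P.free D φ₂ = ∅ := by
    rw [Finset.eq_empty_iff_forall_notMem]
    intro c hc
    rw [Palette.mem_free] at hc
    obtain ⟨w, hw, h⟩ := c₂ c (Finset.mem_sdiff.2 ⟨hc.1, hc.2.1⟩)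
    exact hc.2.2 w hw h
  have hu := E₂.card_free
  rw [hfree, Finset.card_empty] at hu
  obtain ⟨Z, hZ⟩ : ∃ Z, Z = (P.used D φ₂).image φ₂ := ⟨_, rfl⟩
  have hZc : Z.card = (P.used D φ₂).card := by
    rw [hZ]
    exact Finset.card_image_of_injOn fun u hu v hv h =>
      E₂.injOn u (Palette.mem_used.1 hu).1 v (Palette.mem_used.1 hv).1 h
  have memZ : ∀ z ∈ Z, ∃ w ∈ D, φ₂ w = z ∧ z ∈ P.tokens := by
    intro z hz
    rw [hZ] at hz
    obtain ⟨w, hw, rfl⟩ := Finset.mem_image.1 hz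
    rw [Palette.mem_used] at hw
    exact ⟨w, hw.1, rfl, hw.2⟩
  -- The tree minus `Sl.card` vertices is embedded with no free vertex left, so by `Emb.card_free`
  -- the tokens used number `A.card - Sl.card = 45 * (Δ * m)`. Their labels differ, so they lie in
  -- distinct sets `F i`, which is what the absorber tolerates.
  obtain ⟨g, hg, hgf⟩ := habs Z (fun z hz => by
      obtain ⟨-, -, -, h⟩ := memZ z hz
      exact (hPt z).1 h)
    (fun i => by
      rw [Finset.card_le_one]
      intro z hz z' hz'
      rw [Finset.mem_inter] at hz hz'
      obtain ⟨w, hw, rfl, -⟩ := memZ z hz.1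
      obtain ⟨w', hw', rfl, -⟩ := memZ z' hz'.1
      rw [E₂.inj w hw w' hw' (by rw [hPl i _ hz.2, hPl i _ hz'.2])]) (by omega)
  -- filling the slots
  obtain ⟨P', hP'⟩ : ∃ P' : Palette V V, P' = ⟨id, Finset.univ, ∅, Finset.subset_univ _,
    fun c _ _ c' _ h => h⟩ := ⟨_, rfl⟩
  have hlab : ∀ v, P'.label v = v := fun v => by rw [hP']; rfl
  have hall : ∀ v, v ∈ P'.allowed := fun v => by rw [hP']; exact Finset.mem_univ v
  have E₃ : Emb G T P' D φ₂ := ⟨fun u hu v hv h => by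
    rw [hlab, hlab] at h; exact E₂.injOn u hu v hv h, fun w _ => hall _, E₂.adj⟩
  have hga : ∀ w ∈ KS, g (κ w) ∈ A ∧ g (κ w) ∉ Z := fun w hw => by
    have := hg.mapsTo (hκ.mapsTo hw)
    simpa using this
  have memD : ∀ v, v ∈ D ↔ v ∉ pieces par KS {2} := fun v => by simp [hD]
  have hK2 : ∀ w ∈ KS, par^[2] w ∈ pieces par KS {2} := fun w hw =>
    mem_pieces.2 ⟨w, hw, 2, by simp, rfl⟩
  have hadj : ∀ w ∈ KS, ∀ b, T.Adj b (par^[2] w) → b = par^[3] w ∨ b = par^[1] w :=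
    fun w hw b hb => hE.adj_cases R (hKS hw) (i := 1) (by norm_num) hb
  obtain ⟨φ₃, -, -, E₄⟩ := E₃.prefill KS par^[2] (fun w => g (κ w))
    (fun w hw h => (memD _).1 h (hK2 w hw))
    (fun w hw w' hw' h => (hE.disj w (hKS hw) w' (hKS hw') 2 (by norm_num) 2 (by norm_num) h).1)
    (fun w _ => hall _)
    (fun w hw w' hw' h => by
      rw [hlab, hlab] at h
      exact hκ.injOn hw hw' (hg.injOn (hκ.mapsTo hw) (hκ.mapsTo hw') h))
    (fun w hw u hu h => by
      rw [hlab, hlab] at h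
      -- An occupied vertex of `A` is a token, hence in `Z`, whereas the slots are filled from
      -- outside `Z`.
      have h1 := hga w hw
      rw [← h] at h1
      exact h1.2 (hZ ▸ Finset.mem_image_of_mem _
        (Palette.mem_used.2 ⟨hu, hPa _ (E₂.mem u hu) h1.1⟩)))
    (fun w hw b _ hb => by
      have h1 := hgf _ (hκ.mapsTo hw)
      rcases hadj w hw b hb with rfl | rfl
      · rw [e₂ w hw 3 (by simp), (s₁ w hw).1]; exact h1.1
      · rw [e₂ w hw 1 (by simp), (s₁ w hw).2]; exact h1.2)
    (fun w hw w' hw' h => by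
      rcases hadj w' hw' _ h with h | h
      · have := (hE.disj w (hKS hw) w' (hKS hw') 2 (by norm_num) 3 (by norm_num) h).2
        omega
      · have := (hE.disj w (hKS hw) w' (hKS hw') 2 (by norm_num) 1 (by norm_num) h).2
        omega)
  have hfin : ∀ v, v ∈ D ∪ KS.image par^[2] := by
    intro v
    rw [Finset.mem_union, memD, Finset.mem_image]
    by_cases hv : v ∈ pieces par KS {2}
    · obtain ⟨w, hw, i, hi, h⟩ := mem_pieces.1 hv
      rw [Finset.mem_singleton] at hi
      subst hi
      exact Or.inr ⟨w, hw, h⟩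
    · exact Or.inl hv
  exact ⟨φ₃, fun u v h => E₄.injOn u (hfin u) v (hfin v) h,
    fun u v h => E₄.adj u (hfin u) v (hfin v) h⟩

/-- The embedding of a spanning tree of bounded degree. -/
theorem Joined.exists_emb_of_isTree (hJ : Joined G m) (hT : T.IsTree)
    (hΔ : ∀ w, (nbr T w).card ≤ Δ) (hΔ1 : 1 ≤ Δ) (hcard : Fintype.card V = Fintype.card W)
    (hdeg : ∀ v, 240 * (Δ * m) ≤ (nbr G v).card)
    (hn : 10 ^ 9 * (Δ * m) ^ 2 ≤ Fintype.card V)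
    (hlog : Fintype.card V < 4 ^ (60 * (Δ * m))) :
    ∃ φ : W → V, Function.Injective φ ∧ ∀ u v, T.Adj u v → G.Adj (φ u) (φ v) := by
  obtain ⟨ρ⟩ := hT.connected.nonempty
  obtain ⟨par, dep, R⟩ := hT.exists_rooted ρ
  by_cases hL : 2000 * (Finset.univ.filter fun v => v ≠ ρ ∧ ∀ u, u ≠ ρ → par u ≠ v).card <
      Fintype.card V
  · exact hJ.exists_emb_of_paths R hΔ hΔ1 hcard hdeg hn hlog hL
  · refine hJ.exists_emb_of_leaves R hΔ hcard hdeg hn _ ?_ (fun v hv h => ?_) (not_lt.1 hL)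
    · simp
    · exact (Finset.mem_filter.1 h).2.2 v hv rfl

end Embedding

/-! ### From expanders to joined graphs, and the constants -/

section Expander
open scoped Classical

variable {V : Type*} [Fintype V] {G : SimpleGraph V} {n : ℕ} {d : ℝ}

lemma IsExpander.joined_ceil (h : IsExpander n d G) : Joined G ⌈(n : ℝ) / (2 * d)⌉₊ := by
  intro X Y hXY hX hY
  obtain ⟨X', hX', hXc⟩ := Finset.exists_subset_card_eq hX
  obtain ⟨Y', hY', hYc⟩ := Finset.exists_subset_card_eq hY
  have hpos := h.joined X' Y' (hXY.mono hX' hY') (hXc.trans hYc.symm)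
    (by rw [hXc]; exact Nat.le_ceil _)
  obtain ⟨⟨x, y⟩, hxy⟩ := Finset.card_pos.1 hpos
  rw [SimpleGraph.mem_interedges_iff] at hxy
  exact ⟨x, hX' hxy.1, y, hY' hxy.2.1, hxy.2.2⟩

lemma IsExpander.le_card_nbr (h : IsExpander n d G) (hd : 1 < (n : ℝ) / (2 * d)) (v : V) :
    d ≤ ((nbr G v).card : ℝ) := by
  have h1 := h.expands {v} (by simp) (by simpa using hd)
  rw [Finset.card_singleton, Nat.cast_one, mul_one] at h1
  refine h1.trans (Nat.cast_le.2 (Finset.card_le_card fun w hw => ?_))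
  obtain ⟨-, -, x, hx, hxw⟩ := Finset.mem_filter.1 hw
  rw [Finset.mem_singleton] at hx
  exact mem_nbr.2 (hx ▸ hxw)

lemma card_nbr_le_of_maxDegree_le {W : Type*} [Fintype W] {T : SimpleGraph W} {Δ : ℕ}
    (h : T.maxDegree ≤ Δ) (w : W) : (nbr T w).card ≤ Δ := by
  have : nbr T w = T.neighborFinset w := by ext; simp
  rw [this, SimpleGraph.card_neighborFinset_eq_degree]
  exact (T.degree_le_maxDegree w).trans h

lemma mul_sq_lt_four_pow {μ : ℕ} (hμ : 1 ≤ μ) : 4 * 10 ^ 10 * μ ^ 2 < 4 ^ (60 * μ) := by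
  have h1 : μ ^ 2 < 4 ^ μ := by
    calc μ ^ 2 < (2 ^ μ) ^ 2 := Nat.pow_lt_pow_left Nat.lt_two_pow_self (by norm_num)
      _ = 4 ^ μ := by rw [← pow_mul, mul_comm, pow_mul]; norm_num
  calc 4 * 10 ^ 10 * μ ^ 2 < 4 * 10 ^ 10 * 4 ^ μ := by omega
    _ ≤ 4 ^ (59 * 1) * 4 ^ μ := Nat.mul_le_mul_right _ (by norm_num)
    _ ≤ 4 ^ (59 * μ) * 4 ^ μ :=
      Nat.mul_le_mul_right _ (Nat.pow_le_pow_right (by norm_num) (by omega))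
    _ = 4 ^ (60 * μ) := by rw [← pow_add]; congr 1; ring

/-- With `s = √n`, the threshold `n / (2d)` equals `s / (200000 * Δ) ≥ 2`, so its ceiling `m` is at
most twice as large. Hence `s` lies between `100000 * (Δ * m)` and `200000 * (Δ * m)`, which gives
the quadratic bounds relating `n` to `Δ * m` and the degree bound. -/
theorem IsExpander.isUniversal {Δ : ℕ} (hΔ : (Δ : ℝ) ≤ 1 / 400000 * Real.sqrt n)
    (h : IsExpander n (100000 * (Δ : ℝ) * Real.sqrt n) G) :
    IsUniversal G (boundedDegreeTrees n Δ) := by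
  rintro T ⟨hT, hTΔ⟩
  obtain ⟨s, hs⟩ : ∃ s, s = Real.sqrt n := ⟨_, rfl⟩
  have hss : s * s = n := by rw [hs]; exact Real.mul_self_sqrt (Nat.cast_nonneg n)
  have hs0 : 0 ≤ s := hs ▸ Real.sqrt_nonneg _
  rw [← hs] at h hΔ
  have hd := h.d_pos
  have hΔ1 : 1 ≤ Δ := by
    by_contra hlt
    obtain rfl : Δ = 0 := by omega
    simp at hd
  have hΔ1' : (1 : ℝ) ≤ Δ := by exact_mod_cast hΔ1
  have hspos : 0 < s := by nlinarith
  have hx : (n : ℝ) / (2 * (100000 * (Δ : ℝ) * s)) = s / (200000 * Δ) := by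
    rw [← hss]; field_simp; norm_num
  obtain ⟨m, hm⟩ : ∃ m, m = ⌈(n : ℝ) / (2 * (100000 * (Δ : ℝ) * s))⌉₊ := ⟨_, rfl⟩
  have hJ := h.joined_ceil
  rw [← hm] at hJ
  have hx2 : 2 ≤ s / (200000 * Δ) := by
    rw [le_div_iff₀ (by positivity)]; linarith
  have hmx : s / (200000 * Δ) ≤ m := by
    rw [hm, hx]; exact Nat.le_ceil _
  have hmx' : (m : ℝ) < s / (200000 * Δ) + 1 := by
    rw [hm, hx]; exact Nat.ceil_lt_add_one (by linarith)
  have hlow : s ≤ 200000 * (Δ * m : ℝ) := by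
    rw [div_le_iff₀ (by positivity)] at hmx
    linarith
  have hupp : 100000 * (Δ * m : ℝ) ≤ s := by
    have h1 : (m : ℝ) ≤ 2 * (s / (200000 * Δ)) := by linarith
    have h2 : 2 * (s / (200000 * Δ)) = s / (100000 * Δ) := by field_simp; norm_num
    rw [h2, le_div_iff₀ (by positivity)] at h1
    linarith
  have hm0 := hJ.pos
  have hμ1 : 1 ≤ Δ * m := Nat.mul_pos hΔ1 hm0
  have hμ1' : (1 : ℝ) ≤ Δ * m := by exact_mod_cast hμ1
  have hn1 : 10 ^ 9 * (Δ * m) ^ 2 ≤ n := by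
    have : (10 ^ 9 * (Δ * m) ^ 2 : ℝ) ≤ n := by rw [← hss]; nlinarith
    exact_mod_cast this
  have hn2 : n ≤ 4 * 10 ^ 10 * (Δ * m) ^ 2 := by
    have : (n : ℝ) ≤ 4 * 10 ^ 10 * (Δ * m) ^ 2 := by rw [← hss]; nlinarith
    exact_mod_cast this
  obtain ⟨φ, hφ, hφa⟩ := hJ.exists_emb_of_isTree hT (card_nbr_le_of_maxDegree_le hTΔ) hΔ1
    (by rw [h.card_eq, Fintype.card_fin]) (fun v => by
      have h1 := h.le_card_nbr (by rw [hx]; linarith) v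
      have h2 : (240 * (Δ * m) : ℝ) ≤ (nbr G v).card := by nlinarith
      exact_mod_cast h2) (by rw [h.card_eq]; exact hn1)
    (by rw [h.card_eq]; exact hn2.trans_lt (mul_sq_lt_four_pow hμ1))
  exact ⟨⟨⟨φ, fun {a b} hab => hφa a b hab⟩, hφ⟩⟩

end Expander

end TreeUniversality

theorem mainTheorem2 :
    ∃ C c : ℝ, 0 < C ∧ 0 < c ∧ ∃ n₀ : ℕ, ∀ n : ℕ, n₀ ≤ n →
      ∀ Δ : ℕ, (Δ : ℝ) ≤ c * Real.sqrt (n : ℝ) →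
        ∀ (V : Type*) [Fintype V] (G : SimpleGraph V),
          TreeUniversality.IsExpander n (C * (Δ : ℝ) * Real.sqrt (n : ℝ)) G →
            TreeUniversality.IsUniversal G (TreeUniversality.boundedDegreeTrees n Δ) := by
  -- No lower bound on `n` is needed: positivity of the expansion parameter forces `1 ≤ Δ`, and then
  -- `Δ ≤ c√n` makes `n` large.
  refine ⟨100000, 1 / 400000, by norm_num, by norm_num, 0, fun n _ Δ hΔ V _ G h => ?_⟩
  exact h.isUniversal hΔ
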